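/- Let $k\ge 3$ be odd. If there is $\epsilon>0$ such that $\#k$-SUM can be solved in time $O(n^{\lceil k/2\rceil-\epsilon})$, then for every problem $P$ in $\mathsf{FOP}_{\mathbb Z}(\exists^k)$ there is $\epsilon'>0$ such that the witnesses of $P$ can be counted in time $O(n^{\lceil k/2\rceil-\epsilon'})$. Here a problem $P$ in $\mathsf{FOP}_{\mathbb Z}(\exists^k)$ is given by dimensions $d_1,\dots,d_k$, a number $l$ and a quantifier-free linear integer arithmetic formula $\psi$ (a Boolean combination of linear equations and inequalities with integer coefficients) in the coordinates of vectors $x_1\in\mathbb Z^{d_1},\dots,x_k\in\mathbb Z^{d_k}$ and in $t_1,\dots,t_l$. An input consists of finite sets $A_1\subseteq\mathbb Z^{d_1},\dots,A_k\subseteq\mathbb Z^{d_k}$ and integers $\hat t_1,\dots,\hat t_l$. A witness is a tuple $(a_1,\dots,a_k)\in A_1\times\dots\times A_k$ satisfying $\psi$ with $t_1,\dots,t_l$ replaced by $\hat t_1,\dots,\hat t_l$, and counting the witnesses of $P$ means computing their number. In $\#k$-SUM the input consists of finite sets $A_1,\dots,A_k\subseteq\mathbb Z$ and a target $t\in\mathbb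 Z$, and the task is to compute the number of $(a_1,\dots,a_k)\in A_1\times\dots\times A_k$ with $a_1+\dots+a_k=t$. The input size is $n=\max_i|A_i|$, and all input numbers lie in a polynomially sized universe $\{-n^c,\dots,n^c\}$. Running times are worst-case running times of deterministic algorithms on a word RAM with words of $O(\log n)$ bits. A problem can be solved in time $O(n^e)$ if for every constant $c$ there is such an algorithm for the inputs with numbers in $\{-n^c,\dots,n^c\}$; the algorithm and the constants hidden in the $O$-notation may depend on $c$, the exponent $e$ may not. -/

import Mathlib

namespace WordRAM

/-! ## The word RAM

A program works on integer registers `0, 1, 2, …` and on finitely many integer arrays `0, 1, 2, …`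
with constant-time indexed access.  Every evaluated subexpression is charged one time unit, as is
every executed assignment, store and test.  The word size enters through a bound `B`: an execution
exists only if every value that is computed, read, stored or used as an address lies in `[-B, B]`. -/

/-- Unit-cost operations on words. -/
inductive BinOp
  | add | sub | mul | div | mod | lt | eq | land | lor | xor | shl | shr

/-- Integer division rounds down for positive divisors, and division by zero returns `0`;
comparisons return `1` for true and `0` for false. -/
def BinOp.eval : BinOp → ℤ → ℤ → ℤ
  | .add, a, b => a + b
  | .sub, a, b => a - b
  | .mul, a, b => a * b
  | .div, a, b => a / b
  | .mod, a, b => a % b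
  | .lt, a, b => if a < b then 1 else 0
  | .eq, a, b => if a = b then 1 else 0
  | .land, a, b => Int.land a b
  | .lor, a, b => Int.lor a b
  | .xor, a, b => Int.xor a b
  | .shl, a, b => a * 2 ^ b.toNat
  | .shr, a, b => a / 2 ^ b.toNat

/-- Contents of the registers and of the arrays. -/
@[ext]
structure State where
  reg : ℕ → ℤ
  mem : ℕ → ℤ → ℤ

/-- The state after writing `v` into register `x`. -/
def State.setReg (σ : State) (x : ℕ) (v : ℤ) : State where
  reg := Function.update σ.reg x v
  mem := σ.mem

/-- The state after writing `v` into cell `i` of array `A`. -/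
def State.setMem (σ : State) (A : ℕ) (i v : ℤ) : State where
  reg := σ.reg
  mem := Function.update σ.mem A (Function.update (σ.mem A) i v)

/-- Expressions: constants, registers, array cells, operations. -/
inductive Expr
  | const (v : ℤ)
  | reg (x : ℕ)
  | read (A : ℕ) (i : Expr)
  | bin (op : BinOp) (e₁ e₂ : Expr)

/-- The value of an expression. -/
def Expr.eval (σ : State) : Expr → ℤ
  | .const v => v
  | .reg x => σ.reg x
  | .read A i => σ.mem A (i.eval σ)
  | .bin op e₁ e₂ => op.eval (e₁.eval σ) (e₂.eval σ)

/-- The evaluation time: the number of subexpressions. -/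
def Expr.cost : Expr → ℕ
  | .const _ => 1
  | .reg _ => 1
  | .read _ i => i.cost + 1
  | .bin _ e₁ e₂ => e₁.cost + e₂.cost + 1

/-- All values that occur in the evaluation fit into a word. -/
def Expr.Fits (B : ℤ) (σ : State) : Expr → Prop
  | .const v => |v| ≤ B
  | .reg x => |σ.reg x| ≤ B
  | .read A i => i.Fits B σ ∧ |σ.mem A (i.eval σ)| ≤ B
  | .bin op e₁ e₂ => e₁.Fits B σ ∧ e₂.Fits B σ ∧ |op.eval (e₁.eval σ) (e₂.eval σ)| ≤ B

/-- Programs. -/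
inductive Prog
  | skip
  | assign (x : ℕ) (e : Expr)
  | store (A : ℕ) (i e : Expr)
  | seq (p q : Prog)
  | ite (e : Expr) (p q : Prog)
  | loop (e : Expr) (p : Prog)

/-- `Exec B p σ t σ'`: with words in `[-B, B]`, the program `p` started in `σ` halts after exactly
`t` time units in `σ'`.  Tests succeed on nonzero values; `loop e p` is "while `e` do `p`". -/
inductive Exec (B : ℤ) : Prog → State → ℕ → State → Prop
  | skip (σ : State) : Exec B .skip σ 1 σ
  | assign (σ : State) (x : ℕ) (e : Expr) (he : e.Fits B σ) :
      Exec B (.assign x e) σ (e.cost + 1) (σ.setReg x (e.eval σ))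
  | store (σ : State) (A : ℕ) (i e : Expr) (hi : i.Fits B σ) (he : e.Fits B σ) :
      Exec B (.store A i e) σ (i.cost + e.cost + 1) (σ.setMem A (i.eval σ) (e.eval σ))
  | seq {p q : Prog} {σ σ' σ'' : State} {t t' : ℕ} (hp : Exec B p σ t σ')
      (hq : Exec B q σ' t' σ'') : Exec B (.seq p q) σ (t + t') σ''
  | ite_true {e : Expr} {p : Prog} (q : Prog) {σ σ' : State} {t : ℕ} (he : e.Fits B σ)
      (h : e.eval σ ≠ 0) (hp : Exec B p σ t σ') : Exec B (.ite e p q) σ (e.cost + 1 + t) σ'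
  | ite_false {e : Expr} (p : Prog) {q : Prog} {σ σ' : State} {t : ℕ} (he : e.Fits B σ)
      (h : e.eval σ = 0) (hq : Exec B q σ t σ') : Exec B (.ite e p q) σ (e.cost + 1 + t) σ'
  | loop_true {e : Expr} {p : Prog} {σ σ' σ'' : State} {t t' : ℕ} (he : e.Fits B σ)
      (h : e.eval σ ≠ 0) (hp : Exec B p σ t σ') (hl : Exec B (.loop e p) σ' t' σ'') :
      Exec B (.loop e p) σ (e.cost + 1 + t + t') σ''
  | loop_false {e : Expr} (p : Prog) {σ : State} (he : e.Fits B σ) (h : e.eval σ = 0) :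
      Exec B (.loop e p) σ (e.cost + 1) σ

end WordRAM

/-! ## Inputs and counting problems -/

/-- An input: finite sets `A₁ ⊆ ℤ^{d₁}, …, A_k ⊆ ℤ^{d_k}` and integers `t₁, …, t_l`. -/
structure Input {k : ℕ} (d : Fin k → ℕ) (l : ℕ) where
  A : (i : Fin k) → Finset (Fin (d i) → ℤ)
  t : Fin l → ℤ

namespace Input

variable {k : ℕ} {d : Fin k → ℕ} {l : ℕ}

/-- The input size `n = maxᵢ |Aᵢ|`. -/
def size (I : Input d l) : ℕ := Finset.univ.sup fun i => (I.A i).card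

/-- All input numbers lie in `{-n^c, …, n^c}`, where `n` is the input size. -/
def InUniverse (I : Input d l) (c : ℕ) : Prop :=
  (∀ i, ∀ a ∈ I.A i, ∀ s, |a s| ≤ (I.size : ℤ) ^ c) ∧ ∀ r, |I.t r| ≤ (I.size : ℤ) ^ c

/-- `σ` is an initial state that presents the input: register `i < k` holds `|Aᵢ|`, register `k + r`
holds `t_r`, array `i < k` lists the coordinate vectors of the elements of `Aᵢ` one after the other
in some order without repetition, and everything else is `0`. -/
def Encodes (I : Input d l) (σ : WordRAM.State) : Prop :=
  (∀ i : Fin k, σ.reg i = (I.A i).card) ∧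
  (∀ r : Fin l, σ.reg (k + r) = I.t r) ∧
  (∀ x, k + l ≤ x → σ.reg x = 0) ∧
  (∃ e : (i : Fin k) → Fin (I.A i).card ≃ {a // a ∈ I.A i},
    ∀ (i : Fin k) (j : Fin (I.A i).card) (s : Fin (d i)),
      σ.mem i ((j : ℤ) * (d i : ℤ) + (s : ℤ)) = (e i j).1 s) ∧
  (∀ (b : ℕ) (a : ℤ),
    (¬ ∃ (i : Fin k) (j : Fin (I.A i).card) (s : Fin (d i)),
      b = i ∧ a = (j : ℤ) * (d i : ℤ) + (s : ℤ)) → σ.mem b a = 0)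

/-- The number of witnesses: tuples in `A₁ × ⋯ × A_k` that satisfy `W` with the given `t`. -/
noncomputable def numWitnesses (I : Input d l)
    (W : ((i : Fin k) → Fin (d i) → ℤ) → (Fin l → ℤ) → Prop) : ℕ :=
  Set.ncard {a : (i : Fin k) → Fin (d i) → ℤ | (∀ i, a i ∈ I.A i) ∧ W a I.t}

end Input

/-- The witnesses for `W` can be counted in time `O(n ^ e)` on a word RAM with `O(log n)`-bit words:
for every universe bound `n^c` there is a program that, on every input of size `n` with numbers in
this universe, halts within `C * n ^ e` time units (`C` if `n = 0`), never leaves the words of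
absolute value at most `(n + 2) ^ w`, and leaves the number of witnesses in register `0`.
The program and the constants `C`, `w` may depend on `c`, but not on the input. -/
def CountableInTime {k : ℕ} {d : Fin k → ℕ} {l : ℕ}
    (W : ((i : Fin k) → Fin (d i) → ℤ) → (Fin l → ℤ) → Prop) (e : ℝ) : Prop :=
  ∀ c : ℕ, ∃ (p : WordRAM.Prog) (w : ℕ) (C : ℝ),
    ∀ (I : Input d l) (σ : WordRAM.State), I.InUniverse c → I.Encodes σ →
      ∃ (T : ℕ) (σ' : WordRAM.State),
        WordRAM.Exec (((I.size + 2) ^ w : ℕ) : ℤ) p σ T σ' ∧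
        (T : ℝ) ≤ C * (max I.size 1 : ℝ) ^ e ∧
        σ'.reg 0 = I.numWitnesses W

/-- `#k`-SUM: sets of integers `A₁, …, A_k` and a target `t`; witnesses have `a₁ + ⋯ + a_k = t`. -/
def IsKSumWitness (k : ℕ) (a : Fin k → Fin 1 → ℤ) (t : Fin 1 → ℤ) : Prop :=
  ∑ i, a i 0 = t 0

/-! ## Quantifier-free linear integer arithmetic -/

/-- Linear terms `const + ∑ v, coeff v * v` with integer coefficients. -/
structure LinTerm (V : Type) where
  coeff : V → ℤ
  const : ℤ

/-- The value of a linear term. -/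
def LinTerm.eval {V : Type} [Fintype V] (τ : LinTerm V) (x : V → ℤ) : ℤ :=
  τ.const + ∑ v, τ.coeff v * x v

/-- Quantifier-free linear arithmetic formulas. -/
inductive LinFormula (V : Type)
  | nonneg (τ : LinTerm V)
  | isZero (τ : LinTerm V)
  | neg (φ : LinFormula V)
  | conj (φ ψ : LinFormula V)
  | disj (φ ψ : LinFormula V)

/-- Satisfaction of a formula by an integer assignment. -/
def LinFormula.Holds {V : Type} [Fintype V] (x : V → ℤ) : LinFormula V → Prop
  | .nonneg τ => 0 ≤ τ.eval x
  | .isZero τ => τ.eval x = 0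
  | .neg φ => ¬ φ.Holds x
  | .conj φ ψ => φ.Holds x ∧ ψ.Holds x
  | .disj φ ψ => φ.Holds x ∨ ψ.Holds x

/-- The variables: the coordinates `xᵢ[s]` of the quantified vectors, and the free variables. -/
abbrev FOPVar {k : ℕ} (d : Fin k → ℕ) (l : ℕ) : Type := ((i : Fin k) × Fin (d i)) ⊕ Fin l

/-- Witnesses of `∃ x₁ ∈ A₁ … ∃ x_k ∈ A_k : ψ` with the free variables replaced by `t`. -/
def IsFOPWitness {k : ℕ} {d : Fin k → ℕ} {l : ℕ} (ψ : LinFormula (FOPVar d l))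
    (a : (i : Fin k) → Fin (d i) → ℤ) (t : Fin l → ℤ) : Prop :=
  ψ.Holds (Sum.elim (fun v => a v.1 v.2) t)

/-! The formula is a Boolean function `F` of the signs of finitely many linear terms, and every term
is a constant plus a sum of contributions x_1(a_1) + ... + x_k(a_k), one from each set. The main
difficulty is to replace a sign condition by equations; rounding does this. After a change of sign
and constant the condition reads c + x_1 + ... + x_k > 0. Let S_l be the sum of these summands, each
divided by 2^l and rounded down. Then 2 S_{l+1} ≤ S_l ≤ 2 S_{l+1} + k + 1, so positivity passes to
lower levels, and S_L ≤ 0 for some L = O(log n). Hence exactly one level satisfies S_{l+1} ≤ 0 <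
S_l, and at this level both values lie in a range that depends only on k.

A digit below D = O(log n) records the sign, the level and the two values. Every tuple matches
exactly one digit (`existsUnique_digMatch`), and a match amounts to two equations between sums of
rounded contributions. One digit for each term gives a system of equations, which is packed into a
single equation in a large base M (`sum_packPairs_eq_iff`). The number of witnesses is therefore the
sum, over all digit vectors whose signs satisfy `F`, of the number of solutions of one k-SUM
equation (`sum_digits_eq_card`).

These equations range over multisets, since different vectors may have the same packed value,
whereas #k-SUM takes sets. Multiplicities are split into binary digits: for positions b_1, ..., b_k
the i-th set consists of the values whose multiplicity has digit 1 at b_i, and the solutions get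
weight 2^(b_1 + ... + b_k) (`sum_card_bitValues`). Such sets may be too small for their numbers to
lie in a universe polynomial in the instance size. Hence N values that are too large to occur in a
solution are added to each set (`card_filter_sum_union`); the size is then between N and 2N.

With nA terms there are D^(nA + k) rounds, a power of log n. A round costs one call and linear time
for building the instance, so half of the saved exponent pays for the number of rounds. On the
machine, an execution with words in [-W, W] cannot leave a window of half-width W. The called
program is therefore relocated to a fresh window of zero cells in every round (`Exec.reloc`,
`run_round`). `Setup.run` assembles correctness and time for given parameters, `exists_setup`
chooses the parameters as fixed powers of N, and `exists_time_bound` absorbs the logarithms. -/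

namespace WordRAM

/-! ## Bounds for expressions -/

/-- Operations whose results are polynomially bounded in their arguments. -/
def BinOp.Tame : BinOp → Prop
  | .shl | .land | .lor | .xor => False
  | _ => True

/-- Only tame operations occur, and all constants, registers and cells that are read are bounded
by `X`. -/
def Expr.Poly (X : ℤ) (σ : State) : Expr → Prop
  | .const v => |v| ≤ X
  | .reg x => |σ.reg x| ≤ X
  | .read A i => i.Poly X σ ∧ |σ.mem A (i.eval σ)| ≤ X
  | .bin op e₁ e₂ => op.Tame ∧ e₁.Poly X σ ∧ e₂.Poly X σ

/-- Only tame operations occur, and all constants are bounded by `X`. -/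
def Expr.Tame (X : ℤ) : Expr → Prop
  | .const v => |v| ≤ X
  | .reg _ => True
  | .read _ i => i.Tame X
  | .bin op e₁ e₂ => op.Tame ∧ e₁.Tame X ∧ e₂.Tame X

/-- All registers and cells are bounded by `X`. -/
def State.Bdd (X : ℤ) (σ : State) : Prop :=
  (∀ x, |σ.reg x| ≤ X) ∧ ∀ A i, |σ.mem A i| ≤ X

theorem Expr.Tame.poly {X : ℤ} {σ : State} (hσ : σ.Bdd X) {e : Expr} (he : e.Tame X) :
    e.Poly X σ := by
  induction e with
  | const v => exact he
  | reg x => exact hσ.1 x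
  | read A i ih => exact ⟨ih he, hσ.2 _ _⟩
  | bin op a b iha ihb => exact ⟨he.1, iha he.2.1, ihb he.2.2⟩

theorem Expr.Tame.mono {X Y : ℤ} (h : X ≤ Y) {e : Expr} (he : e.Tame X) : e.Tame Y := by
  induction e with
  | const v => exact le_trans he h
  | reg x => trivial
  | read A i ih => exact ih he
  | bin op a b iha ihb => exact ⟨he.1, iha he.2.1, ihb he.2.2⟩

/-- Since P, Q ≥ 1, the product dominates each bound, and the factor 2 takes care of sums and
differences. Quotients, remainders and right shifts never exceed one of the arguments, also for
divisor 0. -/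
theorem BinOp.Tame.abs_eval_le {op : BinOp} (hop : op.Tame) {a b P Q : ℤ} (hP : 1 ≤ P)
    (hQ : 1 ≤ Q) (ha : |a| ≤ P) (hb : |b| ≤ Q) : |op.eval a b| ≤ 2 * (P * Q) := by
  have h1 : P ≤ P * Q := le_mul_of_one_le_right (by omega) hQ
  have h2 : Q ≤ P * Q := le_mul_of_one_le_left (by omega) hP
  cases op <;> simp only [BinOp.Tame] at hop <;> simp only [BinOp.eval]
  · exact (abs_add_le a b).trans (by omega)
  · exact (abs_sub a b).trans (by omega)
  · rw [abs_mul]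
    have : |a| * |b| ≤ P * Q := mul_le_mul ha hb (abs_nonneg _) (by omega)
    omega
  · have : |a / b| ≤ |a| := Int.abs_ediv_le_abs a b
    omega
  · rcases eq_or_ne b 0 with rfl | hb0
    · simp; omega
    · have h3 := Int.emod_nonneg a hb0
      have h4 := Int.emod_lt_abs a hb0
      rw [abs_of_nonneg h3]; omega
  · split_ifs <;> simp <;> omega
  · split_ifs <;> simp <;> omega
  · have : |a / 2 ^ b.toNat| ≤ |a| := Int.abs_ediv_le_abs a _
    omega

/-- Exponents add up along the expression tree, and the unit that an operation adds to the cost pays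
for the factor 2 because X ≥ 2. For a fixed expression this is a polynomial word bound. -/
theorem Expr.Poly.bounds {X : ℤ} (hX : 2 ≤ X) {σ : State} {e : Expr} (he : e.Poly X σ) :
    |e.eval σ| ≤ X ^ e.cost ∧ ∀ B, X ^ e.cost ≤ B → e.Fits B σ := by
  have hp : ∀ n : ℕ, (1 : ℤ) ≤ X ^ n := fun n => one_le_pow₀ (by omega)
  have hle : ∀ {m n : ℕ}, m ≤ n → X ^ m ≤ X ^ n := fun h => pow_le_pow_right₀ (by omega) h
  induction e with
  | const v => exact ⟨by simpa [Expr.eval, Expr.cost, Expr.Poly] using he, fun B hB => by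
      simp only [Expr.cost, pow_one] at hB; exact le_trans he hB⟩
  | reg x => exact ⟨by simpa [Expr.eval, Expr.cost, Expr.Poly] using he, fun B hB => by
      simp only [Expr.cost, pow_one] at hB; exact le_trans he hB⟩
  | read A i ih =>
    have h1 : X ≤ X ^ (i.cost + 1) := by simpa using hle (m := 1) (n := i.cost + 1) (by omega)
    refine ⟨he.2.trans h1, fun B hB => ⟨(ih he.1).2 B ?_, ?_⟩⟩
    · exact (hle (by simp [Expr.cost])).trans hB
    · exact (he.2.trans h1).trans hB
  | bin op a b iha ihb =>
    have ha := iha he.2.1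
    have hb := ihb he.2.2
    have h0 : |op.eval (a.eval σ) (b.eval σ)| ≤ X ^ (a.cost + b.cost + 1) := by
      refine (he.1.abs_eval_le (hp a.cost) (hp b.cost) ha.1 hb.1).trans ?_
      rw [pow_succ, pow_add, mul_comm]
      exact mul_le_mul_of_nonneg_left hX (by positivity)
    refine ⟨h0, fun B hB => ⟨ha.2 B ?_, hb.2 B ?_, h0.trans hB⟩⟩
    · exact (hle (by simp [Expr.cost]; omega)).trans hB
    · exact (hle (by simp [Expr.cost]; omega)).trans hB

theorem Expr.Tame.fits {X B : ℤ} (hX : 2 ≤ X) {κ : ℕ} (hB : X ^ κ ≤ B) {σ : State}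
    (hσ : σ.Bdd X) {e : Expr} (he : e.Tame X) (hc : e.cost ≤ κ) : e.Fits B σ :=
  ((he.poly hσ).bounds hX).2 B ((pow_le_pow_right₀ (by omega) hc).trans hB)

theorem Expr.Fits.abs_eval_le {B : ℤ} {σ : State} {e : Expr} (h : e.Fits B σ) :
    |e.eval σ| ≤ B := by
  cases e with
  | const v => exact h
  | reg x => exact h
  | read A i => exact h.2
  | bin op a b => exact h.2.2

theorem Expr.Fits.mono {B B' : ℤ} (hB : B ≤ B') {σ : State} {e : Expr} (h : e.Fits B σ) :
    e.Fits B' σ := by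
  induction e with
  | const v => exact le_trans h hB
  | reg x => exact le_trans h hB
  | read A i ih => exact ⟨ih h.1, h.2.trans hB⟩
  | bin op a b iha ihb => exact ⟨iha h.1, ihb h.2.1, h.2.2.trans hB⟩

theorem Exec.mono {B B' : ℤ} (hB : B ≤ B') {p : Prog} {σ σ' : State} {t : ℕ}
    (h : Exec B p σ t σ') : Exec B' p σ t σ' := by
  induction h with
  | skip σ => exact .skip σ
  | assign σ x e he => exact .assign σ x e (he.mono hB)
  | store σ A i e hi he => exact .store σ A i e (hi.mono hB) (he.mono hB)
  | seq _ _ ih₁ ih₂ => exact .seq ih₁ ih₂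
  | ite_true q he h _ ih => exact .ite_true q (he.mono hB) h ih
  | ite_false p he h _ ih => exact .ite_false p (he.mono hB) h ih
  | loop_true he h _ _ ih₁ ih₂ => exact .loop_true (he.mono hB) h ih₁ ih₂
  | loop_false p he h => exact .loop_false p (he.mono hB) h

theorem State.Bdd.setReg {X : ℤ} {σ : State} (h : σ.Bdd X) {x : ℕ} {v : ℤ} (hv : |v| ≤ X) :
    (σ.setReg x v).Bdd X := by
  refine ⟨fun y => ?_, h.2⟩
  simp only [State.setReg, Function.update_apply]
  split_ifs
  exacts [hv, h.1 y]

theorem State.Bdd.setMem {X : ℤ} {σ : State} (h : σ.Bdd X) {A : ℕ} {i v : ℤ} (hv : |v| ≤ X) :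
    (σ.setMem A i v).Bdd X := by
  refine ⟨h.1, fun A' z => ?_⟩
  simp only [State.setMem, Function.update_apply]
  split_ifs with h1
  · rw [Function.update_apply]
    split_ifs
    exacts [hv, h.2 A z]
  · exact h.2 A' z

/-- Every value written is the value of an expression that fits into words of size B. -/
theorem Exec.bdd {B X : ℤ} (hB : B ≤ X) {p : Prog} {σ σ' : State} {t : ℕ}
    (h : Exec B p σ t σ') (hσ : σ.Bdd X) : σ'.Bdd X := by
  induction h with
  | skip σ => exact hσ
  | assign σ x e he => exact hσ.setReg (he.abs_eval_le.trans hB)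
  | store σ A i e hi he => exact hσ.setMem (he.abs_eval_le.trans hB)
  | seq _ _ ih₁ ih₂ => exact ih₂ (ih₁ hσ)
  | ite_true q he h _ ih => exact ih hσ
  | ite_false p he h _ ih => exact ih hσ
  | loop_true he h _ _ ih₁ ih₂ => exact ih₂ (ih₁ hσ)
  | loop_false p he h => exact hσ

@[simp] theorem State.setReg_reg (σ : State) (x : ℕ) (v : ℤ) (y : ℕ) :
    (σ.setReg x v).reg y = if y = x then v else σ.reg y := by
  simp [State.setReg, Function.update_apply]

@[simp] theorem State.setReg_mem (σ : State) (x : ℕ) (v : ℤ) : (σ.setReg x v).mem = σ.mem := rfl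

@[simp] theorem State.setMem_reg (σ : State) (A : ℕ) (i v : ℤ) : (σ.setMem A i v).reg = σ.reg := rfl

@[simp] theorem State.setMem_mem (σ : State) (A : ℕ) (i v : ℤ) (A' : ℕ) (z : ℤ) :
    (σ.setMem A i v).mem A' z = if A' = A ∧ z = i then v else σ.mem A' z := by
  simp only [State.setMem, Function.update_apply]
  by_cases h : A' = A
  · subst h; simp [Function.update_apply]
  · simp [h]

/-! ## Total correctness -/

/-- `p` started in `σ` halts within `T` time units in a state that satisfies `Q`. -/
def Run (B : ℤ) (p : Prog) (σ : State) (T : ℕ) (Q : State → Prop) : Prop :=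
  ∃ t σ', Exec B p σ t σ' ∧ t ≤ T ∧ Q σ'

namespace Run

variable {B : ℤ} {p q : Prog} {σ : State} {T T' : ℕ} {Q Q' : State → Prop}

theorem mono (h : Run B p σ T Q) (hT : T ≤ T') (hQ : ∀ σ', Q σ' → Q' σ') : Run B p σ T' Q' := by
  obtain ⟨t, σ', h1, h2, h3⟩ := h
  exact ⟨t, σ', h1, h2.trans hT, hQ _ h3⟩

theorem skip (h : Q σ) : Run B .skip σ 1 Q := ⟨_, _, .skip σ, le_rfl, h⟩

theorem assign {x : ℕ} {e : Expr} (he : e.Fits B σ) (h : Q (σ.setReg x (e.eval σ))) :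
    Run B (.assign x e) σ (e.cost + 1) Q := ⟨_, _, .assign σ x e he, le_rfl, h⟩

theorem store {A : ℕ} {i e : Expr} (hi : i.Fits B σ) (he : e.Fits B σ)
    (h : Q (σ.setMem A (i.eval σ) (e.eval σ))) :
    Run B (.store A i e) σ (i.cost + e.cost + 1) Q := ⟨_, _, .store σ A i e hi he, le_rfl, h⟩

theorem seq (h : Run B p σ T fun σ' => Run B q σ' T' Q) : Run B (.seq p q) σ (T + T') Q := by
  obtain ⟨t, σ', h1, h2, t', σ'', h3, h4, h5⟩ := h
  exact ⟨_, _, .seq h1 h3, add_le_add h2 h4, h5⟩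

theorem ite {e : Expr} (he : e.Fits B σ) (h₁ : e.eval σ ≠ 0 → Run B p σ T Q)
    (h₂ : e.eval σ = 0 → Run B q σ T Q) : Run B (.ite e p q) σ (e.cost + 1 + T) Q := by
  by_cases h : e.eval σ = 0
  · obtain ⟨t, σ', h3, h4, h5⟩ := h₂ h
    exact ⟨_, _, .ite_false p he h h3, by omega, h5⟩
  · obtain ⟨t, σ', h3, h4, h5⟩ := h₁ h
    exact ⟨_, _, .ite_true q he h h3, by omega, h5⟩

/-- A loop with invariant `J` that makes exactly `n` rounds. -/
theorem loop {e : Expr} (n : ℕ) (J : ℕ → State → Prop)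
    (hfits : ∀ i ≤ n, ∀ σ, J i σ → e.Fits B σ)
    (htest : ∀ i ≤ n, ∀ σ, J i σ → (e.eval σ ≠ 0 ↔ i < n))
    (hbody : ∀ i < n, ∀ σ, J i σ → Run B p σ T (J (i + 1))) (h0 : J 0 σ) :
    Run B (.loop e p) σ (n * (e.cost + 1 + T) + (e.cost + 1)) (J n) := by
  suffices H : ∀ m i, i + m = n → ∀ σ, J i σ →
      Run B (.loop e p) σ (m * (e.cost + 1 + T) + (e.cost + 1)) (J n) from H n 0 (by simp) σ h0
  intro m
  induction m with
  | zero =>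
    intro i hi σ hJ
    obtain rfl : i = n := by omega
    refine ⟨_, _, .loop_false p (hfits i le_rfl σ hJ) ?_, by simp, hJ⟩
    by_contra h
    exact absurd ((htest i le_rfl σ hJ).1 h) (by omega)
  | succ m ih =>
    intro i hi σ hJ
    obtain ⟨t, σ', h1, h2, h3⟩ := hbody i (by omega) σ hJ
    obtain ⟨t', σ'', h4, h5, h6⟩ := ih (i + 1) (by omega) σ' h3
    refine ⟨_, _, .loop_true (hfits i (by omega) σ hJ)
      ((htest i (by omega) σ hJ).2 (by omega)) h1 h4, ?_, h6⟩
    rw [Nat.succ_mul]; omega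

end Run

/-! ## Relocation

A program is moved into a window of the arrays `A₀, A₀ + 1, …`, whose centre is held by register
`ro`; its registers live in array `A₀`. -/

/-- Strict upper bound on the registers that occur. -/
def Expr.regBound : Expr → ℕ
  | .const _ => 0
  | .reg x => x + 1
  | .read _ i => i.regBound
  | .bin _ a b => max a.regBound b.regBound

/-- Strict upper bound on the registers that occur. -/
def Prog.regBound : Prog → ℕ
  | .skip => 0
  | .assign x e => max (x + 1) e.regBound
  | .store _ i e => max i.regBound e.regBound
  | .seq p q => max p.regBound q.regBound
  | .ite e p q => max e.regBound (max p.regBound q.regBound)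
  | .loop e p => max e.regBound p.regBound

/-- The relocated expression. -/
def Expr.reloc (A₀ ro : ℕ) : Expr → Expr
  | .const v => .const v
  | .reg x => .read A₀ (.bin .add (.const x) (.reg ro))
  | .read A i => .read (A₀ + 1 + A) (.bin .add (i.reloc A₀ ro) (.reg ro))
  | .bin op a b => .bin op (a.reloc A₀ ro) (b.reloc A₀ ro)

/-- The relocated program. -/
def Prog.reloc (A₀ ro : ℕ) : Prog → Prog
  | .skip => .skip
  | .assign x e => .store A₀ (.bin .add (.const x) (.reg ro)) (e.reloc A₀ ro)
  | .store A i e => .store (A₀ + 1 + A) (.bin .add (i.reloc A₀ ro) (.reg ro)) (e.reloc A₀ ro)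
  | .seq p q => .seq (p.reloc A₀ ro) (q.reloc A₀ ro)
  | .ite e p q => .ite (e.reloc A₀ ro) (p.reloc A₀ ro) (q.reloc A₀ ro)
  | .loop e p => .loop (e.reloc A₀ ro) (p.reloc A₀ ro)

/-- The window of half-width `W` around `off` in `σ` presents the state `τ`. -/
structure Presents (A₀ ro : ℕ) (W off : ℤ) (τ σ : State) : Prop where
  off_eq : σ.reg ro = off
  reg_eq : ∀ x : ℕ, (x : ℤ) ≤ W → σ.mem A₀ (x + off) = τ.reg x
  mem_eq : ∀ A i, |i| ≤ W → σ.mem (A₀ + 1 + A) (i + off) = τ.mem A i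

theorem Expr.cost_reloc_le (A₀ ro : ℕ) (e : Expr) : (e.reloc A₀ ro).cost ≤ 4 * e.cost := by
  induction e with
  | const v => simp [Expr.reloc, Expr.cost]
  | reg x => simp [Expr.reloc, Expr.cost]
  | read A i ih => simp [Expr.reloc, Expr.cost]; omega
  | bin op a b iha ihb => simp [Expr.reloc, Expr.cost]; omega

/-- An expression that fits into words of size W reads only cells with addresses in [-W, W], so the
window shows it the same contents. The shifted addresses are the only larger numbers, at most W +
|off|. -/
theorem Expr.reloc_spec {A₀ ro : ℕ} {W off B : ℤ} {τ σ : State} (h : Presents A₀ ro W off τ σ)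
    (hB : W + |off| ≤ B) {e : Expr} (he : e.Fits W τ) (hr : (e.regBound : ℤ) ≤ W) :
    (e.reloc A₀ ro).eval σ = e.eval τ ∧ (e.reloc A₀ ro).Fits B σ := by
  have h0 := abs_nonneg off
  induction e with
  | const v => exact ⟨rfl, le_trans he (by omega)⟩
  | reg x =>
    simp only [Expr.regBound] at hr
    push_cast at hr
    have h1 := h.reg_eq x (by omega)
    have h2 : |(x : ℤ) + off| ≤ W + |off| := (abs_add_le _ _).trans (by simp; omega)
    simp only [Expr.Fits] at he
    simp only [Expr.reloc, Expr.eval, Expr.Fits, BinOp.eval, h.off_eq, h1]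
    refine ⟨trivial, ⟨?_, ?_, ?_⟩, ?_⟩
    · simp; omega
    · omega
    · omega
    · omega
  | read A i ih =>
    have hi := ih he.1 hr
    have h1 := he.1.abs_eval_le
    have h2 : |i.eval τ + off| ≤ W + |off| := (abs_add_le _ _).trans (by omega)
    have h3 := he.2
    simp only [Expr.reloc, Expr.eval, Expr.Fits, BinOp.eval, h.off_eq, hi.1, h.mem_eq A _ h1]
    exact ⟨trivial, ⟨hi.2, by omega, by omega⟩, by omega⟩
  | bin op a b iha ihb =>
    simp only [Expr.regBound, Nat.cast_max, max_le_iff] at hr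
    have ha := iha he.1 hr.1
    have hb := ihb he.2.1 hr.2
    simp only [Expr.reloc, Expr.eval, Expr.Fits, ha.1, hb.1]
    exact ⟨trivial, ha.2, hb.2, he.2.2.trans (by omega)⟩

/-- The parts of the state that a relocated program leaves alone. -/
def SameOutside (A₀ : ℕ) (W off : ℤ) (σ σ' : State) : Prop :=
  σ'.reg = σ.reg ∧ ∀ A z, (A < A₀ ∨ W < |z - off|) → σ'.mem A z = σ.mem A z

theorem SameOutside.trans {A₀ : ℕ} {W off : ℤ} {σ σ' σ'' : State}
    (h : SameOutside A₀ W off σ σ') (h' : SameOutside A₀ W off σ' σ'') :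
    SameOutside A₀ W off σ σ'' :=
  ⟨h'.1.trans h.1, fun A z hz => (h'.2 A z hz).trans (h.2 A z hz)⟩

/-- The word bound W of the execution also bounds every address it uses, and only registers below
`regBound` occur, so the window contains all that the program can touch. The factor 4 is the
overhead of relocated expressions. -/
theorem Exec.reloc {A₀ ro : ℕ} {W off B : ℤ} (hB : W + |off| ≤ B) {p : Prog} {τ τ' : State}
    {t : ℕ} (h : Exec W p τ t τ') (hr : (p.regBound : ℤ) ≤ W) {σ : State}
    (hσ : Presents A₀ ro W off τ σ) :
    Run B (p.reloc A₀ ro) σ (4 * t)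
      fun σ' => Presents A₀ ro W off τ' σ' ∧ SameOutside A₀ W off σ σ' := by
  induction h generalizing σ with
  | skip τ => exact (Run.skip ⟨hσ, rfl, fun _ _ _ => rfl⟩).mono (by norm_num) fun _ h => h
  | assign τ x e he =>
    simp only [Prog.regBound, Nat.cast_max, max_le_iff] at hr
    push_cast at hr
    have h1 := Expr.reloc_spec hσ hB he hr.2
    have h0 := abs_nonneg off
    have h2 : |(x : ℤ) + off| ≤ W + |off| := (abs_add_le _ _).trans (by simp; omega)
    have hc := Expr.cost_reloc_le A₀ ro e
    have hf : (Expr.bin .add (.const x) (.reg ro)).Fits B σ := by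
      simp only [Expr.Fits, Expr.eval, BinOp.eval, hσ.off_eq, Nat.abs_cast]
      omega
    refine (Run.store (Q := fun σ' => Presents A₀ ro W off (τ.setReg x (e.eval τ)) σ' ∧
      SameOutside A₀ W off σ σ') hf h1.2 ⟨⟨?_, ?_, ?_⟩, ?_, ?_⟩).mono ?_ fun _ h => h
    · exact hσ.off_eq
    · intro y hy
      have := hσ.reg_eq y hy
      simp [Expr.eval, BinOp.eval, hσ.off_eq, h1.1, this]
    · intro A i hi
      have := hσ.mem_eq A i hi
      simp [this, show A₀ + 1 + A ≠ A₀ by omega]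
    · rfl
    · intro A z hz
      simp only [Expr.eval, BinOp.eval, hσ.off_eq, State.setMem_mem]
      rw [if_neg]
      rintro ⟨rfl, rfl⟩
      simp at hz; omega
    · simp [Expr.cost]; omega
  | store τ A i e hi he =>
    simp only [Prog.regBound, Nat.cast_max, max_le_iff] at hr
    have h1 := Expr.reloc_spec hσ hB he hr.2
    have h2 := Expr.reloc_spec hσ hB hi hr.1
    have h0 := abs_nonneg off
    have h3 := hi.abs_eval_le
    have h4 : |i.eval τ + off| ≤ W + |off| := (abs_add_le _ _).trans (by omega)
    have hc := Expr.cost_reloc_le A₀ ro e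
    have hc' := Expr.cost_reloc_le A₀ ro i
    have hf : (Expr.bin .add (i.reloc A₀ ro) (.reg ro)).Fits B σ := by
      simp only [Expr.Fits, Expr.eval, BinOp.eval, hσ.off_eq, h2.1]
      exact ⟨h2.2, by omega, by omega⟩
    refine (Run.store (Q := fun σ' => Presents A₀ ro W off (τ.setMem A (i.eval τ) (e.eval τ)) σ' ∧
      SameOutside A₀ W off σ σ') hf h1.2 ⟨⟨?_, ?_, ?_⟩, ?_, ?_⟩).mono ?_ fun _ h => h
    · exact hσ.off_eq
    · intro y hy
      have := hσ.reg_eq y hy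
      simp [this, show A₀ ≠ A₀ + 1 + A by omega]
    · intro A' z hz
      have := hσ.mem_eq A' z hz
      simp [Expr.eval, BinOp.eval, hσ.off_eq, h1.1, h2.1, this]
    · rfl
    · intro A' z hz
      simp only [Expr.eval, BinOp.eval, hσ.off_eq, State.setMem_mem, h2.1]
      rw [if_neg]
      rintro ⟨rfl, rfl⟩
      simp at hz; omega
    · simp [Expr.cost]; omega
  | seq _ _ ih₁ ih₂ =>
    simp only [Prog.regBound, Nat.cast_max, max_le_iff] at hr
    refine (Run.seq ((ih₁ hr.1 hσ).mono le_rfl fun σ' h' => ?_)).mono (by rw [mul_add])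
      fun _ h => h
    exact (ih₂ hr.2 h'.1).mono le_rfl fun σ'' h'' => ⟨h''.1, h'.2.trans h''.2⟩
  | @ite_true e p q τ τ' t he h _ ih =>
    simp only [Prog.regBound, Nat.cast_max, max_le_iff] at hr
    have h1 := Expr.reloc_spec hσ hB he hr.1
    have hc := Expr.cost_reloc_le A₀ ro e
    refine (Run.ite h1.2 (fun _ => ih hr.2.1 hσ) fun h' => absurd (h1.1 ▸ h') h).mono
      (by omega) fun _ h => h
  | @ite_false e p q τ τ' t he h _ ih =>
    simp only [Prog.regBound, Nat.cast_max, max_le_iff] at hr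
    have h1 := Expr.reloc_spec hσ hB he hr.1
    have hc := Expr.cost_reloc_le A₀ ro e
    refine (Run.ite h1.2 (fun h' => absurd (h1.1 ▸ h) h') fun _ => ih hr.2.2 hσ).mono
      (by omega) fun _ h => h
  | @loop_true e p τ τ' τ'' t t' he h _ _ ih₁ ih₂ =>
    have hr' := hr
    simp only [Prog.regBound, Nat.cast_max, max_le_iff] at hr'
    have h1 := Expr.reloc_spec hσ hB he hr'.1
    have hc := Expr.cost_reloc_le A₀ ro e
    obtain ⟨t₁, σ₁, e₁, l₁, q₁⟩ := ih₁ hr'.2 hσ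
    obtain ⟨t₂, σ₂, e₂, l₂, q₂⟩ := ih₂ hr q₁.1
    exact ⟨_, _, .loop_true h1.2 (by rwa [h1.1]) e₁ e₂, by omega, q₂.1, q₁.2.trans q₂.2⟩
  | @loop_false e p τ he h =>
    simp only [Prog.regBound, Nat.cast_max, max_le_iff] at hr
    have h1 := Expr.reloc_spec hσ hB he hr.1
    have hc := Expr.cost_reloc_le A₀ ro e
    exact ⟨_, _, .loop_false _ h1.2 (by rwa [h1.1]), by omega, hσ, rfl, fun _ _ _ => rfl⟩

/-! ## Compound expressions -/

namespace Expr

/-- The sum of a list of expressions. -/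
def sum : List Expr → Expr
  | [] => .const 0
  | e :: l => .bin .add e (sum l)

/-- The product of a list of expressions. -/
def prod : List Expr → Expr
  | [] => .const 1
  | e :: l => .bin .mul e (prod l)

/-- A power with a fixed exponent. -/
def pow (e : Expr) (n : ℕ) : Expr := prod (List.replicate n e)

variable {X : ℤ} {σ : State}

@[simp] theorem eval_sum (l : List Expr) : (sum l).eval σ = (l.map (eval σ)).sum := by
  induction l with
  | nil => rfl
  | cons e l ih => simp [sum, eval, BinOp.eval, ih]

@[simp] theorem eval_prod (l : List Expr) : (prod l).eval σ = (l.map (eval σ)).prod := by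
  induction l with
  | nil => rfl
  | cons e l ih => simp [prod, eval, BinOp.eval, ih]

@[simp] theorem eval_pow (e : Expr) (n : ℕ) : (e.pow n).eval σ = e.eval σ ^ n := by
  simp [pow]

theorem poly_sum (hX : 2 ≤ X) {l : List Expr} (h : ∀ e ∈ l, e.Poly X σ) : (sum l).Poly X σ := by
  induction l with
  | nil => simp [sum, Poly]; omega
  | cons e l ih => exact ⟨trivial, h e (by simp), ih fun e he => h e (by simp [he])⟩

theorem poly_prod (hX : 2 ≤ X) {l : List Expr} (h : ∀ e ∈ l, e.Poly X σ) : (prod l).Poly X σ := by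
  induction l with
  | nil => simp [prod, Poly]; omega
  | cons e l ih => exact ⟨trivial, h e (by simp), ih fun e he => h e (by simp [he])⟩

theorem poly_pow (hX : 2 ≤ X) {e : Expr} (h : e.Poly X σ) (n : ℕ) : (e.pow n).Poly X σ :=
  poly_prod hX fun e' he' => by rw [List.eq_of_mem_replicate he']; exact h

end Expr

end WordRAM

/-! ## Normal form of formulas -/

/-- The truth value of a formula is a Boolean function of the signs of finitely many terms. -/
theorem LinFormula.exists_signs {V : Type} [Fintype V] (ψ : LinFormula V) :
    ∃ (N : ℕ) (τ : Fin N → LinTerm V) (F : (Fin N → Bool) → Bool),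
      ∀ x, ψ.Holds x ↔ F (fun j => decide (0 ≤ (τ j).eval x)) = true := by
  induction ψ with
  | nonneg τ => exact ⟨1, fun _ => τ, fun f => f 0, fun x => by simp [LinFormula.Holds]⟩
  | isZero τ =>
    -- An equation is a pair of inequalities, for the term and for its negative.
    refine ⟨2, ![τ, ⟨fun v => -τ.coeff v, -τ.const⟩], fun f => f 0 && f 1, fun x => ?_⟩
    have : (⟨fun v => -τ.coeff v, -τ.const⟩ : LinTerm V).eval x = -τ.eval x := by
      simp [LinTerm.eval]; ring
    change τ.eval x = 0 ↔ (decide (0 ≤ τ.eval x) &&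
      decide (0 ≤ (⟨fun v => -τ.coeff v, -τ.const⟩ : LinTerm V).eval x)) = true
    rw [this, Bool.and_eq_true, decide_eq_true_eq, decide_eq_true_eq]
    omega
  | neg φ ih =>
    obtain ⟨N, τ, F, h⟩ := ih
    exact ⟨N, τ, fun f => !F f, fun x => by simp [LinFormula.Holds, h]⟩
  | conj φ ψ ih₁ ih₂ =>
    obtain ⟨N₁, τ₁, F₁, h₁⟩ := ih₁
    obtain ⟨N₂, τ₂, F₂, h₂⟩ := ih₂
    exact ⟨N₁ + N₂, Fin.append τ₁ τ₂,
      fun f => F₁ (fun j => f (Fin.castAdd _ j)) && F₂ (fun j => f (Fin.natAdd _ j)),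
      fun x => by simp [LinFormula.Holds, h₁, h₂]⟩
  | disj φ ψ ih₁ ih₂ =>
    obtain ⟨N₁, τ₁, F₁, h₁⟩ := ih₁
    obtain ⟨N₂, τ₂, F₂, h₂⟩ := ih₂
    exact ⟨N₁ + N₂, Fin.append τ₁ τ₂,
      fun f => F₁ (fun j => f (Fin.castAdd _ j)) || F₂ (fun j => f (Fin.natAdd _ j)),
      fun x => by simp [LinFormula.Holds, h₁, h₂]⟩

/-! ## Signs of sums through rounded summands -/

section Crossing

variable {ι : Type} [Fintype ι]

/-- The sum of all numbers after division by `2 ^ l` and rounding down. -/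
def roundedSum (c : ℤ) (x : ι → ℤ) (l : ℕ) : ℤ := c / 2 ^ l + ∑ i, x i / 2 ^ l

/-- This holds for each summand, as rounding down at level l + 1 is halving the rounding at level l.
It makes positivity monotone in the level. -/
theorem two_mul_roundedSum_succ_le (c : ℤ) (x : ι → ℤ) (l : ℕ) :
    2 * roundedSum c x (l + 1) ≤ roundedSum c x l := by
  have h : ∀ a : ℤ, 2 * (a / 2 ^ (l + 1)) ≤ a / 2 ^ l := fun a => by
    rw [pow_succ, ← Int.ediv_ediv_of_nonneg (by positivity)]; omega
  unfold roundedSum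
  rw [mul_add, Finset.mul_sum]
  exact add_le_add (h c) (Finset.sum_le_sum fun i _ => h (x i))

/-- Each summand, the constant included, loses at most 1 when it is halved and rounded down. This
keeps the values at a sign change in a range independent of the numbers. -/
theorem roundedSum_le_two_mul_succ (c : ℤ) (x : ι → ℤ) (l : ℕ) :
    roundedSum c x l ≤ 2 * roundedSum c x (l + 1) + (Fintype.card ι + 1) := by
  have h : ∀ a : ℤ, a / 2 ^ l ≤ 2 * (a / 2 ^ (l + 1)) + 1 := fun a => by
    rw [pow_succ, ← Int.ediv_ediv_of_nonneg (by positivity)]; omega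
  unfold roundedSum
  have := Finset.sum_le_sum fun i (_ : i ∈ Finset.univ) => h (x i)
  rw [Finset.sum_add_distrib, ← Finset.mul_sum] at this
  simp at this
  have := h c
  linarith

theorem roundedSum_pos_of_le {c : ℤ} {x : ι → ℤ} {l l' : ℕ} (hl : l ≤ l')
    (h : 0 < roundedSum c x l') : 0 < roundedSum c x l := by
  induction hl with
  | refl => exact h
  | @step m _ ih =>
    have := two_mul_roundedSum_succ_le c x m
    rw [Nat.succ_eq_add_one] at h
    exact ih (by omega)

theorem roundedSum_zero (c : ℤ) (x : ι → ℤ) : roundedSum c x 0 = c + ∑ i, x i := by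
  simp [roundedSum]

theorem roundedSum_nonpos {c : ℤ} {x : ι → ℤ} {L : ℕ} (hc : c < 2 ^ L) (hx : ∀ i, x i < 2 ^ L) :
    roundedSum c x L ≤ 0 := by
  have h : ∀ a : ℤ, a < 2 ^ L → a / 2 ^ L ≤ 0 := fun a ha => by
    have : a / 2 ^ L < 1 := Int.ediv_lt_of_lt_mul (by positivity) (by simpa using ha)
    omega
  exact add_nonpos (h c hc) (Finset.sum_nonpos fun i _ => h _ (hx i))

/-- Without such a level, positivity would climb from level 0 up to level L. -/
theorem exists_crossing {c : ℤ} {x : ι → ℤ} {L : ℕ} (hL : roundedSum c x L ≤ 0)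
    (h0 : 0 < roundedSum c x 0) :
    ∃ l < L, roundedSum c x (l + 1) ≤ 0 ∧ 0 < roundedSum c x l := by
  by_contra! h
  have : ∀ l ≤ L, 0 < roundedSum c x l := by
    intro l
    induction l with
    | zero => exact fun _ => h0
    | succ l ih =>
      intro hl
      by_contra! h'
      exact absurd (h l (by omega) h') (by have := ih (by omega); omega)
  exact absurd (this L le_rfl) (by omega)

theorem crossing_unique {c : ℤ} {x : ι → ℤ} {l l' : ℕ} (h : roundedSum c x (l + 1) ≤ 0)
    (h' : 0 < roundedSum c x l) (g : roundedSum c x (l' + 1) ≤ 0) (g' : 0 < roundedSum c x l') :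
    l = l' := by
  rcases lt_trichotomy l l' with hl | hl | hl
  · have := roundedSum_pos_of_le (l := l + 1) hl g'; omega
  · exact hl
  · have := roundedSum_pos_of_le (l := l' + 1) hl h'; omega

/-! A digit `d` encodes a sign `d % 2`, two small numbers and a level. -/

/-- The sign `±1` encoded in a digit. -/
def digSign (d : ℕ) : ℤ := 1 - 2 * ((d % 2 : ℕ) : ℤ)

/-- The level encoded in a digit. -/
def digLevel (K d : ℕ) : ℕ := d / (2 * K * K)

/-- A summand, rounded at the level of the digit. -/
def digLow (K d : ℕ) (x : ℤ) : ℤ := digSign d * x / 2 ^ digLevel K d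

/-- A summand, rounded at the level after that of the digit. -/
def digHigh (K d : ℕ) (x : ℤ) : ℤ := digSign d * x / 2 ^ (digLevel K d + 1)

/-- The constant summand that belongs to the sign of the digit. -/
def digConst (d : ℕ) (C : ℤ) : ℤ := digSign d * C + (1 - ((d % 2 : ℕ) : ℤ))

/-- The value that the sum of the lower roundings has to have. -/
def digLowTarget (K d : ℕ) (C : ℤ) : ℤ :=
  ((d / (2 * K) % K : ℕ) : ℤ) + 1 - digConst d C / 2 ^ digLevel K d

/-- The value that the sum of the higher roundings has to have. -/
def digHighTarget (K d : ℕ) (C : ℤ) : ℤ :=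
  -((d / 2 % K : ℕ) : ℤ) - digConst d C / 2 ^ (digLevel K d + 1)

/-- The digit describes where the rounded sums change sign. -/
def DigMatch (K d : ℕ) (C : ℤ) (x : ι → ℤ) : Prop :=
  ∑ i, digLow K d (x i) = digLowTarget K d C ∧ ∑ i, digHigh K d (x i) = digHighTarget K d C

/-- In a match the rounded constant stands on the side of the target, so that each remaining summand
depends on a single set; here it is moved back into the rounded sum. -/
theorem digMatch_iff (K d : ℕ) (C : ℤ) (x : ι → ℤ) :
    DigMatch K d C x ↔
      roundedSum (digConst d C) (fun i => digSign d * x i) (digLevel K d) =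
        ((d / (2 * K) % K : ℕ) : ℤ) + 1 ∧
      roundedSum (digConst d C) (fun i => digSign d * x i) (digLevel K d + 1) =
        -((d / 2 % K : ℕ) : ℤ) := by
  unfold DigMatch roundedSum digLow digHigh digLowTarget digHighTarget
  constructor <;> rintro ⟨h1, h2⟩ <;> constructor <;> linarith

/-- The matched value at the level of the digit is at least 1, and positivity descends to level 0.
For sign bit 0 this says C + 1 + Σ x > 0, for sign bit 1 it says -C - Σ x > 0. -/
theorem DigMatch.sign {K d : ℕ} {C : ℤ} {x : ι → ℤ} (h : DigMatch K d C x) :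
    d % 2 = 0 ↔ 0 ≤ C + ∑ i, x i := by
  rw [digMatch_iff] at h
  have h1 : 0 < roundedSum (digConst d C) (fun i => digSign d * x i) 0 :=
    roundedSum_pos_of_le (Nat.zero_le _) (by rw [h.1]; positivity)
  rw [roundedSum_zero, ← Finset.mul_sum, digConst, digSign] at h1
  rcases Nat.mod_two_eq_zero_or_one d with h2 | h2 <;> rw [h2] at h1 ⊢ <;> simp at h1 ⊢ <;> omega

/-- The sign of the sum fixes the sign bit, the unique sign change of the rounded sums fixes the
level, and the two values there fix the remaining parts. Existence needs these values to be
representable below K, which is the bounded range at a sign change. -/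
theorem existsUnique_digMatch {K L : ℕ} (hK : Fintype.card ι + 2 < K) {C : ℤ} {x : ι → ℤ}
    (hC : |C| + 1 < 2 ^ L) (hx : ∀ i, |x i| < 2 ^ L) :
    ∃! d, d < 2 * K * K * L ∧ DigMatch K d C x := by
  have hK0 : 0 < K := by omega
  -- digits with prescribed parts
  have key : ∀ s < 2, ∀ u < K, ∀ v < K, ∀ l, ∃ d, d % 2 = s ∧ d / 2 % K = u ∧
      d / (2 * K) % K = v ∧ d / (2 * K * K) = l := by
    intro s hs u hu v hv l
    have e1 : (s + 2 * (u + K * (v + K * l))) / 2 = u + K * (v + K * l) := by omega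
    have e2 : (u + K * (v + K * l)) / K = v + K * l := by
      rw [Nat.add_mul_div_left _ _ hK0, Nat.div_eq_of_lt hu, zero_add]
    have e3 : (v + K * l) / K = l := by
      rw [Nat.add_mul_div_left _ _ hK0, Nat.div_eq_of_lt hv, zero_add]
    refine ⟨s + 2 * (u + K * (v + K * l)), by omega, ?_, ?_, ?_⟩
    · rw [e1, Nat.add_mul_mod_self_left, Nat.mod_eq_of_lt hu]
    · rw [← Nat.div_div_eq_div_mul, e1, e2, Nat.add_mul_mod_self_left, Nat.mod_eq_of_lt hv]
    · rw [← Nat.div_div_eq_div_mul, ← Nat.div_div_eq_div_mul, e1, e2, e3]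
  have uniq : ∀ d d' : ℕ, d % 2 = d' % 2 → d / 2 % K = d' / 2 % K →
      d / (2 * K) % K = d' / (2 * K) % K → d / (2 * K * K) = d' / (2 * K * K) → d = d' := by
    intro d d' h1 h2 h3 h4
    simp only [← Nat.div_div_eq_div_mul] at h3 h4
    have h5 : d / 2 / K = d' / 2 / K := by
      rw [← Nat.div_add_mod (d / 2 / K) K, ← Nat.div_add_mod (d' / 2 / K) K, h3, h4]
    have h6 : d / 2 = d' / 2 := by
      rw [← Nat.div_add_mod (d / 2) K, ← Nat.div_add_mod (d' / 2) K, h2, h5]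
    omega
  obtain ⟨s, hs, hs0⟩ : ∃ s < 2, s = 0 ↔ 0 ≤ C + ∑ i, x i := by
    by_cases h : 0 ≤ C + ∑ i, x i
    · exact ⟨0, by norm_num, by simpa using h⟩
    · exact ⟨1, by norm_num, by simpa using h⟩
  set σ : ℤ := 1 - 2 * (s : ℤ) with hσ
  set c : ℤ := σ * C + (1 - (s : ℤ)) with hc
  have hs' : s = 0 ∨ s = 1 := by omega
  have hL : roundedSum c (fun i => σ * x i) L ≤ 0 := by
    refine roundedSum_nonpos ?_ fun i => ?_
    -- The margin 1 in the bound on C is used when c = C + 1.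
    · rcases abs_lt.1 (show |C| < 2 ^ L - 1 by omega) with ⟨h1, h2⟩
      rcases hs' with rfl | rfl <;> simp [hc, hσ] <;> omega
    · rcases abs_lt.1 (hx i) with ⟨h1, h2⟩
      rcases hs' with rfl | rfl <;> simp [hσ] <;> omega
  have h0 : 0 < roundedSum c (fun i => σ * x i) 0 := by
    rw [roundedSum_zero, ← Finset.mul_sum]
    rcases hs' with rfl | rfl <;> simp at hs0 <;> simp [hc, hσ] <;> omega
  obtain ⟨l, hl, hl1, hl2⟩ := exists_crossing hL h0
  have hb := roundedSum_le_two_mul_succ c (fun i => σ * x i) l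
  have hb' := two_mul_roundedSum_succ_le c (fun i => σ * x i) l
  -- Here S_{l+1} = -u and S_l = v + 1. The bound `hb` gives v + 2u ≤ card ι, so both are below K.
  obtain ⟨u, hu⟩ := Int.eq_ofNat_of_zero_le (neg_nonneg.2 hl1)
  obtain ⟨v, hv⟩ := Int.eq_ofNat_of_zero_le (show 0 ≤ roundedSum c (fun i => σ * x i) l - 1 by omega)
  obtain ⟨d, d1, d2, d3, d4⟩ := key s hs u (by omega) v (by omega) l
  refine ⟨d, ⟨?_, ?_⟩, ?_⟩
  · have := (Nat.div_lt_iff_lt_mul (show 0 < 2 * K * K by positivity)).1 (d4 ▸ hl)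
    rwa [mul_comm L] at this
  · rw [digMatch_iff, digConst, digSign, digLevel, d1, d2, d3, d4, ← hσ, ← hc]
    exact ⟨by linarith, by linarith⟩
  -- The sign bit is recovered first: constant and signs in the rounded sums depend on it, and only
  -- then is uniqueness of the level applicable.
  · rintro d' ⟨_, hd'⟩
    have p1 : d' % 2 = s := by
      have := hd'.sign
      omega
    rw [digMatch_iff, digConst, digSign, digLevel, p1, ← hσ, ← hc] at hd'
    have p2 : d' / (2 * K * K) = l :=
      crossing_unique (by rw [hd'.2, neg_nonpos]; exact Int.natCast_nonneg _)
        (by rw [hd'.1]; positivity) hl1 hl2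
    rw [p2] at hd'
    refine uniq _ _ (p1.trans d1.symm) ?_ ?_ (p2.trans d4.symm)
    · rw [d2]; exact_mod_cast (by linarith : ((d' / 2 % K : ℕ) : ℤ) = (u : ℤ))
    · rw [d3]; exact_mod_cast (by linarith : ((d' / (2 * K) % K : ℕ) : ℤ) = (v : ℤ))

end Crossing

/-! ## Packing -/

/-- M divides the lowest entry, which is smaller than M in absolute value and hence 0; dividing by M
leaves a shorter sum. Entries may be negative. -/
theorem eq_zero_of_packed {n : ℕ} {z : Fin n → ℤ} {M : ℤ} (hz : ∀ j, |z j| < M)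
    (h : ∑ j, z j * M ^ (j : ℕ) = 0) : ∀ j, z j = 0 := by
  induction n with
  | zero => exact fun j => j.elim0
  | succ n ih =>
    rw [Fin.sum_univ_succ] at h
    have h1 : ∑ i : Fin n, z i.succ * M ^ ((i.succ : Fin (n + 1)) : ℕ) =
        M * ∑ i : Fin n, z i.succ * M ^ (i : ℕ) := by
      rw [Finset.mul_sum]
      exact Finset.sum_congr rfl fun i _ => by simp [pow_succ]; ring
    rw [h1] at h
    simp only [Fin.val_zero, pow_zero, mul_one] at h
    have h0 : z 0 = 0 := Int.eq_zero_of_abs_lt_dvd ⟨-∑ i : Fin n, z i.succ * M ^ (i : ℕ), by linarith⟩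
      (hz 0)
    have hM : M ≠ 0 := by have := hz 0; have := abs_nonneg (z 0); omega
    rw [h0, zero_add] at h
    have h2 := ih (fun j => hz j.succ) ((mul_eq_zero.1 h).resolve_left hM)
    exact fun j => Fin.cases h0 h2 j

/-- Two families of integers as one integer. -/
def packPairs {N : ℕ} (M : ℤ) (y z : Fin N → ℤ) : ℤ :=
  ∑ j, (y j + M * z j) * (M ^ 2) ^ (j : ℕ)

/-- Packing is linear, so the difference of the two sides packs the differences of the components.
These are small, and `eq_zero_of_packed` applies in base M^2, followed by divisibility by M within
each pair. -/
theorem sum_packPairs_eq_iff {N : ℕ} {ι : Type} [Fintype ι] {M : ℤ} {y z : ι → Fin N → ℤ}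
    {s t : Fin N → ℤ} (hs : ∀ j, |∑ i, y i j - s j| < M) (ht : ∀ j, |∑ i, z i j - t j| < M) :
    ∑ i, packPairs M (y i) (z i) = packPairs M s t ↔
      ∀ j, ∑ i, y i j = s j ∧ ∑ i, z i j = t j := by
  have e : ∑ i, packPairs M (y i) (z i) - packPairs M s t =
      ∑ j : Fin N, ((∑ i, y i j - s j) + M * (∑ i, z i j - t j)) * (M ^ 2) ^ (j : ℕ) := by
    simp only [packPairs]
    rw [Finset.sum_comm, ← Finset.sum_sub_distrib]
    refine Finset.sum_congr rfl fun j _ => ?_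
    rw [← Finset.sum_mul, Finset.sum_add_distrib, ← Finset.mul_sum]
    ring
  constructor
  · intro h j
    rw [← sub_eq_zero, e] at h
    have h1 := eq_zero_of_packed (fun j => ?_) h j
    · have hM : M ≠ 0 := by have := hs j; have := abs_nonneg (∑ i, y i j - s j); omega
      have h2 : ∑ i, y i j - s j = 0 :=
        Int.eq_zero_of_abs_lt_dvd ⟨-(∑ i, z i j - t j), by linarith⟩ (hs j)
      rw [h2, zero_add] at h1
      have h3 := (mul_eq_zero.1 h1).resolve_left hM
      constructor <;> linarith
    -- A pair is a digit in base M^2, as its absolute value is at most (M - 1) + M (M - 1).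
    · have h1 := hs j
      have h2 := ht j
      have h3 := abs_nonneg (∑ i, z i j - t j)
      have h4 := abs_add_le (∑ i, y i j - s j) (M * (∑ i, z i j - t j))
      rw [abs_mul, abs_of_pos (show 0 < M by omega)] at h4
      nlinarith
  · intro h
    rw [← sub_eq_zero, e]
    exact Finset.sum_eq_zero fun j _ => by simp [(h j).1, (h j).2]

/-! ## Multiplicities through binary digits -/

theorem Nat.sum_bits {x D : ℕ} (h : x < 2 ^ D) : ∑ b : Fin D, 2 ^ (b : ℕ) * (x / 2 ^ (b : ℕ) % 2) = x := by
  rw [Fin.sum_univ_eq_sum_range (fun b => 2 ^ b * (x / 2 ^ b % 2)) D]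
  conv_rhs => rw [← Nat.mod_eq_of_lt h]
  clear h
  induction D with
  | zero => simp [Nat.mod_one]
  | succ D ih => rw [Finset.sum_range_succ, ih, Nat.mod_pow_succ]

/-- How often `f` takes the value `v` on `A`. -/
def valueCount {α : Type} (A : Finset α) (f : α → ℤ) (v : ℤ) : ℕ :=
  (A.filter fun a => f a = v).card

/-- The values of `f` on `A` whose multiplicity has binary digit `1` at position `b`. -/
def bitValues {α : Type} (A : Finset α) (f : α → ℤ) (b : ℕ) : Finset ℤ :=
  (A.image f).filter fun v => valueCount A f v / 2 ^ b % 2 = 1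

/-- The fiber over a tuple v of values has as many elements as the product of the multiplicities of
the v_i. Writing each multiplicity in binary and expanding the product gives one term per choice of
bit positions; the term is its weight if all chosen digits are 1, and 0 otherwise. -/
theorem sum_card_bitValues {k : ℕ} {α : Fin k → Type} (A : ∀ i, Finset (α i))
    (f : ∀ i, α i → ℤ) (t : ℤ) {D : ℕ} (hD : ∀ i, (A i).card < 2 ^ D) :
    ∑ b : Fin k → Fin D, 2 ^ (∑ i, (b i : ℕ)) *
        ((Fintype.piFinset fun i => bitValues (A i) (f i) (b i)).filter
          fun v => ∑ i, v i = t).card =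
      ((Fintype.piFinset A).filter fun a => ∑ i, f i (a i) = t).card := by
  set S : Finset (Fin k → ℤ) :=
    (Fintype.piFinset fun i => (A i).image (f i)).filter fun v => ∑ i, v i = t with hS
  have h1 : ∀ b : Fin k → Fin D, 2 ^ (∑ i, (b i : ℕ)) *
        ((Fintype.piFinset fun i => bitValues (A i) (f i) (b i)).filter
          fun v => ∑ i, v i = t).card =
      ∑ v ∈ S, ∏ i, 2 ^ (b i : ℕ) * (valueCount (A i) (f i) (v i) / 2 ^ (b i : ℕ) % 2) := by
    intro b
    have e : ((Fintype.piFinset fun i => bitValues (A i) (f i) (b i)).filter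
          fun v => ∑ i, v i = t) =
        S.filter fun v => ∀ i, valueCount (A i) (f i) (v i) / 2 ^ (b i : ℕ) % 2 = 1 := by
      ext v
      simp only [hS, Finset.mem_filter, Fintype.mem_piFinset, bitValues]
      constructor
      · rintro ⟨h, h'⟩; exact ⟨⟨fun i => (h i).1, h'⟩, fun i => (h i).2⟩
      · rintro ⟨⟨h, h'⟩, h''⟩; exact ⟨fun i => ⟨h i, h'' i⟩, h'⟩
    rw [e, Finset.card_filter, Finset.mul_sum]
    refine Finset.sum_congr rfl fun v _ => ?_
    rw [Finset.prod_mul_distrib, Finset.prod_pow_eq_pow_sum]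
    congr 1
    split_ifs with h
    · exact (Finset.prod_eq_one fun i _ => h i).symm
    · push Not at h
      obtain ⟨i, hi⟩ := h
      exact (Finset.prod_eq_zero (Finset.mem_univ i) (by omega)).symm
  refine (Finset.sum_congr rfl fun b _ => h1 b).trans ?_
  rw [Finset.sum_comm]
  have h2 : ∀ v ∈ S, ∑ b : Fin k → Fin D, ∏ i, 2 ^ (b i : ℕ) *
      (valueCount (A i) (f i) (v i) / 2 ^ (b i : ℕ) % 2) =
      (((Fintype.piFinset A).filter fun a => ∑ i, f i (a i) = t).filter
        fun a => (fun i => f i (a i)) = v).card := by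
    intro v hv
    have := Finset.prod_univ_sum (fun _ : Fin k => (Finset.univ : Finset (Fin D)))
      (fun i b => 2 ^ (b : ℕ) * (valueCount (A i) (f i) (v i) / 2 ^ (b : ℕ) % 2))
    rw [Fintype.piFinset_univ] at this
    rw [← this]
    have e : (((Fintype.piFinset A).filter fun a => ∑ i, f i (a i) = t).filter
        fun a => (fun i => f i (a i)) = v) =
        Fintype.piFinset fun i => (A i).filter fun a => f i a = v i := by
      ext a
      simp only [Finset.mem_filter, Fintype.mem_piFinset, funext_iff]
      constructor
      · rintro ⟨⟨h, _⟩, h'⟩; exact fun i => ⟨h i, h' i⟩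
      · intro h
        refine ⟨⟨fun i => (h i).1, ?_⟩, fun i => (h i).2⟩
        rw [← (Finset.mem_filter.1 hv).2]
        exact Finset.sum_congr rfl fun i _ => (h i).2
    rw [e, Fintype.card_piFinset]
    refine Finset.prod_congr rfl fun i _ => ?_
    rw [Nat.sum_bits]
    · rfl
    · exact (Finset.card_filter_le _ _).trans_lt (hD i)
  have h3 : ∀ a ∈ (Fintype.piFinset A).filter (fun a => ∑ i, f i (a i) = t),
      (fun i => f i (a i)) ∈ S := fun a ha => by
    rw [Finset.mem_filter, Fintype.mem_piFinset] at ha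
    rw [hS, Finset.mem_filter, Fintype.mem_piFinset]
    exact ⟨fun i => Finset.mem_image_of_mem _ (ha.1 i), ha.2⟩
  have h4 := Finset.card_eq_sum_card_fiberwise h3
  rw [h4]
  exact Finset.sum_congr rfl h2

/-- Values above `H` can be added if they cannot take part in a solution. -/
theorem card_filter_sum_union {k : ℕ} (S P : Fin k → Finset ℤ) {t Y H : ℤ}
    (hS : ∀ i, ∀ v ∈ S i, |v| ≤ Y) (hP : ∀ i, ∀ v ∈ P i, H ≤ v) (ht : |t| ≤ Y)
    (hH : (k + 1) * Y < H) :
    ((Fintype.piFinset fun i => P i ∪ S i).filter fun v => ∑ i, v i = t).card =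
      ((Fintype.piFinset S).filter fun v => ∑ i, v i = t).card := by
  congr 1
  ext v
  simp only [Finset.mem_filter, Fintype.mem_piFinset, Finset.mem_union, and_congr_left_iff]
  intro hv
  refine ⟨fun h => ?_, fun h i => Or.inr (h i)⟩
  have hY : 0 ≤ Y := (abs_nonneg t).trans ht
  by_contra! hn
  obtain ⟨i, hi⟩ := hn
  have h1 : H ≤ v i := hP i _ ((h i).resolve_right hi)
  have h2 : ∀ j, -Y ≤ v j := fun j => by
    rcases h j with h | h
    · have := hP j _ h; nlinarith
    · exact (abs_le.1 (hS j _ h)).1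
  -- A single padding value makes the sum at least H - (k - 1) Y > 2 Y, which exceeds t.
  have h3 := Finset.add_sum_erase Finset.univ v (Finset.mem_univ i)
  have h4 := Finset.card_nsmul_le_sum (Finset.univ.erase i) v (-Y) fun j _ => h2 j
  simp only [Finset.card_erase_of_mem (Finset.mem_univ i), Finset.card_univ, Fintype.card_fin,
    nsmul_eq_mul] at h4
  have h5 : ((k - 1 : ℕ) : ℤ) ≤ k := by omega
  have h6 := (abs_le.1 ht).2
  nlinarith

/-! ## The counting identity -/

/-- The order of summation is exchanged. A fixed tuple matches exactly one digit for each term,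
hence solves the packed equation for exactly one digit vector, and the sign bits of this vector are
the true signs. M exceeds every difference between a component sum and its target. -/
theorem sum_digits_eq_card {k N K L D : ℕ} {α : Fin k → Type} (A : ∀ i, Finset (α i))
    (x : Fin N → ∀ i, α i → ℤ) (C : Fin N → ℤ) (F : (Fin N → Bool) → Bool) {Y M : ℤ}
    (hK : K = k + 3) (hD : D = 2 * K * K * L) (hC : ∀ j, |C j| ≤ Y)
    (hx : ∀ j i, ∀ a ∈ A i, |x j i a| ≤ Y) (hY : Y + 1 < 2 ^ L) (hM : (k + 1) * Y + K + 1 < M) :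
    ∑ g : Fin N → Fin D, (if F fun j => decide ((g j : ℕ) % 2 = 0) then 1 else 0) *
      ((Fintype.piFinset A).filter fun a =>
        ∑ i, packPairs M (fun j => digLow K (g j) (x j i (a i)))
          (fun j => digHigh K (g j) (x j i (a i))) =
        packPairs M (fun j => digLowTarget K (g j) (C j))
          (fun j => digHighTarget K (g j) (C j))).card =
    ((Fintype.piFinset A).filter fun a =>
      F fun j => decide (0 ≤ C j + ∑ i, x j i (a i))).card := by
  classical
  have hs : ∀ (d : ℕ) (z : ℤ), |digSign d * z| = |z| := fun d z => by
    rcases Nat.mod_two_eq_zero_or_one d with h | h <;> simp [digSign, h]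
  have hmatch : ∀ a ∈ Fintype.piFinset A, ∀ g : Fin N → Fin D,
      (∑ i, packPairs M (fun j => digLow K (g j) (x j i (a i)))
          (fun j => digHigh K (g j) (x j i (a i))) =
        packPairs M (fun j => digLowTarget K (g j) (C j))
          (fun j => digHighTarget K (g j) (C j))) ↔
      ∀ j, DigMatch K (g j) (C j) fun i => x j i (a i) := by
    intro a ha g
    rw [Fintype.mem_piFinset] at ha
    have hl : ∀ (p : ℤ) j i, |digSign (g j) * x j i (a i) / p| ≤ Y := fun p j i =>
      (Int.abs_ediv_le_abs _ _).trans ((hs _ _).trans_le (hx j i _ (ha i)))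
    have hc : ∀ (p : ℤ) j, |digConst (g j) (C j) / p| ≤ Y + 1 := fun p j => by
      refine (Int.abs_ediv_le_abs _ _).trans ((abs_add_le _ _).trans (add_le_add
        ((hs _ _).trans_le (hC j)) ?_))
      rw [abs_le]; omega
    have hsum : ∀ (p : ℤ) j, |∑ i, digSign (g j) * x j i (a i) / p| ≤ k * Y := fun p j => by
      refine (Finset.abs_sum_le_sum_abs _ _).trans ((Finset.sum_le_sum fun i _ => hl p j i).trans ?_)
      simp
    have hKp : 0 < K := by omega
    refine sum_packPairs_eq_iff (fun j => ?_) (fun j => ?_)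
    · have h1 := abs_le.1 (hsum (2 ^ digLevel K (g j)) j)
      have h2 := abs_le.1 (hc (2 ^ digLevel K (g j)) j)
      have h3 : (((g j : ℕ) / (2 * K) % K : ℕ) : ℤ) < K := Int.ofNat_lt.2 (Nat.mod_lt _ hKp)
      have h4 : (0 : ℤ) ≤ (((g j : ℕ) / (2 * K) % K : ℕ) : ℤ) := Int.natCast_nonneg _
      simp only [digLow, digLowTarget]
      generalize (((g j : ℕ) / (2 * K) % K : ℕ) : ℤ) = w at *
      rw [abs_lt]
      constructor <;> linarith
    · have h1 := abs_le.1 (hsum (2 ^ (digLevel K (g j) + 1)) j)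
      have h2 := abs_le.1 (hc (2 ^ (digLevel K (g j) + 1)) j)
      have h3 : (((g j : ℕ) / 2 % K : ℕ) : ℤ) < K := Int.ofNat_lt.2 (Nat.mod_lt _ hKp)
      have h4 : (0 : ℤ) ≤ (((g j : ℕ) / 2 % K : ℕ) : ℤ) := Int.natCast_nonneg _
      simp only [digHigh, digHighTarget]
      generalize (((g j : ℕ) / 2 % K : ℕ) : ℤ) = w at *
      rw [abs_lt]
      constructor <;> linarith
  simp only [Finset.card_filter]
  simp only [Finset.mul_sum]
  rw [Finset.sum_comm]
  refine Finset.sum_congr rfl fun a ha => ?_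
  have ha' := Fintype.mem_piFinset.1 ha
  have hex : ∀ j, ∃! d, d < D ∧ DigMatch K d (C j) fun i => x j i (a i) := fun j => by
    rw [hD]
    refine existsUnique_digMatch (by simp [hK]) ?_ fun i => ?_
    · have := hC j; omega
    · have := hx j i _ (ha' i); omega
  choose d hd hd' using hex
  obtain ⟨g₀, hg₀⟩ : ∃ g₀ : Fin N → Fin D, ∀ j, (g₀ j : ℕ) = d j :=
    ⟨fun j => ⟨d j, (hd j).1⟩, fun _ => rfl⟩
  -- The vector g₀ of matching digits is the only one that contributes for this tuple.
  rw [Finset.sum_eq_single g₀]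
  · rw [if_pos ((hmatch a ha _).2 fun j => (hg₀ j).symm ▸ (hd j).2), mul_one]
    have : (fun j => decide ((g₀ j : ℕ) % 2 = 0)) =
        fun j => decide (0 ≤ C j + ∑ i, x j i (a i)) := by
      ext j
      simp [hg₀ j, (hd j).2.sign]
    simp only [this]
  · intro g _ hg
    refine mul_eq_zero_of_right _ (if_neg fun h => ?_)
    apply hg
    ext j
    rw [hg₀ j]
    exact hd' j _ ⟨(g j).2, (hmatch a ha g).1 h j⟩
  · simp

namespace WordRAM

/-! ## Writing one set of an instance -/

/-- The first `o` values of `g` list the elements of `S` without repetition. -/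
structure Lists (g : ℕ → ℤ) (o : ℕ) (S : Finset ℤ) : Prop where
  mem : ∀ p < o, g p ∈ S
  inj : ∀ p < o, ∀ p' < o, g p = g p' → p = p'
  surj : ∀ v ∈ S, ∃ p < o, g p = v

theorem Lists.congr {g g' : ℕ → ℤ} {o : ℕ} {S : Finset ℤ} (h : Lists g o S)
    (hg : ∀ p < o, g' p = g p) : Lists g' o S where
  mem p hp := by rw [hg p hp]; exact h.mem p hp
  inj p hp p' hp' := by rw [hg p hp, hg p' hp']; exact h.inj p hp p' hp'
  surj v hv := by
    obtain ⟨p, hp, rfl⟩ := h.surj v hv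
    exact ⟨p, hp, hg p hp⟩

theorem Lists.snoc {g g' : ℕ → ℤ} {o : ℕ} {S : Finset ℤ} {v : ℤ} (h : Lists g o S) (hv : v ∉ S)
    (hg : ∀ p < o, g' p = g p) (hgo : g' o = v) : Lists g' (o + 1) (insert v S) := by
  have h' := h.congr hg
  have hne : ∀ p < o, g' p ≠ g' o := fun p hp he => hv (by rw [← hgo, ← he]; exact h'.mem p hp)
  refine ⟨fun p hp => ?_, fun p hp p' hp' he => ?_, fun w hw => ?_⟩
  · rcases Nat.lt_succ_iff_lt_or_eq.1 hp with hp | rfl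
    · exact Finset.mem_insert_of_mem (h'.mem p hp)
    · rw [hgo]; exact Finset.mem_insert_self _ _
  · rcases Nat.lt_succ_iff_lt_or_eq.1 hp with hp | rfl <;>
      rcases Nat.lt_succ_iff_lt_or_eq.1 hp' with hp' | rfl
    · exact h'.inj p hp p' hp' he
    · exact absurd he (hne p hp)
    · exact absurd he.symm (hne p' hp')
    · rfl
  · rcases Finset.mem_insert.1 hw with rfl | hw
    · exact ⟨o, by omega, hgo⟩
    · obtain ⟨p, hp, e⟩ := h'.surj w hw
      exact ⟨p, by omega, e⟩

theorem Lists.card {g : ℕ → ℤ} {o : ℕ} {S : Finset ℤ} (h : Lists g o S) : S.card = o := by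
  have : S = (Finset.range o).image g := by
    ext v
    simp only [Finset.mem_image, Finset.mem_range]
    exact ⟨h.surj v, fun ⟨p, hp, e⟩ => e ▸ h.mem p hp⟩
  rw [this, Finset.card_image_of_injOn, Finset.card_range]
  intro p hp p' hp' e
  exact h.inj p (by simpa using hp) p' (by simpa using hp') e

/-- Padding values. -/
def padValues (N : ℕ) (H : ℤ) : Finset ℤ := (Finset.range N).image fun p : ℕ => H + p

section Slot

/- Registers from `z` on are used for work: `z` holds the number of padding values, `z + 4` the
least padding value, `z + 8` the offset of the window; `z + 10`, `z + 11`, `z + 12` are scratch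
registers.  Array `k` counts multiplicities; the window is in the arrays from `k + 1` on. -/
variable (z k i : ℕ) (val bit : Expr)

/-- Write the padding values. -/
def padProg : Prog :=
  .seq (.assign (z + 10) (.const 0))
    (.loop (.bin .lt (.reg (z + 10)) (.reg z))
      (.seq (.store (k + 2 + i) (.bin .add (.reg (z + 8)) (.reg (z + 10)))
          (.bin .add (.reg (z + 4)) (.reg (z + 10))))
        (.assign (z + 10) (.bin .add (.reg (z + 10)) (.const 1)))))

/-- Count multiplicities of values. -/
def countProg : Prog :=
  .seq (.assign (z + 10) (.const 0))
    (.loop (.bin .lt (.reg (z + 10)) (.reg i))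
      (.seq (.assign (z + 12) val)
        (.seq (.store k (.reg (z + 12)) (.bin .add (.read k (.reg (z + 12))) (.const 1)))
          (.assign (z + 10) (.bin .add (.reg (z + 10)) (.const 1))))))

/-- Write the values whose multiplicity has the given binary digit, and clear the counters. -/
def selectProg : Prog :=
  .seq (.assign (z + 10) (.const 0)) <|
  .seq (.assign (z + 11) (.reg z))
    (.loop (.bin .lt (.reg (z + 10)) (.reg i)) <|
      .seq (.assign (z + 12) val) <|
      .seq (.ite (.bin .mod (.bin .shr (.read k (.reg (z + 12))) bit) (.const 2))
        (.seq (.store (k + 2 + i) (.bin .add (.reg (z + 8)) (.reg (z + 11))) (.reg (z + 12)))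
          (.assign (z + 11) (.bin .add (.reg (z + 11)) (.const 1))))
        .skip) <|
      .seq (.store k (.reg (z + 12)) (.const 0))
        (.assign (z + 10) (.bin .add (.reg (z + 10)) (.const 1))))

/-- Write one set of the instance and its size. -/
def slotProg : Prog :=
  .seq (padProg z k i) <| .seq (countProg z k i val) <| .seq (selectProg z k i val bit)
    (.store (k + 1) (.bin .add (.reg (z + 8)) (.const i)) (.reg (z + 11)))

/-- A property of states that fixes everything except scratch registers and the arrays from `k` on,
and that determines the values that are to be written. -/
structure SlotEnv (N n : ℕ) (H off X B : ℤ) (f : ℕ → ℤ) (b κ : ℕ) (E : State → Prop) : Prop where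
  setReg : ∀ σ x v, E σ → z + 10 ≤ x → |v| ≤ X → E (σ.setReg x v)
  setMem : ∀ σ A a v, E σ → k ≤ A → |v| ≤ X → E (σ.setMem A a v)
  bdd : ∀ σ, E σ → σ.Bdd X
  regN : ∀ σ, E σ → σ.reg z = N
  regH : ∀ σ, E σ → σ.reg (z + 4) = H
  regOff : ∀ σ, E σ → σ.reg (z + 8) = off
  regCard : ∀ σ, E σ → σ.reg i = n
  val_eq : ∀ σ, E σ → ∀ j < n, σ.reg (z + 10) = j → val.eval σ = f j
  bit_eq : ∀ σ, E σ → bit.eval σ = b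
  two_le : 2 ≤ X
  pow_le : X ^ κ ≤ B
  val_tame : val.Tame X
  bit_tame : bit.Tame X
  val_cost : val.cost ≤ κ
  bit_cost : bit.cost + 10 ≤ κ
  card_le : (i : ℤ) + N + n + 1 ≤ X
  pad_le : |H| + N ≤ X
  f_le : ∀ j < n, |f j| ≤ X
  pad_ne : ∀ j < n, f j < H
  i_lt : i < z

namespace SlotEnv

variable {z k i val bit} {N n : ℕ} {H off X B : ℤ} {f : ℕ → ℤ} {b κ : ℕ} {E : State → Prop}
  (h : SlotEnv z k i val bit N n H off X B f b κ E)

include h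

theorem fits {σ : State} (hσ : E σ) {e : Expr} (he : e.Tame X) (hc : e.cost ≤ κ) :
    e.Fits B σ :=
  he.fits h.two_le h.pow_le (h.bdd σ hσ) hc

theorem run_pad {σ : State} (hσ : E σ) :
    Run B (padProg z k i) σ (15 * N + 6) fun σ' => E σ' ∧ ∀ A a, σ'.mem A a =
      if A = k + 2 + i ∧ off ≤ a ∧ a < off + N then H + (a - off) else σ.mem A a := by
  have h2 := h.two_le
  have hκ := h.bit_cost
  have hX := h.card_le
  have hP := h.pad_le
  refine (Run.seq (T := 2) (T' := N * (3 + 1 + 11) + (3 + 1)) ?_).mono (by omega) fun _ h => h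
  refine Run.assign (h.fits hσ (by simp [Expr.Tame]; omega) (by simp [Expr.cost]; omega)) ?_
  have h0 := h.setReg σ (z + 10) 0 hσ (by omega) (by simp; omega)
  refine (Run.loop N (fun j σ' => E σ' ∧ σ'.reg (z + 10) = j ∧ ∀ A a, σ'.mem A a =
      if A = k + 2 + i ∧ off ≤ a ∧ a < off + j then H + (a - off) else σ.mem A a)
      ?_ ?_ ?_ ?_).mono le_rfl fun σ' h' => ⟨h'.1, h'.2.2⟩
  · rintro j - σ' ⟨h1, -⟩
    exact h.fits h1 (by simp [Expr.Tame, BinOp.Tame]) (by simp [Expr.cost]; omega)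
  · rintro j - σ' ⟨h1, h3, -⟩
    simp [Expr.eval, BinOp.eval, h3, h.regN σ' h1]
  · rintro j hj σ' ⟨h1, h3, h4⟩
    refine (Run.seq (T := 7) (T' := 4) ?_)
    refine Run.store (h.fits h1 (by simp [Expr.Tame, BinOp.Tame]) (by simp [Expr.cost]; omega))
      (h.fits h1 (by simp [Expr.Tame, BinOp.Tame]) (by simp [Expr.cost]; omega)) ?_
    simp only [Expr.eval, BinOp.eval, h.regOff _ h1, h.regH _ h1, h3]
    have h5 := h.setMem σ' (k + 2 + i) (off + j) (H + j) h1 (by omega)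
      ((abs_add_le _ _).trans (by simp; omega))
    refine Run.assign (h.fits h5 (by simp [Expr.Tame, BinOp.Tame]; omega)
      (by simp [Expr.cost]; omega)) ⟨?_, ?_, ?_⟩
    · refine h.setReg _ _ _ h5 (by omega) ?_
      simp only [Expr.eval, BinOp.eval, State.setMem_reg, h3]
      rw [abs_le]; omega
    · simp [Expr.eval, BinOp.eval, h3]
    · intro A a
      simp only [State.setReg_mem, State.setMem_mem, h4]
      push_cast
      by_cases h6 : A = k + 2 + i
      · by_cases h7 : a = off + j
        · subst h7; simp [h6]
        · simp only [h6, h7, and_false, if_false, true_and]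
          have : (off ≤ a ∧ a < off + (j + 1)) ↔ (off ≤ a ∧ a < off + j) := by omega
          simp only [this]
      · simp [h6]
  · refine ⟨h0, by simp [Expr.eval], fun A a => ?_⟩
    simp only [State.setReg_mem]
    rw [if_neg]; push_cast; omega

/-- The counter of a value is the cell whose address is the value itself. As the counters start at
0, one linear pass suffices and nothing has to be sorted. -/
theorem run_count {σ : State} (hσ : E σ) (h0 : ∀ a, σ.mem k a = 0) :
    Run B (countProg z k i val) σ ((val.cost + 15) * n + 6) fun σ' => E σ' ∧
      (∀ a, σ'.mem k a = valueCount (Finset.range n) f a) ∧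
      ∀ A, A ≠ k → σ'.mem A = σ.mem A := by
  have h2 := h.two_le
  have hκ := h.bit_cost
  have hX := h.card_le
  have hi := h.i_lt
  refine (Run.seq (T := 2) (T' := n * (3 + 1 + (val.cost + 1 + (6 + 4))) + (3 + 1)) ?_).mono
    (by rw [mul_comm n]; simp only [add_mul]; omega) fun _ h => h
  refine Run.assign (h.fits hσ (by simp [Expr.Tame]; omega) (by simp [Expr.cost]; omega)) ?_
  have h00 := h.setReg σ (z + 10) 0 hσ (by omega) (by simp; omega)
  refine (Run.loop n (fun j σ' => E σ' ∧ σ'.reg (z + 10) = j ∧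
      (∀ a, σ'.mem k a = valueCount (Finset.range j) f a) ∧
      ∀ A, A ≠ k → σ'.mem A = σ.mem A)
      ?_ ?_ ?_ ?_).mono le_rfl fun σ' h' => ⟨h'.1, h'.2.2⟩
  · rintro j - σ' ⟨h1, -⟩
    exact h.fits h1 (by simp [Expr.Tame, BinOp.Tame]) (by simp [Expr.cost]; omega)
  · rintro j - σ' ⟨h1, h3, -⟩
    simp [Expr.eval, BinOp.eval, h3, h.regCard σ' h1]
  · rintro j hj σ' ⟨h1, h3, h4, h5⟩
    refine Run.seq (Run.assign (h.fits h1 h.val_tame h.val_cost) ?_)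
    rw [h.val_eq σ' h1 j hj h3]
    have h6 := h.setReg σ' (z + 12) (f j) h1 (by omega) (h.f_le j hj)
    have hle : valueCount (Finset.range j) f (f j) ≤ j :=
      (Finset.card_filter_le _ _).trans (by simp)
    refine Run.seq (Run.store (h.fits h6 (by simp [Expr.Tame]) (by simp [Expr.cost]; omega))
      (h.fits h6 (by simp [Expr.Tame, BinOp.Tame]; omega) (by simp [Expr.cost]; omega)) ?_)
    simp only [Expr.eval, BinOp.eval, State.setReg_reg, State.setReg_mem, if_true, h4]
    have h7 := h.setMem _ k (f j) (valueCount (Finset.range j) f (f j) + 1) h6 le_rfl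
      (by rw [abs_le]; omega)
    refine Run.assign (h.fits h7 (by simp [Expr.Tame, BinOp.Tame]; omega)
      (by simp [Expr.cost]; omega)) ⟨?_, ?_, ?_, ?_⟩
    · refine h.setReg _ _ _ h7 (by omega) ?_
      simp [Expr.eval, BinOp.eval, h3]
      rw [abs_le]; omega
    · simp [Expr.eval, BinOp.eval, h3]
    · intro a
      simp only [State.setReg_mem, State.setMem_mem, h4, valueCount, Finset.range_add_one,
        Finset.filter_insert]
      by_cases h8 : a = f j
      · subst h8; simp
      · simp [h8, Ne.symm h8]
    · intro A hA
      rw [← h5 A hA]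
      ext a
      simp [hA]
  · refine ⟨h00, by simp [Expr.eval], fun a => ?_, fun A hA => by simp⟩
    simp [h0, valueCount]

/-- The second pass appends the distinct values whose multiplicity has the given binary digit to the
padding, and clears the table of multiplicities. -/
theorem run_select {σ : State} (hσ : E σ)
    (h0 : ∀ a, σ.mem k a = valueCount (Finset.range n) f a)
    (hpad : Lists (fun p => σ.mem (k + 2 + i) (off + p)) N (padValues N H)) :
    Run B (selectProg z k i val bit) σ ((val.cost + bit.cost + 27) * n + 8) fun σ' => E σ' ∧
      (∀ a, σ'.mem k a = 0) ∧ ∃ o : ℕ, o ≤ N + n ∧ σ'.reg (z + 11) = o ∧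
        Lists (fun p => σ'.mem (k + 2 + i) (off + p)) o
          (padValues N H ∪ bitValues (Finset.range n) f b) ∧
        ∀ A a, A ≠ k → (A = k + 2 + i → a < off ∨ off + o ≤ a) → σ'.mem A a = σ.mem A a := by
  have h2 := h.two_le
  have hκ := h.bit_cost
  have hX := h.card_le
  have hi := h.i_lt
  refine (Run.seq (T := 2) (T' := 2 + (n * (3 + 1 + (val.cost + 1 + ((bit.cost + 5 + 1 + (5 + 4)) +
    (3 + 4)))) + (3 + 1))) ?_).mono
    (by rw [mul_comm n]; simp only [add_mul]; omega) fun _ h => h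
  refine Run.assign (h.fits hσ (by simp [Expr.Tame]; omega) (by simp [Expr.cost]; omega)) ?_
  have h00 := h.setReg σ (z + 10) 0 hσ (by omega) (by simp; omega)
  refine Run.seq (Run.assign (h.fits h00 (by simp [Expr.Tame]) (by simp [Expr.cost]; omega)) ?_)
  have h01 := h.setReg _ (z + 11) N h00 (by omega) (by simp; omega)
  set G : ℕ → Finset ℤ := fun j => ((Finset.range j).image f).filter
    fun v => valueCount (Finset.range n) f v / 2 ^ b % 2 = 1 with hG
  -- Counters of values already met are 0, so that a repeated value fails the bit test and is not
  -- written twice. The number o counts the padding and the values written so far.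
  refine (Run.loop n (fun j σ' => E σ' ∧ σ'.reg (z + 10) = j ∧
      (∀ a, σ'.mem k a = if a ∈ (Finset.range j).image f then 0 else
        (valueCount (Finset.range n) f a : ℤ)) ∧
      ∃ o : ℕ, o ≤ N + j ∧ σ'.reg (z + 11) = o ∧
        Lists (fun p => σ'.mem (k + 2 + i) (off + p)) o (padValues N H ∪ G j) ∧
        ∀ A a, A ≠ k → (A = k + 2 + i → a < off ∨ off + o ≤ a) → σ'.mem A a = σ.mem A a)
      ?_ ?_ ?_ ?_).mono le_rfl fun σ' h' => ⟨h'.1, fun a => ?_, h'.2.2.2⟩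
  · rintro j - σ' ⟨h1, -⟩
    exact h.fits h1 (by simp [Expr.Tame, BinOp.Tame]) (by simp [Expr.cost]; omega)
  · rintro j - σ' ⟨h1, h3, -⟩
    simp [Expr.eval, BinOp.eval, h3, h.regCard σ' h1]
  · rintro j hj σ' ⟨h1, h3, h4, o, ho, h5, h6, h7⟩
    refine Run.seq (Run.assign (h.fits h1 h.val_tame h.val_cost) ?_)
    rw [h.val_eq σ' h1 j hj h3]
    have h8 := h.setReg σ' (z + 12) (f j) h1 (by omega) (h.f_le j hj)
    -- the rest of the round, after the test
    have key : ∀ (o' : ℕ) (σ₁ : State), E σ₁ → σ₁.reg (z + 12) = f j → σ₁.reg (z + 10) = j →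
        (∀ a, σ₁.mem k a = σ'.mem k a) → o' ≤ N + (j + 1) → σ₁.reg (z + 11) = o' →
        Lists (fun p => σ₁.mem (k + 2 + i) (off + p)) o' (padValues N H ∪ G (j + 1)) →
        (∀ A a, A ≠ k → (A = k + 2 + i → a < off ∨ off + o' ≤ a) → σ₁.mem A a = σ.mem A a) →
        Run B (.seq (.store k (.reg (z + 12)) (.const 0))
          (.assign (z + 10) (.bin .add (.reg (z + 10)) (.const 1)))) σ₁ (3 + 4)
          fun σ' => E σ' ∧ σ'.reg (z + 10) = ((j + 1 : ℕ) : ℤ) ∧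
      (∀ a, σ'.mem k a = if a ∈ (Finset.range (j + 1)).image f then 0 else
        (valueCount (Finset.range n) f a : ℤ)) ∧
      ∃ o : ℕ, o ≤ N + (j + 1) ∧ σ'.reg (z + 11) = o ∧
        Lists (fun p => σ'.mem (k + 2 + i) (off + p)) o (padValues N H ∪ G (j + 1)) ∧
        ∀ A a, A ≠ k → (A = k + 2 + i → a < off ∨ off + o ≤ a) → σ'.mem A a = σ.mem A a := by
      intro o' σ₁ g1 g2 g3 g4 g5 g6 g7 g8
      refine Run.seq (Run.store (h.fits g1 (by simp [Expr.Tame]) (by simp [Expr.cost]; omega))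
        (h.fits g1 (by simp [Expr.Tame]; omega) (by simp [Expr.cost]; omega)) ?_)
      simp only [Expr.eval, g2]
      have g9 := h.setMem _ k (f j) 0 g1 le_rfl (by simp; omega)
      refine Run.assign (h.fits g9 (by simp [Expr.Tame, BinOp.Tame]; omega)
        (by simp [Expr.cost]; omega)) ⟨?_, ?_, ?_, o', g5, by simp [g6], ?_, ?_⟩
      · refine h.setReg _ _ _ g9 (by omega) ?_
        simp [Expr.eval, BinOp.eval, g3]
        rw [abs_le]; omega
      · simp [Expr.eval, BinOp.eval, g3]
      · intro a
        simp only [State.setReg_mem, State.setMem_mem, g4, h4, Finset.range_add_one,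
          Finset.image_insert, Finset.mem_insert]
        by_cases hc : a = f j <;> simp [hc]
      · exact g7.congr fun p _ => by simp [show k + 2 + i ≠ k by omega]
      · intro A a hA hA'
        simp [hA, g8 A a hA hA']
    have hGs : G (j + 1) = if valueCount (Finset.range n) f (f j) / 2 ^ b % 2 = 1 then
        insert (f j) (G j) else G j := by
      simp only [hG, Finset.range_add_one, Finset.image_insert, Finset.filter_insert]
    have htest : (Expr.bin .mod (.bin .shr (.read k (.reg (z + 12))) bit) (.const 2)).eval
        (σ'.setReg (z + 12) (f j)) = if f j ∈ (Finset.range j).image f then 0 else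
          ((valueCount (Finset.range n) f (f j) / 2 ^ b % 2 : ℕ) : ℤ) := by
      simp only [Expr.eval, BinOp.eval, State.setReg_reg, State.setReg_mem, if_true, h4,
        h.bit_eq _ h8, Int.toNat_natCast]
      split_ifs <;> simp
    refine Run.seq ((Run.ite (T := 5 + 4) (h.fits h8 ?_ ?_) (fun ht => ?_) (fun ht => ?_)).mono
      (by simp [Expr.cost]; omega) fun _ h => h)
    · simp only [Expr.Tame, BinOp.Tame, true_and]
      exact ⟨h.bit_tame, by simp; omega⟩
    · simp [Expr.cost]; omega
    · rw [htest] at ht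
      have hnew : f j ∉ (Finset.range j).image f := fun hc => ht (if_pos hc)
      rw [if_neg hnew] at ht
      have hbit : valueCount (Finset.range n) f (f j) / 2 ^ b % 2 = 1 := by omega
      refine Run.seq (Run.store (h.fits h8 (by simp [Expr.Tame, BinOp.Tame])
        (by simp [Expr.cost]; omega)) (h.fits h8 (by simp [Expr.Tame])
        (by simp [Expr.cost]; omega)) ?_)
      simp only [Expr.eval, BinOp.eval, h.regOff _ h8, State.setReg_reg, if_true,
        show z + 11 ≠ z + 12 by omega, if_false, h5]
      have h9 := h.setMem _ (k + 2 + i) (off + o) (f j) h8 (by omega) (h.f_le j hj)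
      refine Run.assign (h.fits h9 (by simp [Expr.Tame, BinOp.Tame]; omega)
        (by simp [Expr.cost]; omega)) ?_
      refine key (o + 1) _ (h.setReg _ _ _ h9 (by omega) ?_) (by simp) (by simp [h3])
        (fun a => by simp [show k ≠ k + 2 + i by omega]) (by omega)
        (by simp [Expr.eval, BinOp.eval, h5]) ?_ ?_
      · simp [Expr.eval, BinOp.eval, h5]
        rw [abs_le]; omega
      · rw [hGs, if_pos hbit, Finset.union_insert]
        refine h6.snoc ?_ (fun p hp => ?_) (by simp)
        -- The new value lies below H, so it is no padding value, and its counter was still nonzero,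
        -- so it was not met before.
        · rw [Finset.mem_union, not_or]
          refine ⟨fun hc => ?_, fun hc => hnew (Finset.mem_filter.1 hc).1⟩
          simp only [padValues, Finset.mem_image, Finset.mem_range] at hc
          obtain ⟨p, -, hp⟩ := hc
          have := h.pad_ne j hj
          omega
        · simp; omega
      · intro A a hA hA'
        rw [← h7 A a hA fun e => by have := hA' e; push_cast at this; omega]
        simp only [State.setReg_mem, State.setMem_mem]
        rw [if_neg]
        rintro ⟨e, e'⟩
        have := hA' e
        push_cast at this
        omega
    · rw [htest] at ht
      refine (Run.skip ?_).mono (by omega) fun _ h => h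
      refine key o _ h8 (by simp) (by simp [h3]) (fun a => rfl) (by omega) (by simp [h5]) ?_ h7
      -- A failed test means that the digit is 0 or that the value has been treated already.
      have : G (j + 1) = G j := by
        rw [hGs]
        split_ifs with hc
        · rw [hc] at ht
          have hm : f j ∈ (Finset.range j).image f := by
            by_contra hm
            simp [hm] at ht
          exact Finset.insert_eq_of_mem (Finset.mem_filter.2 ⟨hm, hc⟩)
        · rfl
      rw [this]
      exact h6
  · refine ⟨by simpa [Expr.eval, h.regN _ hσ] using h01, by simp [Expr.eval], fun a => ?_, N,
      by omega, ?_, ?_, fun A a _ _ => rfl⟩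
    · simp [h0]
    · simp [Expr.eval, h.regN _ hσ]
    · simpa [hG] using hpad
  · rw [h'.2.2.1]
    split_ifs with hc
    · rfl
    · rw [Nat.cast_eq_zero, valueCount, Finset.card_eq_zero, Finset.filter_eq_empty_iff]
      intro j hj e
      exact hc (Finset.mem_image.2 ⟨j, hj, e⟩)

end SlotEnv

/-- Slot `i` of the window around `off` lists the set `S`. -/
def SlotDone (k i : ℕ) (W off : ℤ) (S : Finset ℤ) (σ : State) : Prop :=
  σ.mem (k + 1) (off + i) = S.card ∧
  Lists (fun p => σ.mem (k + 2 + i) (off + p)) S.card S ∧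
  ∀ a, off - W ≤ a → (a < off ∨ off + S.card ≤ a) → σ.mem (k + 2 + i) a = 0

theorem SlotEnv.run_slot {z k i val bit} {N n : ℕ} {H off X B W : ℤ} {f : ℕ → ℤ} {b κ : ℕ}
    {E : State → Prop} (h : SlotEnv z k i val bit N n H off X B f b κ E) {σ : State} (hσ : E σ)
    (h0 : ∀ a, σ.mem k a = 0) (hfresh : ∀ a, off - W ≤ a → σ.mem (k + 2 + i) a = 0) :
    Run B (slotProg z k i val bit) σ ((2 * val.cost + bit.cost + 42) * (N + n) + 25) fun σ' =>
      E σ' ∧ (∀ a, σ'.mem k a = 0) ∧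
      SlotDone k i W off (padValues N H ∪ bitValues (Finset.range n) f b) σ' ∧
      ∀ A a, A ≠ k → A ≠ k + 2 + i → (A = k + 1 → a ≠ off + i) → σ'.mem A a = σ.mem A a := by
  have h2 := h.two_le
  have hκ := h.bit_cost
  have hX := h.card_le
  refine (Run.seq ((h.run_pad hσ).mono le_rfl fun σ₁ h₁ => Run.seq
    ((h.run_count h₁.1 fun a => ?_).mono le_rfl fun σ₂ h₂ => Run.seq
    ((h.run_select h₂.1 h₂.2.1 ?_).mono le_rfl fun σ₃ h₃ => (?_ : Run B _ σ₃ 5 _))))).mono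
    ?_ fun _ h => h
  · rw [h₁.2, if_neg (by omega), h0]
  · rw [h₂.2.2 _ (by omega)]
    have e : ∀ p < N, σ₁.mem (k + 2 + i) (off + p) = H + p := fun p hp => by
      rw [h₁.2, if_pos (by omega)]; ring
    refine ⟨fun p hp => ?_, fun p hp p' hp' he => ?_, fun v hv => ?_⟩
    · rw [e p hp]; exact Finset.mem_image.2 ⟨p, by simpa using hp, rfl⟩
    · rw [e p hp, e p' hp'] at he; omega
    · obtain ⟨p, hp, rfl⟩ := Finset.mem_image.1 hv
      exact ⟨p, by simpa using hp, e p (by simpa using hp)⟩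
  · obtain ⟨g1, g2, o, g3, g4, g5, g6⟩ := h₃
    refine Run.store (h.fits g1 (by simp [Expr.Tame, BinOp.Tame]; omega)
      (by simp [Expr.cost]; omega)) (h.fits g1 (by simp [Expr.Tame])
      (by simp [Expr.cost]; omega)) ?_
    simp only [Expr.eval, BinOp.eval, h.regOff _ g1, g4]
    refine ⟨h.setMem _ _ _ _ g1 (by omega) (by simp; omega), fun a => by simp [g2], ⟨?_, ?_, ?_⟩, ?_⟩
    · simp [g5.card]
    · rw [g5.card]
      exact g5.congr fun p _ => by simp [show k + 2 + i ≠ k + 1 by omega]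
    · intro a ha ha'
      rw [g5.card] at ha'
      rw [State.setMem_mem, if_neg (by omega), g6 _ _ (by omega) (fun _ => ha'),
        h₂.2.2 _ (by omega), h₁.2, if_neg, hfresh a ha]
      -- The cells written by the padding pass are among the first o entries of the list, so beyond
      -- the list everything is still zero.
      have : N ≤ o := by
        rw [← g5.card]
        refine le_trans ?_ (Finset.card_le_card Finset.subset_union_left)
        rw [padValues, Finset.card_image_of_injective _ fun p p' e => by simpa using e,
          Finset.card_range]
      omega
    · intro A a hA hA' hA''
      rw [State.setMem_mem, if_neg (fun e => hA'' e.1 e.2), g6 _ _ hA (fun e => absurd e hA'),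
        h₂.2.2 _ hA, h₁.2, if_neg (fun e => hA' e.1)]
  · nlinarith

end Slot

end WordRAM

/-! ## Instances of `#k`-SUM -/

/-- The `#k`-SUM instance with the given sets and target. -/
def kSumInput {k : ℕ} (S : Fin k → Finset ℤ) (t : ℤ) : Input (fun _ : Fin k => 1) 1 where
  A i := (S i).map ⟨fun v _ => v, fun _ _ h => congrFun h 0⟩
  t _ := t

theorem card_kSumInput {k : ℕ} (S : Fin k → Finset ℤ) (t : ℤ) (i : Fin k) :
    ((kSumInput S t).A i).card = (S i).card := by
  simp [kSumInput]

theorem numWitnesses_kSumInput {k : ℕ} (S : Fin k → Finset ℤ) (t : ℤ) :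
    (kSumInput S t).numWitnesses (IsKSumWitness k) =
      ((Fintype.piFinset S).filter fun v => ∑ i, v i = t).card := by
  rw [Input.numWitnesses, ← Set.ncard_coe_finset]
  refine (Set.ncard_congr (fun v _ i _ => v i) ?_ ?_ ?_).symm
  · intro v hv
    simp only [Finset.coe_filter, Fintype.mem_piFinset, Set.mem_ofPred_eq] at hv
    exact ⟨fun i => Finset.mem_map.2 ⟨v i, hv.1 i, rfl⟩, hv.2⟩
  · intro v w _ _ h
    ext i
    exact congrFun (congrFun h i) 0
  · rintro a ⟨ha, ht⟩
    refine ⟨fun i => a i 0, ?_, ?_⟩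
    · simp only [Finset.coe_filter, Fintype.mem_piFinset, Set.mem_ofPred_eq]
      refine ⟨fun i => ?_, ht⟩
      obtain ⟨v, hv, e⟩ := Finset.mem_map.1 (ha i)
      rw [← e]
      exact hv
    · ext i s
      rw [Subsingleton.elim s 0]

namespace WordRAM

theorem encodes_kSumInput {k : ℕ} {S : Fin k → Finset ℤ} {t : ℤ} {τ : State}
    (hcard : ∀ i : Fin k, τ.reg i = (S i).card) (ht : τ.reg k = t)
    (hreg : ∀ x, k + 1 ≤ x → τ.reg x = 0)
    (hlist : ∀ i : Fin k, Lists (fun p => τ.mem i p) (S i).card (S i))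
    (hzero : ∀ (i : Fin k) (a : ℤ), (a < 0 ∨ (S i).card ≤ a) → τ.mem i a = 0)
    (hmem : ∀ A a, k ≤ A → τ.mem A a = 0) : (kSumInput S t).Encodes τ := by
  refine ⟨fun i => by rw [hcard, card_kSumInput], fun r => ?_, hreg, ?_, ?_⟩
  · rw [Subsingleton.elim r 0]; simpa [kSumInput] using ht
  · have hm : ∀ (i : Fin k) (j : Fin ((kSumInput S t).A i).card),
        (fun _ => τ.mem i j) ∈ (kSumInput S t).A i := fun i j => by
      have := (hlist i).mem j (by rw [← card_kSumInput S t]; exact j.2)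
      exact Finset.mem_map.2 ⟨_, this, rfl⟩
    refine ⟨fun i => Equiv.ofBijective (fun j => ⟨fun _ => τ.mem i j, hm i j⟩) ⟨?_, ?_⟩, ?_⟩
    · intro j j' h
      have h' := congrFun (congrArg Subtype.val h) 0
      refine Fin.ext ((hlist i).inj j ?_ j' ?_ h')
      · rw [← card_kSumInput S t]; exact j.2
      · rw [← card_kSumInput S t]; exact j'.2
    · rintro ⟨a, ha⟩
      obtain ⟨v, hv, rfl⟩ := Finset.mem_map.1 ha
      obtain ⟨p, hp, e⟩ := (hlist i).surj v hv
      exact ⟨⟨p, by rw [card_kSumInput]; exact hp⟩, Subtype.ext (funext fun _ => e)⟩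
    · intro i j s
      rw [Subsingleton.elim s 0]
      simp
      rfl
  · intro A a hA
    rcases lt_or_ge A k with h | h
    · refine hzero ⟨A, h⟩ a ?_
      by_contra! hc
      refine hA ⟨⟨A, h⟩, ⟨a.toNat, ?_⟩, 0, rfl, ?_⟩
      · rw [card_kSumInput]; omega
      · simp; omega
    · exact hmem A a h

/-! ## One round -/

/-- All values are bounded, and everything but scratch registers and the arrays from `k` on is
fixed. -/
structure Fixed (z k : ℕ) (X : ℤ) (ρ : ℕ → ℤ) (μ : ℕ → ℤ → ℤ) (σ : State) : Prop where
  bdd : σ.Bdd X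
  reg : ∀ x < z + 10, σ.reg x = ρ x
  mem : ∀ A < k, σ.mem A = μ A

section Round

variable (z k : ℕ) (val bit : ℕ → Expr) (tgt chk : Expr) (p : Prog)

/-- Write the first sets of the instance. -/
def buildProg : ℕ → Prog
  | 0 => .skip
  | m + 1 => .seq (buildProg m) (slotProg z k m (val m) (bit m))

/-- Write the instance, call the program for it, and add the weighted result. -/
def roundProg : Prog :=
  .seq (buildProg z k val bit k) <|
  .seq (.store (k + 1) (.bin .add (.reg (z + 8)) (.const k)) tgt) <|
  .seq (p.reloc (k + 1) (z + 8)) <|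
  .seq (.assign (z + 11) (.bin .shl (.const 1) (.sum ((List.range k).map bit)))) <|
  .seq (.assign (z + 9) (.bin .add (.reg (z + 9))
    (.bin .mul chk (.bin .mul (.reg (z + 11)) (.read (k + 1) (.reg (z + 8))))))) <|
  .seq (.assign (z + 7) (.bin .add (.reg (z + 7)) (.const 1)))
    (.assign (z + 8) (.bin .add (.reg (z + 8)) (.reg (z + 5))))

variable {z k val bit tgt chk p}
variable {N : ℕ} {n : ℕ → ℕ} {H off X B W t : ℤ} {f : ℕ → ℕ → ℤ} {b : ℕ → ℕ} {κ : ℕ}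

/-- The set in slot `i`. -/
def slotSet (N : ℕ) (H : ℤ) (n : ℕ → ℕ) (f : ℕ → ℕ → ℤ) (b : ℕ → ℕ) (i : ℕ) : Finset ℤ :=
  padValues N H ∪ bitValues (Finset.range (n i)) (f i) (b i)

theorem card_slotSet_le (i : ℕ) : (slotSet N H n f b i).card ≤ N + n i :=
  (Finset.card_union_le _ _).trans (add_le_add (Finset.card_image_le.trans (by simp))
    ((Finset.card_filter_le _ _).trans (Finset.card_image_le.trans (by simp))))

/-- Different slots write to different arrays and to different size cells, so finished slots
survive; the counters are back at 0 for the next slot. -/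
theorem run_build {E : State → Prop}
    (hs : ∀ i < k, SlotEnv z k i (val i) (bit i) N (n i) H off X B (f i) (b i) κ E)
    (hn : ∀ i < k, n i ≤ N) {σ : State} (hσ : E σ) (h0 : ∀ a, σ.mem k a = 0)
    (hfresh : ∀ A a, k + 1 ≤ A → off - W ≤ a → σ.mem A a = 0) (m : ℕ) (hm : m ≤ k) :
    Run B (buildProg z k val bit m) σ (m * ((3 * κ + 42) * (2 * N) + 25) + 1) fun σ' =>
      E σ' ∧ (∀ a, σ'.mem k a = 0) ∧
      (∀ i < m, SlotDone k i W off (slotSet N H n f b i) σ') ∧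
      ∀ A a, A ≠ k → (∀ i < m, A ≠ k + 2 + i) → (A = k + 1 → ∀ i < m, a ≠ off + i) →
        σ'.mem A a = σ.mem A a := by
  induction m with
  | zero => exact (Run.skip ⟨hσ, h0, by simp, fun _ _ _ _ _ => rfl⟩).mono (by simp) fun _ h => h
  | succ m ih =>
    refine (Run.seq ((ih (by omega)).mono le_rfl fun σ₁ h₁ =>
      ((hs m hm).run_slot (W := W) h₁.1 h₁.2.1 fun a ha => ?_).mono le_rfl fun σ₂ h₂ =>
        ⟨h₂.1, h₂.2.1, ?_, ?_⟩)).mono ?_ fun _ h => h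
    · rw [h₁.2.2.2 _ _ (by omega) (fun i hi => by omega) (fun e => by omega)]
      exact hfresh _ _ (by omega) ha
    · have h1 : (2 * (val m).cost + (bit m).cost + 42) * (N + n m) ≤ (3 * κ + 42) * (2 * N) :=
        Nat.mul_le_mul (by have := (hs m hm).val_cost; have := (hs m hm).bit_cost; omega)
          (by have := hn m hm; omega)
      generalize (3 * κ + 42) * (2 * N) = G at *
      rw [add_mul m, one_mul]; omega
    · intro i hi
      rcases Nat.lt_succ_iff_lt_or_eq.1 hi with hi | rfl
      · obtain ⟨d1, d2, d3⟩ := h₁.2.2.1 i hi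
        have e : ∀ a, σ₂.mem (k + 2 + i) a = σ₁.mem (k + 2 + i) a := fun a =>
          h₂.2.2.2 _ _ (by omega) (by omega) (fun e => by omega)
        refine ⟨?_, d2.congr fun p _ => e _, fun a ha ha' => (e a).trans (d3 a ha ha')⟩
        rw [h₂.2.2.2 _ _ (by omega) (by omega) (fun _ => by omega), d1]
      · exact h₂.2.2.1
    · intro A a hA hA' hA''
      rw [h₂.2.2.2 A a hA (hA' m (by omega)) (fun e => hA'' e m (by omega)),
        h₁.2.2.2 A a hA (fun i hi => hA' i (by omega)) (fun e i hi => hA'' e i (by omega))]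

/-- `hfresh` makes the window around `off` look like an initial state of the machine once the
instance is written. Building and calling write no cell beyond off + W; since 2 W < St, this lies
before the window of the next round. No used memory has to be cleared except for the counters. -/
theorem run_round {ρ ρ' : ℕ → ℤ} {μ : ℕ → ℤ → ℤ} {res Tc : ℕ} {γ St : ℤ}
    (hs : ∀ i < k, SlotEnv z k i (val i) (bit i) N (n i) H off X B (f i) (b i) κ
      (Fixed z k X ρ μ))
    (hn : ∀ i < k, n i ≤ N) (hk : 0 < k)
    (htgt : ∀ σ, Fixed z k X ρ μ σ → tgt.eval σ = t) (htgt_tame : tgt.Tame X)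
    (htgt_cost : tgt.cost ≤ κ) (htX : |t| ≤ X)
    (hchk : ∀ σ, Fixed z k X ρ μ σ → chk.eval σ = γ) (hchk_tame : chk.Tame X)
    (hchk_cost : chk.cost + 10 ≤ κ) (hW0 : k + 1 ≤ W) (hW1 : 2 * N ≤ W) (hpW : p.regBound ≤ W)
    (hWX : W + |off| ≤ X) (hSt : 2 * W < St) (hStρ : ρ (z + 5) = St)
    (hbits_cost : (Expr.sum ((List.range k).map bit)).cost ≤ κ)
    (hbits_le : 2 ^ (∑ i ∈ Finset.range k, b i) ≤ X)
    (hcall : ∀ τ, (kSumInput (fun i : Fin k => slotSet N H n f b i) t).Encodes τ →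
      ∃ T τ', Exec W p τ T τ' ∧ T ≤ Tc ∧ τ'.reg 0 = res)
    (hρ' : ∀ x < z + 10, x ≠ z + 7 → x ≠ z + 8 → x ≠ z + 9 → ρ' x = ρ x)
    (hρ7 : ρ' (z + 7) = ρ (z + 7) + 1) (hρ8 : ρ' (z + 8) = off + St)
    (hρ9 : ρ' (z + 9) = ρ (z + 9) + γ * (2 ^ (∑ i ∈ Finset.range k, b i) * (res : ℤ)))
    (hρX : ∀ x < z + 10, |ρ' x| ≤ X)
    {σ : State} (hσ : Fixed z k X ρ μ σ) (h0 : ∀ a, σ.mem k a = 0)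
    (hfresh : ∀ A a, k + 1 ≤ A → off - W ≤ a → σ.mem A a = 0) :
    Run B (roundProg z k val bit tgt chk p) σ
      (k * ((3 * κ + 42) * (2 * N) + 25) + 4 * Tc + 4 * κ + 30) fun σ' =>
      Fixed z k X ρ' μ σ' ∧ (∀ a, σ'.mem k a = 0) ∧
      ∀ A a, k + 1 ≤ A → off + St - W ≤ a → σ'.mem A a = 0 := by
  have hs0 := hs 0 hk
  have h2 := hs0.two_le
  have hκ := hs0.bit_cost
  have hXB : X ≤ B := (le_self_pow₀ (by omega) (by omega)).trans hs0.pow_le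
  have hoffn := abs_nonneg off
  have fits : ∀ {σ : State} {e : Expr}, σ.Bdd X → e.Tame X → e.cost ≤ κ → e.Fits B σ :=
    fun hσ he hc => he.fits h2 hs0.pow_le hσ hc
  refine (Run.seq ((run_build hs hn hσ h0 hfresh k le_rfl).mono le_rfl fun σ₁ h₁ =>
    Run.seq (T := 3 + tgt.cost + 1) (T' := 4 * Tc + ((κ + 5) + ((chk.cost + 8) + (4 + 4)))) ?_)).mono
    (by omega) fun _ h => h
  obtain ⟨hf₁, hc₁, hd₁, hm₁⟩ := h₁
  refine Run.store (fits hf₁.bdd (by simp [Expr.Tame, BinOp.Tame]; omega)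
    (by simp [Expr.cost]; omega)) (fits hf₁.bdd htgt_tame htgt_cost) ?_
  simp only [Expr.eval, BinOp.eval, hs0.regOff _ hf₁, htgt _ hf₁]
  set σ₂ := σ₁.setMem (k + 1) (off + k) t with hσ₂
  have hb₂ : σ₂.Bdd X := hf₁.bdd.setMem htX
  have hmem₂ : ∀ A a, A ≠ k + 1 → σ₂.mem A a = σ₁.mem A a := fun A a hA => by
    simp [hσ₂, hA]
  have hz₂ : ∀ A a, k + 2 + k ≤ A → off - W ≤ a → σ₂.mem A a = 0 := fun A a hA ha => by
    rw [hmem₂ _ _ (by omega), hm₁ A a (by omega) (fun i hi => by omega) (fun e => by omega)]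
    exact hfresh A a (by omega) ha
  have hr₂ : ∀ a, off - W ≤ a → (∀ i ≤ k, a ≠ off + i) → σ₂.mem (k + 1) a = 0 := fun a ha ha' => by
    have e := ha' k le_rfl
    simp only [hσ₂, State.setMem_mem, true_and, if_neg e]
    rw [hm₁ _ a (by omega) (fun i hi => by omega) (fun _ i hi => ha' i (by omega))]
    exact hfresh _ a le_rfl ha
  have hSle : ∀ i < k, ((slotSet N H n f b i).card : ℤ) ≤ W := fun i hi => by
    have h1 := card_slotSet_le (N := N) (H := H) (n := n) (f := f) (b := b) i
    have h2 := hn i hi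
    omega
  -- the state seen by the called program
  set τ : State := ⟨fun x => if (x : ℤ) ≤ W then σ₂.mem (k + 1) (x + off) else 0,
    fun A a => if |a| ≤ W then σ₂.mem (k + 2 + A) (a + off) else 0⟩ with hτ
  have hpres : Presents (k + 1) (z + 8) W off τ σ₂ := by
    refine ⟨(hs0.regOff _ hf₁ : σ₁.reg (z + 8) = off), fun x hx => ?_, fun A a ha => ?_⟩
    · simp [hτ, hx]
    · simp [hτ, ha]
  have henc : (kSumInput (fun i : Fin k => slotSet N H n f b i) t).Encodes τ := by
    refine encodes_kSumInput (fun i => ?_) ?_ (fun x hx => ?_) (fun i => ?_) (fun i a ha => ?_)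
      (fun A a hA => ?_)
    · have hi := i.2
      simp only [hτ]
      rw [if_pos (by omega), hσ₂, State.setMem_mem, if_neg (by omega), add_comm ((i : ℕ) : ℤ), (hd₁ i hi).1]
    · simp only [hτ]
      rw [if_pos (by omega), hσ₂, State.setMem_mem, if_pos ⟨rfl, by ring⟩]
    · simp only [hτ]
      split_ifs
      · exact hr₂ _ (by omega) fun i hi => by omega
      · rfl
    · refine (hd₁ i i.2).2.1.congr fun p hp => ?_
      have := hSle i i.2
      simp only [hτ]
      rw [if_pos (by rw [Nat.abs_cast]; omega), hmem₂ _ _ (by omega), add_comm (p : ℤ)]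
    · simp only [hτ]
      split_ifs with haW
      · rw [hmem₂ _ _ (by omega)]
        refine (hd₁ i i.2).2.2 _ ?_ ?_
        · have := (abs_le.1 haW).1; omega
        · omega
      · rfl
    · simp only [hτ]
      split_ifs with haW
      · exact hz₂ _ _ (by omega) (by have := (abs_le.1 haW).1; omega)
      · rfl
  obtain ⟨T, τ', hexec, hT, hres⟩ := hcall τ henc
  -- Relocation also guarantees that registers, input arrays and counters survive the call.
  obtain ⟨T₃, σ₃, he₃, hT₃, hp₃, hso₃⟩ := hexec.reloc hWX hpW hpres
  have hb₃ : σ₃.Bdd X := he₃.bdd le_rfl hb₂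
  refine Run.seq ⟨T₃, σ₃, he₃.mono hXB, by omega, ?_⟩
  have hf₃ : Fixed z k X ρ μ σ₃ := by
    refine ⟨hb₃, fun x hx => ?_, fun A hA => ?_⟩
    · rw [hso₃.1]; exact hf₁.reg x hx
    · rw [← hf₁.mem A hA]
      ext a
      rw [hso₃.2 A a (Or.inl (by omega)), hmem₂ _ _ (by omega)]
  have hc₃ : ∀ a, σ₃.mem k a = 0 := fun a => by
    rw [hso₃.2 k a (Or.inl (by omega)), hmem₂ _ _ (by omega), hc₁]
  -- Such cells are outside the current window and beyond the lists written for the instance, whose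
  -- lengths are at most W.
  have hfr₃ : ∀ A a, k + 1 ≤ A → off + St - W ≤ a → σ₃.mem A a = 0 := by
    intro A a hA ha
    rw [hso₃.2 A a (Or.inr (by rw [lt_abs]; left; omega))]
    rcases Nat.lt_or_ge A (k + 2) with h | h
    · obtain rfl : A = k + 1 := by omega
      exact hr₂ a (by omega) fun i hi => by omega
    · rcases Nat.lt_or_ge A (k + 2 + k) with h' | h'
      · obtain ⟨i, rfl⟩ := Nat.exists_eq_add_of_le h
        have := hSle i (by omega)
        rw [hmem₂ _ _ (by omega)]
        exact (hd₁ i (by omega)).2.2 a (by omega) (Or.inr (by omega))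
      · exact hz₂ A a h' (by omega)
  have hres₃ : σ₃.mem (k + 1) off = res := by
    have := hp₃.reg_eq 0 (by omega)
    simpa [hres] using this
  have hbits : (Expr.sum ((List.range k).map bit)).eval σ₃ = (∑ i ∈ Finset.range k, b i : ℕ) := by
    have : List.map (Expr.eval σ₃ ∘ bit) (List.range k) =
        List.map (fun i => (b i : ℤ)) (List.range k) :=
      List.map_congr_left fun i hi => (hs i (List.mem_range.1 hi)).bit_eq σ₃ hf₃
    rw [Expr.eval_sum, List.map_map, this]
    push_cast
    simp [Finset.sum, Finset.range, Multiset.range]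
  have hbits_fits : (Expr.sum ((List.range k).map bit)).Fits B σ₃ := by
    refine ((Expr.poly_sum h2 fun e he => ?_).bounds h2).2 B
      ((pow_le_pow_right₀ (by omega) hbits_cost).trans hs0.pow_le)
    obtain ⟨i, hi, rfl⟩ := List.mem_map.1 he
    exact (hs i (List.mem_range.1 hi)).bit_tame.poly hb₃
  set w : ℤ := 2 ^ (∑ i ∈ Finset.range k, b i) with hw
  have hwe : (Expr.bin .shl (.const 1) (.sum ((List.range k).map bit))).eval σ₃ = w := by
    simp only [Expr.eval, BinOp.eval] at hbits ⊢
    rw [hbits, Int.toNat_natCast, one_mul]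
  have hwa : |w| ≤ X := by rw [abs_of_nonneg (by positivity)]; exact hbits_le
  -- A left shift is not tame, as it can grow exponentially; it fits because the weight itself is at
  -- most X.
  have hwf : (Expr.bin .shl (.const 1) (.sum ((List.range k).map bit))).Fits B σ₃ := by
    have h1 : |w| ≤ B := hwa.trans hXB
    rw [← hwe] at h1
    refine ⟨?_, hbits_fits, h1⟩
    simp only [Expr.Fits, abs_one]; omega
  refine (Run.seq (Run.assign hwf ?_)).mono (T := (Expr.bin .shl (.const 1) (.sum ((List.range k).map bit))).cost
    + 1 + ((chk.cost + 8) + (4 + 4))) (by simp only [Expr.cost]; omega) fun _ h => h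
  rw [hwe]
  have hb₄ := hb₃.setReg (x := z + 11) hwa
  have hf₄ : Fixed z k X ρ μ (σ₃.setReg (z + 11) w) := by
    refine ⟨hb₄, fun x hx => ?_, hf₃.mem⟩
    simp only [State.setReg_reg]
    rw [if_neg (by omega), hf₃.reg x hx]
  refine (Run.seq (Run.assign (fits hb₄ ?_ ?_) ?_)).mono (T := (Expr.bin .add (.reg (z + 9))
    (.bin .mul chk (.bin .mul (.reg (z + 11)) (.read (k + 1) (.reg (z + 8)))))).cost + 1 + (4 + 4))
    (by simp only [Expr.cost]; omega) fun _ h => h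
  · simp [Expr.Tame, BinOp.Tame, hchk_tame]
  · simp only [Expr.cost]; omega
  have hacc : (Expr.bin .add (.reg (z + 9)) (.bin .mul chk (.bin .mul (.reg (z + 11))
      (.read (k + 1) (.reg (z + 8)))))).eval (σ₃.setReg (z + 11) w) = ρ' (z + 9) := by
    have e8 := hs0.regOff _ hf₄
    have e9 := hf₄.reg (z + 9) (by omega)
    simp only [Expr.eval, BinOp.eval, hchk _ hf₄, e8, e9, hρ9, State.setReg_mem, hres₃]
    simp
  rw [hacc]
  have hb₅ := hb₄.setReg (x := z + 9) (hρX (z + 9) (by omega))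
  refine Run.seq (Run.assign (fits hb₅ (by simp [Expr.Tame, BinOp.Tame]; omega)
    (by simp [Expr.cost]; omega)) ?_)
  have e7 : (Expr.bin .add (.reg (z + 7)) (.const 1)).eval
      ((σ₃.setReg (z + 11) w).setReg (z + 9) (ρ' (z + 9))) = ρ' (z + 7) := by
    simp [Expr.eval, BinOp.eval, hρ7, hf₃.reg]
  rw [e7]
  have hb₆ := hb₅.setReg (x := z + 7) (hρX (z + 7) (by omega))
  refine Run.assign (fits hb₆ (by simp [Expr.Tame, BinOp.Tame])
    (by simp [Expr.cost]; omega)) ?_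
  have e8 : (Expr.bin .add (.reg (z + 8)) (.reg (z + 5))).eval
      (((σ₃.setReg (z + 11) w).setReg (z + 9) (ρ' (z + 9))).setReg (z + 7) (ρ' (z + 7))) =
      ρ' (z + 8) := by
    have := hs0.regOff _ hf₃
    simp [Expr.eval, BinOp.eval, hρ8, hf₃.reg (z + 5), hStρ, this]
  rw [e8]
  refine ⟨⟨hb₆.setReg (hρX (z + 8) (by omega)), fun x hx => ?_, hf₃.mem⟩, hc₃, hfr₃⟩
  simp only [State.setReg_reg]
  split_ifs with h8 h7 h9 h11
  · rw [h8]
  · rw [h7]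
  · rw [h9]
  · omega
  · rw [hf₃.reg x hx, hρ' x hx h7 h8 h9]

end Round

end WordRAM

namespace WordRAM

/-! ## The expressions of the reduction -/

theorem Expr.Poly.tame {X : ℤ} {σ : State} {e : Expr} (h : e.Poly X σ) : e.Tame X := by
  induction e with
  | const v => exact h
  | reg x => trivial
  | read A i ih => exact ih h.1
  | bin op a b iha ihb => exact ⟨h.1, iha h.2.1, ihb h.2.2⟩

section Expressions

variable (z K : ℕ)

/-- Digit `e` of the round number. -/
def digE (e : ℕ) : Expr := .bin .mod (.bin .div (.reg (z + 7)) ((Expr.reg (z + 2)).pow e)) (.reg (z + 2))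

/-- The sign of a digit. -/
def signE (g : Expr) : Expr := .bin .sub (.const 1) (.bin .mul (.const 2) (.bin .mod g (.const 2)))

/-- The level of a digit. -/
def levelE (g : Expr) : Expr := .bin .div g (.const (2 * K * K : ℕ))

/-- The rounded summand at the level of a digit. -/
def lowE (g x : Expr) : Expr := .bin .shr (.bin .mul (signE g) x) (levelE K g)

/-- The rounded summand at the level after that of a digit. -/
def highE (g x : Expr) : Expr :=
  .bin .shr (.bin .mul (signE g) x) (.bin .add (levelE K g) (.const 1))

/-- The constant summand. -/
def digConstE (g x : Expr) : Expr :=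
  .bin .add (.bin .mul (signE g) x) (.bin .sub (.const 1) (.bin .mod g (.const 2)))

/-- The required value at the level of a digit. -/
def lowTargetE (g x : Expr) : Expr :=
  .bin .sub (.bin .add (.bin .mod (.bin .div g (.const (2 * K : ℕ))) (.const K)) (.const 1))
    (.bin .shr (digConstE g x) (levelE K g))

/-- The required value at the level after that of a digit. -/
def highTargetE (g x : Expr) : Expr :=
  .bin .sub (.bin .sub (.const 0) (.bin .mod (.bin .div g (.const 2)) (.const K)))
    (.bin .shr (digConstE g x) (.bin .add (levelE K g) (.const 1)))

/-- Packing into one number. -/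
def packE {N : ℕ} (y w : Fin N → Expr) : Expr :=
  .sum (List.ofFn fun j => .bin .mul (.bin .add (y j) (.bin .mul (.reg (z + 3)) (w j)))
    (((Expr.reg (z + 3)).pow 2).pow j))

/-- The truth value of `F` on the signs of the digits. -/
noncomputable def checkE {N : ℕ} (F : (Fin N → Bool) → Bool) : Expr :=
  .sum ((Finset.univ.filter fun s => F s = true).toList.map fun s =>
    .prod (List.ofFn fun j => .bin .eq (.bin .mod (digE z j) (.const 2))
      (.const (if s j then 0 else 1))))

variable {z K} {σ : State} {X : ℤ} {g x : Expr} {gv : ℕ} {xv : ℤ}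

theorem eval_digE {q D : ℕ} (hq : σ.reg (z + 7) = q) (hD : σ.reg (z + 2) = D) (e : ℕ) :
    (digE z e).eval σ = (q / D ^ e % D : ℕ) := by
  simp only [digE, Expr.eval, BinOp.eval, Expr.eval_pow, hq, hD]
  push_cast
  rfl

theorem eval_lowE (hg : g.eval σ = gv) (hx : x.eval σ = xv) :
    (lowE K g x).eval σ = digLow K gv xv := by
  simp only [lowE, signE, levelE, Expr.eval, BinOp.eval, hg, hx, digLow, digSign, digLevel,
    ← Int.natCast_div, Int.toNat_natCast]
  push_cast
  rfl

theorem eval_highE (hg : g.eval σ = gv) (hx : x.eval σ = xv) :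
    (highE K g x).eval σ = digHigh K gv xv := by
  have : ((gv / (2 * K * K) : ℕ) + 1 : ℤ) = ((gv / (2 * K * K) + 1 : ℕ) : ℤ) := by push_cast; rfl
  simp only [highE, signE, levelE, Expr.eval, BinOp.eval, hg, hx, digHigh, digSign, digLevel,
    ← Int.natCast_div, this, Int.toNat_natCast]
  push_cast
  rfl

theorem eval_lowTargetE (hg : g.eval σ = gv) (hx : x.eval σ = xv) :
    (lowTargetE K g x).eval σ = digLowTarget K gv xv := by
  simp only [lowTargetE, digConstE, signE, levelE, Expr.eval, BinOp.eval, hg, hx, digLowTarget,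
    digConst, digSign, digLevel, ← Int.natCast_div, Int.toNat_natCast]
  push_cast
  rfl

theorem eval_highTargetE (hg : g.eval σ = gv) (hx : x.eval σ = xv) :
    (highTargetE K g x).eval σ = digHighTarget K gv xv := by
  have : ((gv / (2 * K * K) : ℕ) + 1 : ℤ) = ((gv / (2 * K * K) + 1 : ℕ) : ℤ) := by push_cast; rfl
  simp only [highTargetE, digConstE, signE, levelE, Expr.eval, BinOp.eval, hg, hx, digHighTarget,
    digConst, digSign, digLevel, ← Int.natCast_div, this, Int.toNat_natCast, zero_sub]
  push_cast
  rfl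

theorem eval_packE {N : ℕ} {y w : Fin N → Expr} {yv wv : Fin N → ℤ} {M : ℤ}
    (hM : σ.reg (z + 3) = M) (hy : ∀ j, (y j).eval σ = yv j) (hw : ∀ j, (w j).eval σ = wv j) :
    (packE z y w).eval σ = packPairs M yv wv := by
  simp [packE, packPairs, List.map_ofFn, List.sum_ofFn, Expr.eval, BinOp.eval, hM, hy, hw]

/-- This is the disjunctive normal form of `F`: among the products over satisfying sign vectors, the
only one that can be nonzero belongs to the actual signs. A digit that is 0 modulo 2 stands for a
true inequality. -/
theorem eval_checkE {N : ℕ} {F : (Fin N → Bool) → Bool} {gs : Fin N → ℕ}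
    (hg : ∀ j : Fin N, (digE z j).eval σ = gs j) :
    (checkE z F).eval σ = if F fun j => decide (gs j % 2 = 0) then 1 else 0 := by
  have h1 : ∀ s : Fin N → Bool, (Expr.prod (List.ofFn fun j : Fin N => .bin .eq
      (.bin .mod (digE z j) (.const 2)) (.const (if s j then 0 else 1)))).eval σ =
      if s = fun j => decide (gs j % 2 = 0) then 1 else 0 := by
    intro s
    have h2 : ∀ j : Fin N, (Expr.bin .eq (.bin .mod (digE z j) (.const 2))
        (.const (if s j then 0 else 1))).eval σ = if s j = decide (gs j % 2 = 0) then 1 else 0 := by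
      intro j
      simp only [Expr.eval, BinOp.eval, hg]
      rcases Nat.mod_two_eq_zero_or_one (gs j) with h | h <;> cases s j <;> simp [h] <;> omega
    rw [Expr.eval_prod, List.map_ofFn, List.prod_ofFn]
    simp only [Function.comp_apply]
    split_ifs with hs
    · exact Finset.prod_eq_one fun j _ => (h2 j).trans (if_pos (congrFun hs j))
    · obtain ⟨j, hj⟩ := Function.ne_iff.1 hs
      exact Finset.prod_eq_zero (Finset.mem_univ j) ((h2 j).trans (if_neg hj))
  rw [checkE, Expr.eval_sum, List.map_map, Function.comp_def]
  simp only [h1]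
  rw [Finset.sum_map_toList, Finset.sum_filter]
  rw [Finset.sum_eq_single fun j => decide (gs j % 2 = 0)]
  · simp
  · intro s _ hs
    simp [hs]
  · simp

theorem poly_const {v : ℤ} (h : |v| ≤ X) : (Expr.const v).Poly X σ := h

theorem poly_digE (hX : 2 ≤ X) (hq : |σ.reg (z + 7)| ≤ X) (hD : |σ.reg (z + 2)| ≤ X) (e : ℕ) :
    (digE z e).Poly X σ :=
  ⟨trivial, ⟨trivial, hq, Expr.poly_pow hX (show (Expr.reg _).Poly X σ from hD) e⟩, hD⟩

theorem poly_signE (hX : 2 ≤ X) (hg : g.Poly X σ) : (signE g).Poly X σ :=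
  ⟨trivial, poly_const (by simp; omega), trivial, poly_const (by simpa using hX), trivial, hg,
    poly_const (by simpa using hX)⟩

theorem poly_levelE (hK : (2 * K * K : ℕ) ≤ X) (hg : g.Poly X σ) : (levelE K g).Poly X σ :=
  ⟨trivial, hg, poly_const (by rwa [Nat.abs_cast])⟩

theorem poly_lowE (hX : 2 ≤ X) (hK : (2 * K * K : ℕ) ≤ X) (hg : g.Poly X σ) (hx : x.Poly X σ) :
    (lowE K g x).Poly X σ :=
  ⟨trivial, ⟨trivial, poly_signE hX hg, hx⟩, poly_levelE hK hg⟩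

theorem poly_highE (hX : 2 ≤ X) (hK : (2 * K * K : ℕ) ≤ X) (hg : g.Poly X σ) (hx : x.Poly X σ) :
    (highE K g x).Poly X σ :=
  ⟨trivial, ⟨trivial, poly_signE hX hg, hx⟩, trivial, poly_levelE hK hg,
    poly_const (by simp; omega)⟩

theorem poly_digConstE (hX : 2 ≤ X) (hg : g.Poly X σ) (hx : x.Poly X σ) :
    (digConstE g x).Poly X σ :=
  ⟨trivial, ⟨trivial, poly_signE hX hg, hx⟩, trivial, poly_const (by simp; omega), trivial, hg,
    poly_const (by simpa using hX)⟩

theorem le_of_two_mul_mul_le (hK : (2 * K * K : ℕ) ≤ X) : (2 * K : ℕ) ≤ X ∧ (K : ℤ) ≤ X := by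
  rcases Nat.eq_zero_or_pos K with rfl | h
  · simpa using hK
  · have h1 : 2 * K ≤ 2 * K * K := Nat.le_mul_of_pos_right _ h
    omega

theorem poly_lowTargetE (hX : 2 ≤ X) (hK : (2 * K * K : ℕ) ≤ X) (hg : g.Poly X σ)
    (hx : x.Poly X σ) : (lowTargetE K g x).Poly X σ :=
  ⟨trivial, ⟨trivial, ⟨trivial, ⟨trivial, hg,
    poly_const (by rw [Nat.abs_cast]; exact (le_of_two_mul_mul_le hK).1)⟩,
    poly_const (by rw [Nat.abs_cast]; exact (le_of_two_mul_mul_le hK).2)⟩,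
    poly_const (by simp; omega)⟩, trivial, poly_digConstE hX hg hx, poly_levelE hK hg⟩

theorem poly_highTargetE (hX : 2 ≤ X) (hK : (2 * K * K : ℕ) ≤ X) (hg : g.Poly X σ)
    (hx : x.Poly X σ) : (highTargetE K g x).Poly X σ :=
  ⟨trivial, ⟨trivial, poly_const (by simp; omega), trivial, ⟨trivial, hg,
    poly_const (by simpa using hX)⟩,
    poly_const (by rw [Nat.abs_cast]; exact (le_of_two_mul_mul_le hK).2)⟩,
    trivial, poly_digConstE hX hg hx, trivial, poly_levelE hK hg, poly_const (by simp; omega)⟩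

theorem poly_packE (hX : 2 ≤ X) {N : ℕ} {y w : Fin N → Expr} (hM : |σ.reg (z + 3)| ≤ X)
    (hy : ∀ j, (y j).Poly X σ) (hw : ∀ j, (w j).Poly X σ) : (packE z y w).Poly X σ := by
  refine Expr.poly_sum hX fun e he => ?_
  obtain ⟨j, rfl⟩ := (List.mem_ofFn' _ _).1 he
  exact ⟨trivial, ⟨trivial, hy j, trivial, hM, hw j⟩,
    Expr.poly_pow hX (Expr.poly_pow hX (show (Expr.reg _).Poly X σ from hM) 2) j⟩

theorem poly_checkE (hX : 2 ≤ X) {N : ℕ} {F : (Fin N → Bool) → Bool}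
    (hq : |σ.reg (z + 7)| ≤ X) (hD : |σ.reg (z + 2)| ≤ X) : (checkE z F).Poly X σ := by
  refine Expr.poly_sum hX fun e he => ?_
  obtain ⟨s, -, rfl⟩ := List.mem_map.1 he
  refine Expr.poly_prod hX fun e he => ?_
  obtain ⟨j, rfl⟩ := (List.mem_ofFn' _ _).1 he
  refine ⟨trivial, ⟨trivial, poly_digE hX hq hD j, poly_const (by simpa using hX)⟩,
    poly_const ?_⟩
  split_ifs <;> simp <;> omega

end Expressions

section Terms

variable {k l : ℕ} {d : Fin k → ℕ}

/-- The part of a linear term in the coordinates of element number `reg (z + 10)` of set `i`. -/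
def termE (z : ℕ) (τ : LinTerm (FOPVar d l)) (i : Fin k) : Expr :=
  .sum (List.ofFn fun s : Fin (d i) => .bin .mul (.const (τ.coeff (.inl ⟨i, s⟩)))
    (.read i (.bin .add (.bin .mul (.reg (z + 10)) (.const (d i))) (.const (s : ℕ)))))

/-- The part of a linear term without coordinates. -/
def freeE (τ : LinTerm (FOPVar d l)) : Expr :=
  .sum (.const τ.const :: List.ofFn fun r : Fin l =>
    .bin .mul (.const (τ.coeff (.inr r))) (.reg (k + r)))

/-- The coordinates of element number `p` of set `i`. -/
def memVec (σ₀ : State) (i : Fin k) (p : ℕ) (s : Fin (d i)) : ℤ :=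
  σ₀.mem i ((p : ℤ) * (d i : ℤ) + (s : ℤ))

/-- The value of the part of a linear term in the coordinates of a vector. -/
def termVal (τ : LinTerm (FOPVar d l)) (i : Fin k) (a : Fin (d i) → ℤ) : ℤ :=
  ∑ s, τ.coeff (.inl ⟨i, s⟩) * a s

/-- The value of the part of a linear term without coordinates. -/
def freeVal (τ : LinTerm (FOPVar d l)) (t : Fin l → ℤ) : ℤ :=
  τ.const + ∑ r, τ.coeff (.inr r) * t r

theorem eval_eq_freeVal_add (τ : LinTerm (FOPVar d l)) (a : (i : Fin k) → Fin (d i) → ℤ)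
    (t : Fin l → ℤ) :
    τ.eval (Sum.elim (fun v => a v.1 v.2) t) = freeVal τ t + ∑ i, termVal τ i (a i) := by
  simp only [LinTerm.eval, freeVal, termVal, Fintype.sum_sum_type, Fintype.sum_sigma, Sum.elim_inl,
    Sum.elim_inr]
  ring

theorem eval_termE {z : ℕ} {σ σ₀ : State} {p : ℕ} {i : Fin k} (τ : LinTerm (FOPVar d l))
    (hp : σ.reg (z + 10) = p) (hm : σ.mem i = σ₀.mem i) :
    (termE z τ i).eval σ = termVal τ i (memVec σ₀ i p) := by
  simp [termE, termVal, memVec, List.map_ofFn, List.sum_ofFn, Expr.eval, BinOp.eval, hp, hm]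

theorem eval_freeE {σ : State} {t : Fin l → ℤ} (τ : LinTerm (FOPVar d l))
    (ht : ∀ r : Fin l, σ.reg (k + r) = t r) : (freeE τ).eval σ = freeVal τ t := by
  simp [freeE, freeVal, List.map_ofFn, List.sum_ofFn, Expr.eval, BinOp.eval, ht]

theorem poly_termE {X : ℤ} (hX : 2 ≤ X) {z : ℕ} {σ σ₀ : State} {p : ℕ} {i : Fin k}
    {τ : LinTerm (FOPVar d l)} (hτ : ∀ v, |τ.coeff v| ≤ X) (hd : d i ≤ X)
    (hp : σ.reg (z + 10) = p) (hpX : p ≤ X) (hm : σ.mem i = σ₀.mem i)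
    (hv : ∀ s, |memVec (d := d) σ₀ i p s| ≤ X) : (termE z τ i).Poly X σ := by
  refine Expr.poly_sum hX fun e he => ?_
  obtain ⟨s, rfl⟩ := (List.mem_ofFn' _ _).1 he
  refine ⟨trivial, hτ _, ⟨trivial, ⟨trivial, ?_, ?_⟩, ?_⟩, ?_⟩
  · simpa [Expr.Poly, hp] using hpX
  · simpa [Expr.Poly] using hd
  · have := s.2
    simp only [Expr.Poly, Nat.abs_cast]; omega
  · simpa [Expr.eval, BinOp.eval, hp, hm, memVec] using hv s

theorem poly_freeE {X : ℤ} (hX : 2 ≤ X) {σ : State} {τ : LinTerm (FOPVar d l)}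
    (hτ : ∀ v, |τ.coeff v| ≤ X) (hc : |τ.const| ≤ X) (ht : ∀ r : Fin l, |σ.reg (k + r)| ≤ X) :
    (freeE τ).Poly X σ := by
  refine Expr.poly_sum hX fun e he => ?_
  rcases List.mem_cons.1 he with rfl | he
  · exact hc
  · obtain ⟨r, rfl⟩ := (List.mem_ofFn' _ _).1 he
    exact ⟨trivial, hτ _, ht r⟩

end Terms

end WordRAM

/-! ## Summation over all rounds -/

/-- One loop runs through all choices: in base D, the low m digits of the round number are the
digits for the terms and the next n are the bit positions for the sets. -/
theorem sum_range_digits {m n D : ℕ} (G : (Fin m → ℕ) → (Fin n → ℕ) → ℕ) :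
    ∑ q ∈ Finset.range (D ^ (m + n)),
      G (fun j => q / D ^ (j : ℕ) % D) (fun i => q / D ^ (m + (i : ℕ)) % D) =
    ∑ g : Fin m → Fin D, ∑ h : Fin n → Fin D, G (fun j => g j) (fun i => h i) := by
  rw [Finset.sum_range fun q =>
    G (fun j : Fin m => q / D ^ (j : ℕ) % D) (fun i : Fin n => q / D ^ (m + (i : ℕ)) % D)]
  rw [← finFunctionFinEquiv.sum_comp, ← (Fin.appendEquiv m n).sum_comp, Fintype.sum_prod_type]
  refine Finset.sum_congr rfl fun g _ => Finset.sum_congr rfl fun h _ => ?_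
  have key : ∀ (u : Fin (m + n) → Fin D) (e : Fin (m + n)),
      (finFunctionFinEquiv u : ℕ) / D ^ (e : ℕ) % D = u e := fun u e => by
    rw [← finFunctionFinEquiv_symm_apply_val, Equiv.symm_apply_apply]
  congr 1
  · ext j
    simpa using key (Fin.append g h) (Fin.castAdd n j)
  · ext i
    simpa using key (Fin.append g h) (Fin.natAdd m i)

namespace WordRAM

/-! ## The program of the reduction -/

theorem State.setReg_setReg (σ : State) (x : ℕ) (v w : ℤ) :
    (σ.setReg x v).setReg x w = σ.setReg x w := by
  simp [State.setReg]

theorem Run.assign_seq {B X : ℤ} {κ : ℕ} (hX : 2 ≤ X) (hB : X ^ κ ≤ B) {q : Prog} {σ : State}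
    {x : ℕ} {e : Expr} {v : ℤ} {T : ℕ} {Q : State → Prop} (hσ : σ.Bdd X) (he : e.Tame X)
    (hc : e.cost ≤ κ) (hv : e.eval σ = v) (hvX : |v| ≤ X)
    (h : (σ.setReg x v).Bdd X → Run B q (σ.setReg x v) T Q) :
    Run B (.seq (.assign x e) q) σ (κ + 1 + T) Q := by
  refine (Run.seq (T' := T) (Run.assign (he.fits hX hB hσ hc) ?_)).mono (by omega) fun _ h => h
  rw [hv]
  exact h (hσ.setReg hvX)

/-- Tame expressions stay tame under sums. -/
theorem Expr.tame_sum {X : ℤ} (hX : 0 ≤ X) {l : List Expr} (h : ∀ e ∈ l, e.Tame X) :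
    (Expr.sum l).Tame X := by
  induction l with
  | nil => simpa [Expr.sum, Expr.Tame] using hX
  | cons e l ih => exact ⟨trivial, h e (by simp), ih fun e he => h e (by simp [he])⟩

theorem Expr.tame_pow {X : ℤ} (hX : 1 ≤ X) {e : Expr} (h : e.Tame X) (n : ℕ) :
    (e.pow n).Tame X := by
  induction n with
  | zero => simpa [Expr.pow, Expr.prod, Expr.Tame] using hX
  | succ n ih => exact ⟨trivial, h, ih⟩

/-- The registers at the start of a round. -/
def roundRegs (z : ℕ) (inp : ℕ → ℤ) (N lam D M H St Q q acc : ℤ) (x : ℕ) : ℤ :=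
  if x < z then inp x else
    if x = z then N else if x = z + 1 then lam else if x = z + 2 then D else
    if x = z + 3 then M else if x = z + 4 then H else if x = z + 5 then St else
    if x = z + 6 then Q else if x = z + 7 then q else if x = z + 8 then q * St else
    if x = z + 9 then acc else 0

variable (z k aM aH aS Kc m : ℕ) (body : Prog)

/-- Compute the parameters, perform all rounds, and output the sum. -/
def reductionProg : Prog :=
  .seq (.assign z (.sum (.const 2 :: (List.range k).map .reg))) <|
  .seq (.assign (z + 1) (.const 0)) <|
  .seq (.loop (.bin .shr (.reg z) (.reg (z + 1)))
    (.assign (z + 1) (.bin .add (.reg (z + 1)) (.const 1)))) <|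
  .seq (.assign (z + 2) (.bin .mul (.const Kc) (.reg (z + 1)))) <|
  .seq (.assign (z + 3) ((Expr.reg z).pow aM)) <|
  .seq (.assign (z + 4) ((Expr.reg z).pow aH)) <|
  .seq (.assign (z + 5) ((Expr.reg z).pow aS)) <|
  .seq (.assign (z + 6) ((Expr.reg (z + 2)).pow m)) <|
  .seq (.loop (.bin .lt (.reg (z + 7)) (.reg (z + 6))) body)
    (.assign 0 (.reg (z + 9)))

variable {z k aM aH aS Kc m body}

/-- This separates the outer loop from the work of a round. `acc q` is the intended accumulator
before round q, and round q uses the window around q * St. -/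
theorem run_reduction {B X W : ℤ} {κ T : ℕ} {σ₀ : State} {n : ℕ → ℕ} {acc : ℕ → ℤ}
    {N lam D Q : ℕ} {M H St : ℤ}
    (hX : 2 ≤ X) (hB : X ^ κ ≤ B) (hκ : 3 ≤ κ)
    (hσ₀ : σ₀.Bdd X) (hn : ∀ i < k, σ₀.reg i = n i) (hz : ∀ x, z ≤ x → σ₀.reg x = 0)
    (hmem : ∀ A a, k ≤ A → σ₀.mem A a = 0)
    (hN : N = 2 + ∑ i ∈ Finset.range k, n i) (hlam : lam = Nat.size N) (hD : D = Kc * lam)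
    (hM : M = (N : ℤ) ^ aM) (hH : H = (N : ℤ) ^ aH) (hSt : St = (N : ℤ) ^ aS) (hQ : Q = D ^ m)
    (hNX : N ≤ X) (hlamX : lam ≤ X) (hDX : D ≤ X) (hMX : |M| ≤ X) (hHX : |H| ≤ X)
    (hStX : |St| ≤ X) (hQX : Q ≤ X) (hKcX : Kc ≤ X)
    (hc1 : (Expr.sum (.const 2 :: (List.range k).map .reg)).cost ≤ κ)
    (hcM : ((Expr.reg z).pow aM).cost ≤ κ) (hcH : ((Expr.reg z).pow aH).cost ≤ κ)
    (hcS : ((Expr.reg z).pow aS).cost ≤ κ) (hcm : ((Expr.reg (z + 2)).pow m).cost ≤ κ)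
    (hacc0 : acc 0 = 0)
    (hround : ∀ q < Q, ∀ σ,
      Fixed z k X (roundRegs z σ₀.reg N lam D M H St Q q (acc q)) σ₀.mem σ →
      (∀ a, σ.mem k a = 0) → (∀ A a, k + 1 ≤ A → q * St - W ≤ a → σ.mem A a = 0) →
      Run B body σ T fun σ' =>
        Fixed z k X (roundRegs z σ₀.reg N lam D M H St Q (q + 1) (acc (q + 1))) σ₀.mem σ' ∧
        (∀ a, σ'.mem k a = 0) ∧ ∀ A a, k + 1 ≤ A → q * St + St - W ≤ a → σ'.mem A a = 0) :
    Run B (reductionProg z k aM aH aS Kc m body) σ₀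
      (10 * (κ + 1) + 8 * lam + Q * (T + 4)) fun σ' => σ'.reg 0 = acc Q := by
  have fits : ∀ {σ : State} {e : Expr}, σ.Bdd X → e.Tame X → e.cost ≤ κ → e.Fits B σ :=
    fun hσ he hc => he.fits hX hB hσ hc
  refine Run.mono (T := κ + 1 + (κ + 1 + (lam * (3 + 1 + 4) + (3 + 1) + (κ + 1 + (κ + 1 + (κ + 1 +
    (κ + 1 + (κ + 1 + (Q * (3 + 1 + T) + (3 + 1) + 2))))))))) ?_ ?_ fun _ h => h
  swap
  · have : Q * (3 + 1 + T) = Q * (T + 4) := by ring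
    omega
  refine Run.assign_seq (v := N) hX hB hσ₀ (Expr.tame_sum (by omega) ?_) hc1 ?_ (by simpa using hNX)
    fun hb => ?_
  · intro e he
    rcases List.mem_cons.1 he with rfl | he
    · simpa [Expr.Tame] using hX
    · obtain ⟨i, -, rfl⟩ := List.mem_map.1 he
      trivial
  · have : List.map (Expr.eval σ₀ ∘ Expr.reg) (List.range k) =
        List.map (fun i => (n i : ℤ)) (List.range k) :=
      List.map_congr_left fun i hi => hn i (List.mem_range.1 hi)
    rw [Expr.eval_sum, List.map_cons, List.map_map, this, hN]
    push_cast
    simp [Expr.eval, Finset.sum, Finset.range, Multiset.range]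
  refine Run.assign_seq (v := 0) hX hB hb (by simp [Expr.Tame]; omega) (by simp [Expr.cost]; omega)
    rfl (by simp; omega) fun hb => ?_
  set s := σ₀.setReg z N with hs
  -- The binary length of N is found by counting: the shift N / 2^i is nonzero exactly for i below
  -- `Nat.size N`.
  refine Run.seq ((Run.loop lam (fun i σ => σ = s.setReg (z + 1) i ∧ σ.Bdd X) ?_ ?_ ?_
    ⟨rfl, hb⟩).mono le_rfl ?_)
  · rintro i - σ ⟨-, h⟩
    exact fits h (by simp [Expr.Tame, BinOp.Tame]) (by simp [Expr.cost]; omega)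
  · rintro i - σ ⟨rfl, -⟩
    have : (Expr.bin .shr (.reg z) (.reg (z + 1))).eval (s.setReg (z + 1) i) =
        ((N / 2 ^ i : ℕ) : ℤ) := by
      simp [Expr.eval, BinOp.eval, hs]
    rw [this, Nat.cast_ne_zero, ← Nat.pos_iff_ne_zero, Nat.div_pos_iff, hlam, Nat.lt_size]
    simp
  · rintro i hi σ ⟨rfl, h⟩
    have e : (Expr.bin .add (.reg (z + 1)) (.const 1)).eval (s.setReg (z + 1) i) =
        ((i + 1 : ℕ) : ℤ) := by simp [Expr.eval, BinOp.eval]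
    refine Run.assign (fits h (by simp [Expr.Tame, BinOp.Tame]; omega)
      (by simp [Expr.cost]; omega)) ?_
    rw [e, State.setReg_setReg]
    refine ⟨rfl, ?_⟩
    rw [← State.setReg_setReg s (z + 1) i]
    exact h.setReg (by rw [Nat.abs_cast]; omega)
  rintro _ ⟨rfl, hb⟩
  refine Run.assign_seq (v := D) hX hB hb (by simp [Expr.Tame, BinOp.Tame]; omega)
    (by simp [Expr.cost]; omega) ?_ (by simpa using hDX) fun hb => ?_
  · simp [Expr.eval, BinOp.eval, hD]
  refine Run.assign_seq (v := M) hX hB hb (Expr.tame_pow (by omega) (show (Expr.reg z).Tame X from trivial) _) hcM ?_ hMX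
    fun hb => ?_
  · simp [Expr.eval, hs, hM]
  refine Run.assign_seq (v := H) hX hB hb (Expr.tame_pow (by omega) (show (Expr.reg z).Tame X from trivial) _) hcH ?_ hHX
    fun hb => ?_
  · simp [Expr.eval, hs, hH]
  refine Run.assign_seq (v := St) hX hB hb (Expr.tame_pow (by omega) (show (Expr.reg z).Tame X from trivial) _) hcS ?_ hStX
    fun hb => ?_
  · simp [Expr.eval, hs, hSt]
  refine Run.assign_seq (v := Q) hX hB hb (Expr.tame_pow (by omega) (show (Expr.reg (z + 2)).Tame X from trivial) _) hcm ?_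
    (by simpa using hQX) fun hb => ?_
  · simp [Expr.eval, hs, hQ]
  refine Run.seq ((Run.loop Q (fun q σ =>
      Fixed z k X (roundRegs z σ₀.reg N lam D M H St Q q (acc q)) σ₀.mem σ ∧
      (∀ a, σ.mem k a = 0) ∧ (∀ A a, k + 1 ≤ A → q * St - W ≤ a → σ.mem A a = 0)) ?_ ?_ ?_ ?_).mono
      le_rfl ?_)
  · rintro q - σ ⟨h, -⟩
    exact fits h.bdd (by simp [Expr.Tame, BinOp.Tame]) (by simp [Expr.cost]; omega)
  · rintro q - σ ⟨h, -⟩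
    simp [Expr.eval, BinOp.eval, h.reg, roundRegs]
  · rintro q hq σ ⟨h1, h2, h3⟩
    refine (hround q hq σ h1 h2 h3).mono le_rfl fun σ' h' => ?_
    push_cast
    refine ⟨h'.1, h'.2.1, fun A a hA ha => h'.2.2 A a hA ?_⟩
    linarith
  · refine ⟨⟨hb, fun x hx => ?_, fun A hA => rfl⟩, fun a => hmem k a le_rfl,
      fun A a hA _ => hmem A a (by omega)⟩
    rcases lt_or_ge x z with h | h
    · simp only [State.setReg_reg, roundRegs, if_pos h, hs]
      repeat rw [if_neg (by omega)]
    · obtain ⟨c, rfl⟩ := Nat.exists_eq_add_of_le h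
      have hc : c < 10 := by omega
      interval_cases c <;> simp [roundRegs, hs, hacc0, hz]
  · rintro σ ⟨h, -⟩
    refine Run.assign (fits h.bdd trivial (by simp [Expr.cost]; omega)) ?_
    simp [Expr.eval, h.reg, roundRegs]

end WordRAM

/-! ### Parameters of the reduction and bounds on the packed numbers -/

namespace WordRAM

section Reduction

variable {k l nA : ℕ} {d : Fin k → ℕ}

/-- Indices below `k`. -/
def toIndex (hk : 0 < k) (i : ℕ) : Fin k := if h : i < k then ⟨i, h⟩ else ⟨0, hk⟩

@[simp] theorem toIndex_val (hk : 0 < k) (i : Fin k) : toIndex hk i = i := by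
  simp [toIndex, i.2]

theorem val_toIndex (hk : 0 < k) {i : ℕ} (hi : i < k) : (toIndex hk i : ℕ) = i := by
  simp [toIndex, hi]

/-- The packed value of element `p` of set `i` for given digits. -/
def packedVal (σ₀ : State) (τ : Fin nA → LinTerm (FOPVar d l)) (K : ℕ) (M : ℤ) (g : Fin nA → ℕ)
    (i : Fin k) (p : ℕ) : ℤ :=
  packPairs M (fun j => digLow K (g j) (termVal (τ j) i (memVec σ₀ i p)))
    fun j => digHigh K (g j) (termVal (τ j) i (memVec σ₀ i p))

/-- The packed target for given digits. -/
def packedTarget (τ : Fin nA → LinTerm (FOPVar d l)) (t : Fin l → ℤ) (K : ℕ) (M : ℤ)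
    (g : Fin nA → ℕ) : ℤ :=
  packPairs M (fun j => digLowTarget K (g j) (freeVal (τ j) t))
    fun j => digHighTarget K (g j) (freeVal (τ j) t)

/-- The expression for `packedVal`. -/
def packedValE (z K : ℕ) (τ : Fin nA → LinTerm (FOPVar d l)) (i : Fin k) : Expr :=
  packE z (fun j => lowE K (digE z j) (termE z (τ j) i))
    fun j => highE K (digE z j) (termE z (τ j) i)

/-- The expression for `packedTarget`. -/
def packedTargetE (z K : ℕ) (τ : Fin nA → LinTerm (FOPVar d l)) : Expr :=
  packE z (fun j => lowTargetE K (digE z j) (freeE (τ j)))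
    fun j => highTargetE K (digE z j) (freeE (τ j))

theorem poly_packedValE {z K : ℕ} {τ : Fin nA → LinTerm (FOPVar d l)} {i : Fin k} {X : ℤ}
    {σ : State} (hX : 2 ≤ X) (hK : (2 * K * K : ℕ) ≤ X) (hD : |σ.reg (z + 2)| ≤ X)
    (hM : |σ.reg (z + 3)| ≤ X) (hq : |σ.reg (z + 7)| ≤ X)
    (hτ : ∀ j, (termE z (τ j) i).Poly X σ) : (packedValE z K τ i).Poly X σ :=
  poly_packE hX hM (fun j => poly_lowE hX hK (poly_digE hX hq hD j) (hτ j))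
    fun j => poly_highE hX hK (poly_digE hX hq hD j) (hτ j)

theorem poly_packedTargetE {z K : ℕ} {τ : Fin nA → LinTerm (FOPVar d l)} {X : ℤ}
    {σ : State} (hX : 2 ≤ X) (hK : (2 * K * K : ℕ) ≤ X) (hD : |σ.reg (z + 2)| ≤ X)
    (hM : |σ.reg (z + 3)| ≤ X) (hq : |σ.reg (z + 7)| ≤ X)
    (hτ : ∀ j, (freeE (τ j)).Poly X σ) : (packedTargetE z K τ).Poly X σ :=
  poly_packE hX hM (fun j => poly_lowTargetE hX hK (poly_digE hX hq hD j) (hτ j))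
    fun j => poly_highTargetE hX hK (poly_digE hX hq hD j) (hτ j)

/-- The numbers that occur in the reduction are as required. -/
structure Setup (hk : 0 < k) (I : Input d l) (σ₀ : State) (τ : Fin nA → LinTerm (FOPVar d l))
    (F : (Fin nA → Bool) → Bool) (n : ℕ → ℕ) (N L lam K D Q κ y aM aH aS : ℕ)
    (M H St X₀ Y X₁ Y₁ W X B : ℤ) : Prop where
  enc : I.Encodes σ₀
  n_eq : n = fun i => (I.A (toIndex hk i)).card
  N_eq : N = 2 + ∑ i ∈ Finset.range k, n i
  lam_eq : lam = Nat.size N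
  K_eq : K = k + 3
  L_eq : L = y * lam
  D_eq : D = 2 * K * K * L
  Q_eq : Q = D ^ (nA + k)
  M_eq : M = (N : ℤ) ^ aM
  H_eq : H = (N : ℤ) ^ aH
  St_eq : St = (N : ℤ) ^ aS
  y_pos : 0 < y
  two_le : 2 ≤ X₀
  coeff_le : ∀ j v, |(τ j).coeff v| ≤ X₀
  const_le : ∀ j, |(τ j).const| ≤ X₀
  d_le : ∀ i, d i ≤ X₀
  K_le : (2 * K * K : ℕ) ≤ X₀
  N_le : N ≤ X₀
  input_le : ∀ i, ∀ a ∈ I.A i, ∀ s, |a s| ≤ X₀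
  t_le : ∀ r, |I.t r| ≤ X₀
  term_le : ∀ j i, X₀ ^ (termE (k + l) (τ j) i).cost ≤ Y
  free_le : ∀ j, X₀ ^ (freeE (τ j)).cost ≤ Y
  Y_lt : Y + 1 < 2 ^ L
  Y_lt_M : (k + 1) * Y + K + 1 < M
  X₀_le : X₀ ≤ X₁
  M_le : M ≤ X₁
  D_le : D ≤ X₁
  Q_le : Q ≤ X₁
  val_le : ∀ i, X₁ ^ (packedValE (k + l) K τ i).cost ≤ Y₁
  target_le : X₁ ^ (packedTargetE (k + l) K τ).cost ≤ Y₁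
  Y₁_lt_H : (k + 1) * Y₁ < H
  X₁_le : X₁ ≤ X
  lam_le : lam ≤ X
  Kc_le : (2 * K * K * y : ℕ) ≤ X
  Y₁_le : Y₁ ≤ X
  H_le : H + N ≤ X
  card_le : k + 2 * N + 1 ≤ X
  W_le : 2 * W < St
  St_le : W + Q * St ≤ X
  weight_le : 2 ^ (k * D) ≤ X
  total_le : (N : ℤ) ^ k ≤ X
  pow_le : X ^ κ ≤ B
  val_cost : ∀ i, (packedValE (k + l) K τ i).cost ≤ κ
  target_cost : (packedTargetE (k + l) K τ).cost ≤ κ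
  check_cost : (checkE (k + l) F).cost + 10 ≤ κ
  dig_cost : ∀ i < k, (digE (k + l) (nA + i)).cost + 10 ≤ κ
  bits_cost : (Expr.sum ((List.range k).map fun i => digE (k + l) (nA + i))).cost ≤ κ
  cost_N : (Expr.sum (.const 2 :: (List.range k).map .reg)).cost ≤ κ
  cost_M : ((Expr.reg (k + l)).pow aM).cost ≤ κ
  cost_H : ((Expr.reg (k + l)).pow aH).cost ≤ κ
  cost_S : ((Expr.reg (k + l)).pow aS).cost ≤ κ
  cost_m : ((Expr.reg (k + l + 2)).pow (nA + k)).cost ≤ κ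

namespace Setup

variable {hk : 0 < k} {I : Input d l} {σ₀ : State} {τ : Fin nA → LinTerm (FOPVar d l)}
    {F : (Fin nA → Bool) → Bool} {n : ℕ → ℕ} {N L lam K D Q κ y aM aH aS : ℕ}
    {M H St X₀ Y X₁ Y₁ W X B : ℤ}
    (h : Setup hk I σ₀ τ F n N L lam K D Q κ y aM aH aS M H St X₀ Y X₁ Y₁ W X B)

include h

theorem n_val (i : Fin k) : n i = (I.A i).card :=
  (congrFun h.n_eq i).trans (congrArg (fun i' => (I.A i').card) (toIndex_val hk i))

theorem n_le {i : ℕ} (hi : i < k) : n i + 2 ≤ N := by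
  have := Finset.single_le_sum (f := n) (fun _ _ => Nat.zero_le _) (Finset.mem_range.2 hi)
  have := h.N_eq
  omega

theorem reg_card (i : Fin k) : σ₀.reg i = n i := by rw [h.enc.1 i, h.n_val]

theorem memVec_mem (i : Fin k) {p : ℕ} (hp : p < n i) : memVec (d := d) σ₀ i p ∈ I.A i := by
  obtain ⟨e, he⟩ := h.enc.2.2.2.1
  rw [h.n_val] at hp
  have : memVec (d := d) σ₀ i p = (e i ⟨p, hp⟩).1 := by
    ext s
    exact he i ⟨p, hp⟩ s
  rw [this]
  exact (e i ⟨p, hp⟩).2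

theorem memVec_inj (i : Fin k) {p p' : ℕ} (hp : p < n i) (hp' : p' < n i)
    (e' : memVec (d := d) σ₀ i p = memVec σ₀ i p') : p = p' := by
  obtain ⟨e, he⟩ := h.enc.2.2.2.1
  rw [h.n_val] at hp hp'
  have : e i ⟨p, hp⟩ = e i ⟨p', hp'⟩ := by
    ext s
    rw [← he i ⟨p, hp⟩ s, ← he i ⟨p', hp'⟩ s]
    exact congrFun e' s
  exact congrArg Fin.val ((e i).injective this)

theorem memVec_surj (i : Fin k) {a : Fin (d i) → ℤ} (ha : a ∈ I.A i) :
    ∃ p < n i, memVec (d := d) σ₀ i p = a := by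
  obtain ⟨e, he⟩ := h.enc.2.2.2.1
  refine ⟨(e i).symm ⟨a, ha⟩, by rw [h.n_val]; exact ((e i).symm ⟨a, ha⟩).2, ?_⟩
  ext s
  have := he i ((e i).symm ⟨a, ha⟩) s
  rwa [Equiv.apply_symm_apply] at this

/-- A state in which the given round number and element number are stored. -/
theorem exists_state (q p : ℕ) : ∃ σ : State, σ.reg (k + l + 2) = D ∧ σ.reg (k + l + 3) = M ∧
    σ.reg (k + l + 7) = q ∧ σ.reg (k + l + 10) = p ∧ (∀ r : Fin l, σ.reg (k + r) = I.t r) ∧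
    ∀ A < k, σ.mem A = σ₀.mem A := by
  refine ⟨⟨fun x => if x = k + l + 2 then D else if x = k + l + 3 then M else
    if x = k + l + 7 then q else if x = k + l + 10 then p else σ₀.reg x, σ₀.mem⟩,
    by simp, by simp, by simp, by simp, fun r => ?_, fun _ _ => rfl⟩
  have := r.2
  rw [← h.enc.2.1 r]
  simp only
  repeat rw [if_neg (by omega)]

theorem poly_term {X' : ℤ} (hX' : X₀ ≤ X') {σ : State} {p : ℕ} (i : Fin k) (hp : p < n i)
    (hpσ : σ.reg (k + l + 10) = p) (hm : σ.mem i = σ₀.mem i) (j : Fin nA) :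
    (termE (k + l) (τ j) i).Poly X' σ := by
  have h2 := h.two_le
  have hn := h.n_le i.2
  have hN := h.N_le
  exact poly_termE (by omega) (fun v => (h.coeff_le j v).trans hX') ((h.d_le i).trans hX') hpσ
    (by omega) hm fun s => (h.input_le i _ (h.memVec_mem i hp) s).trans hX'

theorem poly_free {X' : ℤ} (hX' : X₀ ≤ X') {σ : State}
    (ht : ∀ r : Fin l, σ.reg (k + r) = I.t r) (j : Fin nA) : (freeE (τ j)).Poly X' σ := by
  have h2 := h.two_le
  exact poly_freeE (by omega) (fun v => (h.coeff_le j v).trans hX') ((h.const_le j).trans hX')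
    fun r => by rw [ht]; exact (h.t_le r).trans hX'

/-- The bound is read off from the program: in a state that stores p, the number is the value of an
expression whose atoms are at most X₀, so `Expr.Poly.bounds` applies. The packed values and targets
are bounded in the same way with X₁ and Y₁. -/
theorem abs_termVal_le (j : Fin nA) (i : Fin k) {p : ℕ} (hp : p < n i) :
    |termVal (τ j) i (memVec σ₀ i p)| ≤ Y := by
  obtain ⟨σ, -, -, -, h10, -, hm⟩ := h.exists_state 0 p
  rw [← eval_termE (z := k + l) (τ j) h10 (hm i i.2)]
  exact ((h.poly_term le_rfl i hp h10 (hm i i.2) j).bounds h.two_le).1.trans (h.term_le j i)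

theorem abs_freeVal_le (j : Fin nA) : |freeVal (τ j) I.t| ≤ Y := by
  obtain ⟨σ, -, -, -, -, ht, -⟩ := h.exists_state 0 0
  rw [← eval_freeE (τ j) ht]
  exact ((h.poly_free le_rfl ht j).bounds h.two_le).1.trans (h.free_le j)

theorem M_nonneg : 0 ≤ M := by rw [h.M_eq]; positivity

theorem poly_val {σ : State} {q p : ℕ} (i : Fin k) (hp : p < n i) (hq : q ≤ Q)
    (h2 : σ.reg (k + l + 2) = D) (h3 : σ.reg (k + l + 3) = M) (h7 : σ.reg (k + l + 7) = q)
    (h10 : σ.reg (k + l + 10) = p) (hm : σ.mem i = σ₀.mem i) :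
    (packedValE (k + l) K τ i).Poly X₁ σ := by
  have h2' := h.two_le
  have hX := h.X₀_le
  have hQ := h.Q_le
  have hM := h.M_nonneg
  refine poly_packedValE (by omega) (h.K_le.trans hX) ?_ ?_ ?_
    fun j => h.poly_term hX i hp h10 hm j
  · rw [h2, Nat.abs_cast]; exact h.D_le
  · rw [h3, abs_of_nonneg hM]; exact h.M_le
  · rw [h7, Nat.abs_cast]; omega

theorem poly_target {σ : State} {q : ℕ} (hq : q ≤ Q)
    (h2 : σ.reg (k + l + 2) = D) (h3 : σ.reg (k + l + 3) = M) (h7 : σ.reg (k + l + 7) = q)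
    (ht : ∀ r : Fin l, σ.reg (k + r) = I.t r) :
    (packedTargetE (k + l) K τ).Poly X₁ σ := by
  have h2' := h.two_le
  have hX := h.X₀_le
  have hQ := h.Q_le
  have hM := h.M_nonneg
  refine poly_packedTargetE (by omega) (h.K_le.trans hX) ?_ ?_ ?_
    fun j => h.poly_free hX ht j
  · rw [h2, Nat.abs_cast]; exact h.D_le
  · rw [h3, abs_of_nonneg hM]; exact h.M_le
  · rw [h7, Nat.abs_cast]; omega

omit h in
theorem eval_val {σ : State} {q p : ℕ} (i : Fin k)
    (h2 : σ.reg (k + l + 2) = D) (h3 : σ.reg (k + l + 3) = M) (h7 : σ.reg (k + l + 7) = q)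
    (h10 : σ.reg (k + l + 10) = p) (hm : σ.mem i = σ₀.mem i) :
    (packedValE (k + l) K τ i).eval σ =
      packedVal σ₀ τ K M (fun j => q / D ^ (j : ℕ) % D) i p :=
  eval_packE h3 (fun j => eval_lowE (eval_digE h7 h2 j) (eval_termE _ h10 hm))
    fun j => eval_highE (eval_digE h7 h2 j) (eval_termE _ h10 hm)

omit h in
theorem eval_target {σ : State} {q : ℕ}
    (h2 : σ.reg (k + l + 2) = D) (h3 : σ.reg (k + l + 3) = M) (h7 : σ.reg (k + l + 7) = q)
    (ht : ∀ r : Fin l, σ.reg (k + r) = I.t r) :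
    (packedTargetE (k + l) K τ).eval σ =
      packedTarget τ I.t K M fun j => q / D ^ (j : ℕ) % D :=
  eval_packE h3 (fun j => eval_lowTargetE (eval_digE h7 h2 j) (eval_freeE _ ht))
    fun j => eval_highTargetE (eval_digE h7 h2 j) (eval_freeE _ ht)

theorem abs_packedVal_le {q p : ℕ} (i : Fin k) (hp : p < n i) (hq : q ≤ Q) :
    |packedVal σ₀ τ K M (fun j => q / D ^ (j : ℕ) % D) i p| ≤ Y₁ := by
  obtain ⟨σ, h2, h3, h7, h10, -, hm⟩ := h.exists_state q p
  rw [← eval_val i h2 h3 h7 h10 (hm i i.2)]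
  have := h.two_le
  have := h.X₀_le
  exact ((h.poly_val i hp hq h2 h3 h7 h10 (hm i i.2)).bounds (by omega)).1.trans (h.val_le i)

theorem abs_packedTarget_le {q : ℕ} (hq : q ≤ Q) :
    |packedTarget τ I.t K M fun j => q / D ^ (j : ℕ) % D| ≤ Y₁ := by
  obtain ⟨σ, h2, h3, h7, -, ht, -⟩ := h.exists_state q 0
  rw [← eval_target h2 h3 h7 ht]
  have := h.two_le
  have := h.X₀_le
  exact ((h.poly_target hq h2 h3 h7 ht).bounds (by omega)).1.trans h.target_le

end Setup

end Reduction

end WordRAM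

/-! ### The rounds add up to the number of witnesses -/

namespace WordRAM

section Total

variable {k l nA : ℕ} {d : Fin k → ℕ}

/-- The number of solutions of the instance for given digits. -/
def roundCount (σ₀ : State) (τ : Fin nA → LinTerm (FOPVar d l)) (t : Fin l → ℤ) (n : ℕ → ℕ)
    (N K : ℕ) (M H : ℤ) (g : Fin nA → ℕ) (b : Fin k → ℕ) : ℕ :=
  ((Fintype.piFinset fun i : Fin k => padValues N H ∪
      bitValues (Finset.range (n i)) (packedVal σ₀ τ K M g i) (b i)).filter
    fun v => ∑ i, v i = packedTarget τ t K M g).card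

/-- The contribution of the round with given digits. -/
def roundTerm (σ₀ : State) (τ : Fin nA → LinTerm (FOPVar d l)) (F : (Fin nA → Bool) → Bool)
    (t : Fin l → ℤ) (n : ℕ → ℕ) (N K : ℕ) (M H : ℤ) (g : Fin nA → ℕ) (b : Fin k → ℕ) : ℕ :=
  (if F fun j => decide (g j % 2 = 0) then 1 else 0) *
    (2 ^ (∑ i, b i) * roundCount σ₀ τ t n N K M H g b)

/-- The sum of the first `q` contributions. -/
def roundSum (σ₀ : State) (τ : Fin nA → LinTerm (FOPVar d l)) (F : (Fin nA → Bool) → Bool)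
    (t : Fin l → ℤ) (n : ℕ → ℕ) (N K : ℕ) (M H : ℤ) (D q : ℕ) : ℕ :=
  ∑ q ∈ Finset.range q, roundTerm σ₀ τ F t n N K M H (fun j => q / D ^ (j : ℕ) % D)
    fun i => q / D ^ (nA + (i : ℕ)) % D

namespace Setup

variable {hk : 0 < k} {I : Input d l} {σ₀ : State} {τ : Fin nA → LinTerm (FOPVar d l)}
    {F : (Fin nA → Bool) → Bool} {n : ℕ → ℕ} {N L lam K D Q κ y aM aH aS : ℕ}
    {M H St X₀ Y X₁ Y₁ W X B : ℤ}
    (h : Setup hk I σ₀ τ F n N L lam K D Q κ y aM aH aS M H St X₀ Y X₁ Y₁ W X B)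

include h

theorem D_pos : 0 < D := by
  rw [h.D_eq, h.L_eq, h.K_eq, h.lam_eq]
  have : 0 < Nat.size N := Nat.size_pos.2 (by rw [h.N_eq]; omega)
  have := h.y_pos
  positivity

theorem lam_le_D : lam ≤ D := by
  rw [h.D_eq, h.L_eq, ← mul_assoc]
  exact Nat.le_mul_of_pos_left _ (by have := h.y_pos; rw [h.K_eq]; positivity)

theorem n_lt_pow {i : ℕ} (hi : i < k) : n i < 2 ^ D := by
  have h1 := h.n_le hi
  have h2 : N < 2 ^ lam := by rw [h.lam_eq]; exact Nat.lt_size_self N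
  have h3 : 2 ^ lam ≤ 2 ^ D := Nat.pow_le_pow_right (by norm_num) h.lam_le_D
  omega

/-- The arrays list each set without repetition, so witnesses correspond to tuples of positions. -/
theorem numWitnesses_eq {ψ : LinFormula (FOPVar d l)}
    (hψ : ∀ x, ψ.Holds x ↔ F (fun j => decide (0 ≤ (τ j).eval x)) = true) :
    I.numWitnesses (IsFOPWitness ψ) =
      ((Fintype.piFinset fun i : Fin k => Finset.range (n i)).filter fun p =>
        F fun j => decide (0 ≤ freeVal (τ j) I.t +
          ∑ i, termVal (τ j) i (memVec σ₀ i (p i)))).card := by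
  have hW : ∀ (a : (i : Fin k) → Fin (d i) → ℤ) (t : Fin l → ℤ), IsFOPWitness ψ a t ↔
      F fun j => decide (0 ≤ freeVal (τ j) t + ∑ i, termVal (τ j) i (a i)) := fun a t => by
    rw [IsFOPWitness, hψ]
    simp only [eval_eq_freeVal_add]
  rw [Input.numWitnesses, ← Set.ncard_coe_finset]
  refine (Set.ncard_congr (fun p _ i => memVec (d := d) σ₀ i (p i)) ?_ ?_ ?_).symm
  · intro p hp
    simp only [Finset.coe_filter, Fintype.mem_piFinset, Finset.mem_range, Set.mem_ofPred_eq] at hp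
    exact ⟨fun i => h.memVec_mem i (hp.1 i), (hW _ _).2 hp.2⟩
  · intro p p' hp hp' e
    simp only [Finset.coe_filter, Fintype.mem_piFinset, Finset.mem_range, Set.mem_ofPred_eq] at hp hp'
    ext i
    exact h.memVec_inj i (hp.1 i) (hp'.1 i) (congrFun e i)
  · rintro a ⟨ha, hw⟩
    choose p hp he using fun i => h.memVec_surj i (ha i)
    refine ⟨p, ?_, funext he⟩
    simp only [Finset.coe_filter, Fintype.mem_piFinset, Finset.mem_range, Set.mem_ofPred_eq]
    refine ⟨hp, ?_⟩
    simp only [he]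
    exact (hW _ _).1 hw

/-- The size bounds are stated for the digits of a round number; this makes them available for every
digit vector. -/
theorem digits_eq (g : Fin nA → Fin D) : ∃ q ≤ Q, (fun j : Fin nA => q / D ^ (j : ℕ) % D) =
    fun j => (g j : ℕ) := by
  refine ⟨finFunctionFinEquiv g, ?_, funext fun j => ?_⟩
  · refine ((finFunctionFinEquiv g).2.le).trans ?_
    rw [h.Q_eq]
    exact Nat.pow_le_pow_right h.D_pos (by omega)
  · rw [← finFunctionFinEquiv_symm_apply_val, Equiv.symm_apply_apply]

/-- The padding is too large to take part in a solution, and the bit weights restore the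
multiplicities. D bit positions are enough because n_i < N < 2^lam ≤ 2^D. -/
theorem sum_weights (g : Fin nA → Fin D) :
    ∑ b : Fin k → Fin D, 2 ^ (∑ i, (b i : ℕ)) *
      roundCount σ₀ τ I.t n N K M H (fun j => g j) (fun i => b i) =
    ((Fintype.piFinset fun i : Fin k => Finset.range (n i)).filter fun p =>
      ∑ i, packedVal σ₀ τ K M (fun j => g j) i (p i) =
        packedTarget τ I.t K M fun j => g j).card := by
  obtain ⟨q, hq, e⟩ := h.digits_eq g
  have hY := h.Y₁_lt_H
  rw [← sum_card_bitValues (fun i : Fin k => Finset.range (n i))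
    (fun i => packedVal σ₀ τ K M (fun j => g j) i) _ (D := D)
    fun i => by rw [Finset.card_range]; exact h.n_lt_pow i.2]
  refine Finset.sum_congr rfl fun b _ => ?_
  congr 1
  refine card_filter_sum_union _ _ (Y := Y₁) (H := H) ?_ ?_ ?_ hY
  · intro i v hv
    obtain ⟨p, hp, rfl⟩ := Finset.mem_image.1 (Finset.mem_filter.1 hv).1
    rw [← e]
    exact h.abs_packedVal_le i (Finset.mem_range.1 hp) hq
  · intro i v hv
    obtain ⟨p, -, rfl⟩ := Finset.mem_image.1 hv
    omega
  · rw [← e]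
    exact h.abs_packedTarget_le hq

/-- The inner sum over bit positions gives the solutions of the packed equation among tuples of
positions, and the outer sum over digit vectors is `sum_digits_eq_card`. -/
theorem roundSum_eq {ψ : LinFormula (FOPVar d l)}
    (hψ : ∀ x, ψ.Holds x ↔ F (fun j => decide (0 ≤ (τ j).eval x)) = true) :
    roundSum σ₀ τ F I.t n N K M H D Q = I.numWitnesses (IsFOPWitness ψ) := by
  rw [roundSum, h.Q_eq, sum_range_digits (m := nA) (n := k) (D := D)
    fun g b => roundTerm σ₀ τ F I.t n N K M H g b]
  simp only [roundTerm, ← Finset.mul_sum, h.sum_weights]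
  rw [h.numWitnesses_eq hψ]
  exact sum_digits_eq_card (fun i : Fin k => Finset.range (n i))
    (fun j i p => termVal (τ j) i (memVec σ₀ i p)) (fun j => freeVal (τ j) I.t) F h.K_eq h.D_eq
    h.abs_freeVal_le (fun j i p hp => h.abs_termVal_le j i (Finset.mem_range.1 hp)) h.Y_lt h.Y_lt_M

/-- The contributions are nonnegative, so no partial sum exceeds the final count, which is at most
N^k. The accumulator thus never leaves the words. -/
theorem roundSum_le {ψ : LinFormula (FOPVar d l)}
    (hψ : ∀ x, ψ.Holds x ↔ F (fun j => decide (0 ≤ (τ j).eval x)) = true) {q : ℕ} (hq : q ≤ Q) :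
    (roundSum σ₀ τ F I.t n N K M H D q : ℤ) ≤ X := by
  have h1 : roundSum σ₀ τ F I.t n N K M H D q ≤ roundSum σ₀ τ F I.t n N K M H D Q :=
    Finset.sum_le_sum_of_subset (Finset.range_mono hq)
  have h2 : roundSum σ₀ τ F I.t n N K M H D Q ≤ N ^ k := by
    rw [h.roundSum_eq hψ, h.numWitnesses_eq hψ]
    refine (Finset.card_filter_le _ _).trans ?_
    rw [Fintype.card_piFinset]
    simp only [Finset.card_range]
    refine (Finset.prod_le_pow_card _ _ N fun i _ => ?_).trans (by simp)
    have := h.n_le i.2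
    omega
  have h3 : ((N ^ k : ℕ) : ℤ) ≤ X := by push_cast; exact h.total_le
  have h4 := h1.trans h2
  omega

end Setup

end Total

end WordRAM

/-! ### Correctness and running time of the program for given parameters -/

namespace WordRAM

theorem card_padValues (N : ℕ) (H : ℤ) : (padValues N H).card = N := by
  rw [padValues, Finset.card_image_of_injective _ fun p p' e => by simpa using e,
    Finset.card_range]

theorem roundRegs_succ {z : ℕ} {inp : ℕ → ℤ} {N lam D M H St Q q q' acc acc' : ℤ} {x : ℕ}
    (h7 : x ≠ z + 7) (h8 : x ≠ z + 8) (h9 : x ≠ z + 9) :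
    roundRegs z inp N lam D M H St Q q' acc' x = roundRegs z inp N lam D M H St Q q acc x := by
  simp [roundRegs, h7, h8, h9]

theorem abs_roundRegs_le {z : ℕ} {inp : ℕ → ℤ} {N lam D M H St Q q acc X : ℤ}
    (hinp : ∀ x, |inp x| ≤ X) (hN : |N| ≤ X) (hlam : |lam| ≤ X) (hD : |D| ≤ X) (hM : |M| ≤ X)
    (hH : |H| ≤ X) (hSt : |St| ≤ X) (hQ : |Q| ≤ X) (hq : |q| ≤ X) (hqSt : |q * St| ≤ X)
    (hacc : |acc| ≤ X) (x : ℕ) : |roundRegs z inp N lam D M H St Q q acc x| ≤ X := by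
  have h0 : |(0 : ℤ)| ≤ X := by simpa using (abs_nonneg _).trans hN
  have hite : ∀ (P : Prop) [Decidable P] (a b : ℤ), |a| ≤ X → |b| ≤ X → |if P then a else b| ≤ X :=
    fun P _ a b ha hb => by split <;> assumption
  unfold roundRegs
  refine hite _ _ _ (hinp x) <| hite _ _ _ hN <| hite _ _ _ hlam <| hite _ _ _ hD <|
    hite _ _ _ hM <| hite _ _ _ hH <| hite _ _ _ hSt <| hite _ _ _ hQ <| hite _ _ _ hq <|
    hite _ _ _ hqSt <| hite _ _ _ hacc h0

namespace Setup

variable {k l nA : ℕ} {d : Fin k → ℕ} {hk : 0 < k} {I : Input d l} {σ₀ : State}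
    {τ : Fin nA → LinTerm (FOPVar d l)} {F : (Fin nA → Bool) → Bool} {n : ℕ → ℕ}
    {N L lam K D Q κ y aM aH aS : ℕ} {M H St X₀ Y X₁ Y₁ W X B : ℤ}
    (h : Setup hk I σ₀ τ F n N L lam K D Q κ y aM aH aS M H St X₀ Y X₁ Y₁ W X B)

include h

theorem bdd : σ₀.Bdd X := by
  have h2 := h.two_le
  have h3 := h.X₀_le
  have h4 := h.X₁_le
  have h5 := h.N_le
  obtain ⟨e1, e2, e3, ⟨e, e4⟩, e5⟩ := h.enc
  refine ⟨fun x => ?_, fun A a => ?_⟩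
  · rcases lt_or_ge x k with hx | hx
    · rw [h.reg_card ⟨x, hx⟩, Nat.abs_cast]
      have := h.n_le hx
      simp only
      omega
    · rcases lt_or_ge x (k + l) with hx' | hx'
      · obtain ⟨r, rfl⟩ := Nat.exists_eq_add_of_le hx
        have := e2 ⟨r, by omega⟩
        simp only at this
        rw [this]
        exact (h.t_le _).trans (h3.trans h4)
      · rw [e3 x hx']; simp; omega
  · by_cases hc : ∃ (i : Fin k) (j : Fin (I.A i).card) (s : Fin (d i)),
      A = i ∧ a = (j : ℤ) * (d i : ℤ) + (s : ℤ)
    · obtain ⟨i, j, s, rfl, rfl⟩ := hc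
      rw [e4 i j s]
      exact (h.input_le i _ (e i j).2 s).trans (h3.trans h4)
    · rw [e5 A a hc]; simp; omega

theorem mem_eq_zero {A : ℕ} (hA : k ≤ A) (a : ℤ) : σ₀.mem A a = 0 := by
  refine h.enc.2.2.2.2 A a ?_
  rintro ⟨i, -, -, rfl, -⟩
  exact absurd i.2 (by omega)

theorem slotEnv {q : ℕ} {acc : ℤ} (hq : q < Q) {i : ℕ} (hi : i < k) :
    SlotEnv (k + l) k i (packedValE (k + l) K τ (toIndex hk i)) (digE (k + l) (nA + i)) N (n i) H
      (q * St) X B (fun p => packedVal σ₀ τ K M (fun j => q / D ^ (j : ℕ) % D) (toIndex hk i) p)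
      (q / D ^ (nA + i) % D) κ
      (Fixed (k + l) k X (roundRegs (k + l) σ₀.reg N lam D M H St Q q acc) σ₀.mem) := by
  have h2 := h.two_le
  have hX₀ := h.X₀_le
  have hX₁ := h.X₁_le
  have hni := h.n_le hi
  have hD : ∀ σ, Fixed (k + l) k X (roundRegs (k + l) σ₀.reg N lam D M H St Q q acc) σ₀.mem σ →
      σ.reg (k + l + 2) = D := fun σ hσ => by rw [hσ.reg _ (by omega)]; simp [roundRegs]
  have hM : ∀ σ, Fixed (k + l) k X (roundRegs (k + l) σ₀.reg N lam D M H St Q q acc) σ₀.mem σ →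
      σ.reg (k + l + 3) = M := fun σ hσ => by rw [hσ.reg _ (by omega)]; simp [roundRegs]
  have h7 : ∀ σ, Fixed (k + l) k X (roundRegs (k + l) σ₀.reg N lam D M H St Q q acc) σ₀.mem σ →
      σ.reg (k + l + 7) = q := fun σ hσ => by rw [hσ.reg _ (by omega)]; simp [roundRegs]
  have hn' : n (toIndex hk i : ℕ) = n i := by rw [val_toIndex hk hi]
  have hY : ∀ p < n i, |packedVal σ₀ τ K M (fun j => q / D ^ (j : ℕ) % D) (toIndex hk i) p| ≤ Y₁ :=
    fun p hp => h.abs_packedVal_le _ (hn'.symm ▸ hp) hq.le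
  have hH0 : 0 ≤ H := by rw [h.H_eq]; positivity
  constructor
  case val_tame =>
    have hQ := h.Q_le
    -- Tameness concerns only operations and constants, so it may be derived in the state that is
    -- zero everywhere.
    have hz : ∀ j, (termE (k + l) (τ j) (toIndex hk i)).Poly X₁ ⟨fun _ => 0, fun _ _ => 0⟩ := fun j =>
      poly_termE (σ₀ := ⟨fun _ => 0, fun _ _ => 0⟩) (p := 0) (by omega)
        (fun v => (h.coeff_le j v).trans hX₀) ((h.d_le _).trans hX₀) (by simp) (by simp; omega)
        rfl fun s => by simp [memVec]; omega
    exact (poly_packedValE (σ := ⟨fun _ => 0, fun _ _ => 0⟩) (by omega) (h.K_le.trans hX₀)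
      (by simp; omega) (by simp; omega) (by simp; omega) hz).tame.mono hX₁
  case setReg =>
    intro σ x v hσ hx hv
    refine ⟨hσ.bdd.setReg hv, fun x' hx' => ?_, hσ.mem⟩
    rw [State.setReg_reg, if_neg (by omega), hσ.reg x' hx']
  case setMem =>
    intro σ A a v hσ hA hv
    refine ⟨hσ.bdd.setMem hv, hσ.reg, fun A' hA' => ?_⟩
    rw [← hσ.mem A' hA']
    ext a'
    rw [State.setMem_mem, if_neg (by omega)]
  case bdd => exact fun σ hσ => hσ.bdd
  case regN => exact fun σ hσ => by rw [hσ.reg _ (by omega)]; simp [roundRegs]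
  case regH => exact fun σ hσ => by rw [hσ.reg _ (by omega)]; simp [roundRegs]
  case regOff => exact fun σ hσ => by rw [hσ.reg _ (by omega)]; simp [roundRegs]
  case regCard =>
    exact fun σ hσ => by
      rw [hσ.reg _ (by omega), roundRegs, if_pos (by omega)]; exact h.reg_card ⟨i, hi⟩
  case val_eq =>
    exact fun σ hσ j _ h10 => eval_val _ (hD σ hσ) (hM σ hσ) (h7 σ hσ) h10
      (hσ.mem _ (toIndex hk i).2)
  case bit_eq => exact fun σ hσ => eval_digE (h7 σ hσ) (hD σ hσ) _
  case two_le => omega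
  case pow_le => exact h.pow_le
  case bit_tame =>
    exact (poly_digE (σ := ⟨fun _ => 0, fun _ _ => 0⟩) (by omega) (by simp; omega)
      (by simp; omega) _).tame
  case val_cost => exact h.val_cost _
  case bit_cost => exact h.dig_cost i hi
  case card_le => have := h.card_le; omega
  case pad_le => rw [abs_of_nonneg hH0]; exact h.H_le
  case f_le => exact fun j hj => (hY j hj).trans h.Y₁_le
  case pad_ne =>
    intro j hj
    have h3 := hY j hj
    have h4 := h.Y₁_lt_H
    have h5 : 0 ≤ Y₁ := (abs_nonneg _).trans h3
    have h6 := le_abs_self (packedVal σ₀ τ K M (fun j => q / D ^ (j : ℕ) % D) (toIndex hk i) j)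
    nlinarith
  case i_lt => omega

/-- The program of the reduction is correct if the called program is. -/
theorem run {ψ : LinFormula (FOPVar d l)}
    (hψ : ∀ x, ψ.Holds x ↔ F (fun j => decide (0 ≤ (τ j).eval x)) = true) {p : Prog} {Tc : ℕ}
    (hpW : p.regBound ≤ W) (hW0 : k + 1 ≤ W) (hW1 : 2 * N ≤ W)
    (hcall : ∀ (S : Fin k → Finset ℤ) (t : ℤ), (∀ i, N ≤ (S i).card ∧ (S i).card ≤ 2 * N) →
      (∀ i, ∀ v ∈ S i, |v| ≤ H + N) → |t| ≤ H + N →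
      ∀ σ, (kSumInput S t).Encodes σ → ∃ T σ', Exec W p σ T σ' ∧ T ≤ Tc ∧
        σ'.reg 0 = (kSumInput S t).numWitnesses (IsKSumWitness k)) :
    Run B (reductionProg (k + l) k aM aH aS (2 * K * K * y) (nA + k)
      (roundProg (k + l) k (fun i => packedValE (k + l) K τ (toIndex hk i))
        (fun i => digE (k + l) (nA + i)) (packedTargetE (k + l) K τ) (checkE (k + l) F) p)) σ₀
      (10 * (κ + 1) + 8 * lam +
        Q * (k * ((3 * κ + 42) * (2 * N) + 25) + 4 * Tc + 4 * κ + 30 + 4))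
      fun σ' => σ'.reg 0 = I.numWitnesses (IsFOPWitness ψ) := by
  have h2 := h.two_le
  have hX₀ := h.X₀_le
  have hX₁ := h.X₁_le
  have hM0 := h.M_nonneg
  have hH0 : 0 ≤ H := by rw [h.H_eq]; positivity
  have hSt0 : 0 ≤ St := by rw [h.St_eq]; positivity
  have hMX : |M| ≤ X := by rw [abs_of_nonneg hM0]; exact h.M_le.trans hX₁
  have hHX : |H| ≤ X := by rw [abs_of_nonneg hH0]; have := h.H_le; omega
  have hQX : (Q : ℤ) ≤ X := h.Q_le.trans hX₁
  have hSQ : ∀ q : ℕ, q ≤ Q → (q : ℤ) * St ≤ Q * St := fun q hq =>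
    mul_le_mul_of_nonneg_right (by exact_mod_cast hq) hSt0
  have hQ0 : 0 < Q := by rw [h.Q_eq]; exact Nat.pow_pos h.D_pos
  have hStX : |St| ≤ X := by
    rw [abs_of_nonneg hSt0]
    have := h.St_le
    have h1 := hSQ 1 hQ0
    simp only [Nat.cast_one, one_mul] at h1
    omega
  have hDX : (D : ℤ) ≤ X := h.D_le.trans hX₁
  have hNX : (N : ℤ) ≤ X := h.N_le.trans (hX₀.trans hX₁)
  have hz : ∀ x, k + l ≤ x → σ₀.reg x = 0 := h.enc.2.2.1
  have := run_reduction (B := B) (X := X) (W := W) (κ := κ) (z := k + l) (k := k)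
    (T := k * ((3 * κ + 42) * (2 * N) + 25) + 4 * Tc + 4 * κ + 30) (σ₀ := σ₀) (n := n)
    (acc := fun q => roundSum σ₀ τ F I.t n N K M H D q) (N := N) (lam := lam) (D := D) (Q := Q)
    (Kc := 2 * K * K * y) (m := nA + k)
    (body := roundProg (k + l) k (fun i => packedValE (k + l) K τ (toIndex hk i))
        (fun i => digE (k + l) (nA + i)) (packedTargetE (k + l) K τ) (checkE (k + l) F) p)
    (by omega) h.pow_le (by have := h.check_cost; omega) h.bdd (fun i hi => h.reg_card ⟨i, hi⟩) hz
    (fun A a hA => h.mem_eq_zero hA a) h.N_eq h.lam_eq (by rw [h.D_eq, h.L_eq]; ring) h.M_eq h.H_eq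
    h.St_eq h.Q_eq hNX h.lam_le hDX hMX hHX hStX hQX h.Kc_le h.cost_N h.cost_M h.cost_H h.cost_S
    h.cost_m (by simp [roundSum]) ?_
  · refine this.mono le_rfl fun σ' e => ?_
    rw [e, h.roundSum_eq hψ]
  intro q hq σ hσ h0 hfresh
  have hcardn : ∀ i < k, n i ≤ N := fun i hi => by have := h.n_le hi; omega
  have hreg : ∀ σ, Fixed (k + l) k X (roundRegs (k + l) σ₀.reg N lam D M H St Q q
      (roundSum σ₀ τ F I.t n N K M H D q)) σ₀.mem σ →
      σ.reg (k + l + 2) = D ∧ σ.reg (k + l + 3) = M ∧ σ.reg (k + l + 7) = q ∧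
      ∀ r : Fin l, σ.reg (k + r) = I.t r := fun σ hσ => by
    refine ⟨by rw [hσ.reg _ (by omega)]; simp [roundRegs],
      by rw [hσ.reg _ (by omega)]; simp [roundRegs],
      by rw [hσ.reg _ (by omega)]; simp [roundRegs], fun r => ?_⟩
    have := r.2
    rw [hσ.reg _ (by omega), roundRegs, if_pos (by omega), h.enc.2.1 r]
  have hoff0 : 0 ≤ (q : ℤ) * St := by positivity
  have hoff := hSQ q hq.le
  have hoff1 := hSQ (q + 1) hq
  have hStle := h.St_le
  have hWSt := h.W_le
  have hY₁ := h.abs_packedTarget_le hq.le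
  have hY₁0 : 0 ≤ Y₁ := (abs_nonneg _).trans hY₁
  have hY₁H : Y₁ ≤ H := by have := h.Y₁_lt_H; nlinarith
  refine run_round (n := n) (t := packedTarget τ I.t K M fun j => q / D ^ (j : ℕ) % D)
    (γ := if F fun j => decide (q / D ^ (j : ℕ) % D % 2 = 0) then 1 else 0)
    (b := fun i => q / D ^ (nA + i) % D) (W := W)
    (res := roundCount σ₀ τ I.t n N K M H (fun j => q / D ^ (j : ℕ) % D)
      fun i => q / D ^ (nA + (i : ℕ)) % D)
    (fun i hi => h.slotEnv hq hi) hcardn hk ?_ ?_ h.target_cost (hY₁.trans h.Y₁_le) ?_ ?_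
    h.check_cost hW0 hW1 hpW ?_ hWSt ?_ h.bits_cost ?_ ?_ ?_ ?_ ?_ ?_ ?_ hσ h0 hfresh
  · intro σ hσ
    obtain ⟨e2, e3, e7, et⟩ := hreg σ hσ
    exact eval_target e2 e3 e7 et
  · obtain ⟨σ', s2, s3, s7, -, st, -⟩ := h.exists_state q 0
    exact (h.poly_target hq.le s2 s3 s7 st).tame.mono hX₁
  · intro σ hσ
    obtain ⟨e2, e3, e7, et⟩ := hreg σ hσ
    exact eval_checkE fun j => eval_digE e7 e2 j
  · exact (poly_checkE (σ := ⟨fun _ => 0, fun _ _ => 0⟩) (by omega) (by simp; omega)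
      (by simp; omega)).tame
  · rw [abs_of_nonneg hoff0]; omega
  · simp [roundRegs]
  -- Each bit position is a digit below D, so the weight is at most 2^(k D), a power of N because D
  -- is logarithmic.
  · refine le_trans ?_ h.weight_le
    refine pow_le_pow_right₀ (by norm_num) ?_
    refine (Finset.sum_le_card_nsmul _ _ D fun i _ => (Nat.mod_lt _ h.D_pos).le).trans ?_
    simp
  · intro σ' hσ'
    have e : (fun i : Fin k => slotSet N H n (fun i p => packedVal σ₀ τ K M
        (fun j => q / D ^ (j : ℕ) % D) (toIndex hk i) p) (fun i => q / D ^ (nA + i) % D) i) =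
        fun i : Fin k => padValues N H ∪ bitValues (Finset.range (n i))
          (packedVal σ₀ τ K M (fun j => q / D ^ (j : ℕ) % D) i) (q / D ^ (nA + (i : ℕ)) % D) := by
      funext i
      simp only [slotSet, toIndex_val]
    rw [e] at hσ'
    refine (hcall (fun i : Fin k => padValues N H ∪
      bitValues (Finset.range (n i)) (packedVal σ₀ τ K M (fun j => q / D ^ (j : ℕ) % D) i)
        (q / D ^ (nA + (i : ℕ)) % D)) _ (fun i => ⟨?_, ?_⟩) (fun i v hv => ?_)
        (hY₁.trans (by omega)) σ' hσ').imp fun T hT => hT.imp fun σ'' hT => ⟨hT.1, hT.2.1, ?_⟩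
    · calc N = (padValues N H).card := (card_padValues N H).symm
        _ ≤ _ := Finset.card_le_card Finset.subset_union_left
    · have h3 := card_slotSet_le (N := N) (H := H) (n := n) (f := fun i p => packedVal σ₀ τ K M
        (fun j => q / D ^ (j : ℕ) % D) (toIndex hk i) p) (b := fun i => q / D ^ (nA + i) % D) i
      have h4 := congrFun e i
      rw [h4] at h3
      have := hcardn i i.2
      omega
    · rcases Finset.mem_union.1 hv with hv | hv
      · obtain ⟨j, hj, rfl⟩ := Finset.mem_image.1 hv
        have := Finset.mem_range.1 hj
        rw [abs_of_nonneg (by omega)]; omega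
      · obtain ⟨j, hj, rfl⟩ := Finset.mem_image.1 (Finset.mem_filter.1 hv).1
        refine (h.abs_packedVal_le i (Finset.mem_range.1 hj) hq.le).trans ?_
        omega
    · rw [hT.2.2, numWitnesses_kSumInput]
      rfl
  · intro x _ h7 h8 h9
    exact roundRegs_succ h7 h8 h9
  · simp [roundRegs]
  · simp [roundRegs]; ring
  · simp only [roundRegs, roundSum, Finset.sum_range_succ, roundTerm]
    simp [Finset.sum_range]
  · intro x _
    refine abs_roundRegs_le h.bdd.1 ?_ ?_ ?_ hMX hHX hStX ?_ ?_ ?_ ?_ x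
    · rw [Nat.abs_cast]; exact hNX
    · rw [Nat.abs_cast]; exact h.lam_le
    · rw [Nat.abs_cast]; exact hDX
    · rw [Nat.abs_cast]; exact hQX
    · rw [abs_of_nonneg (by omega)]; omega
    · push_cast at hoff1
      rw [abs_of_nonneg (by positivity)]; omega
    · rw [Nat.abs_cast]; exact h.roundSum_le hψ hq

end Setup

end WordRAM

/-! ### Choice of the parameters as fixed powers of N -/

namespace WordRAM

/-- As N ≥ 2, constants can be absorbed into exponents of N; this lets all parameters be plain
powers. -/
theorem natCast_lt_pow {N : ℤ} (hN : 2 ≤ N) (m : ℕ) : (m : ℤ) < N ^ m :=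
  calc (m : ℤ) < (2 : ℤ) ^ m := by exact_mod_cast Nat.lt_two_pow_self
    _ ≤ N ^ m := pow_le_pow_left₀ (by norm_num) hN m

theorem two_pow_size_le {N : ℕ} (hN : 2 ≤ N) : 2 ^ Nat.size N ≤ 2 * N := by
  obtain ⟨m, hm⟩ : ∃ m, Nat.size N = m + 1 :=
    Nat.exists_eq_succ_of_ne_zero (Nat.size_pos.2 (by omega)).ne'
  have : 2 ^ m ≤ N := Nat.lt_size.1 (by omega)
  rw [hm, pow_succ]
  omega

theorem size_le_self (N : ℕ) : Nat.size N ≤ N := Nat.size_le.2 Nat.lt_two_pow_self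

theorem succ_mul_pow_le {N : ℤ} (hN : 2 ≤ N) (m a : ℕ) : ((m : ℤ) + 1) * N ^ a ≤ N ^ (a + m) := by
  rw [pow_add, mul_comm]
  exact mul_le_mul_of_nonneg_left (natCast_lt_pow hN m) (by positivity)

theorem add_le_pow_succ {N : ℤ} (hN : 2 ≤ N) {u v : ℤ} {a : ℕ} (hu : u ≤ N ^ a) (hv : v ≤ N ^ a) :
    u + v ≤ N ^ (a + 1) := by
  have : 0 < N ^ a := by positivity
  rw [pow_succ]
  nlinarith

theorem two_mul_add_two_le_cube {N : ℤ} (hN : 2 ≤ N) : 2 * N + 2 ≤ N ^ 3 := by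
  have h1 : N ^ 3 = N * N * N := by ring
  have h2 : N * 2 ≤ N * N := by nlinarith
  nlinarith

theorem two_pow_size_le_sq {N : ℕ} (hN : 2 ≤ N) : (2 : ℤ) ^ Nat.size N ≤ (N : ℤ) ^ 2 := by
  have h : (2 : ℤ) ^ Nat.size N ≤ 2 * N := by exact_mod_cast two_pow_size_le hN
  have h' : (2 : ℤ) ≤ N := by exact_mod_cast hN
  nlinarith

theorem mul_add_lt_pow {N : ℤ} (hN : 2 ≤ N) (k a : ℕ) :
    (k + 1) * N ^ a + (k + 3 : ℕ) + 1 < N ^ (a + (2 * k + 5)) := by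
  have h1 := succ_mul_pow_le hN (2 * k + 5) a
  have h2 : 0 < N ^ a := by positivity
  have h3 : (0 : ℤ) ≤ k := Int.natCast_nonneg _
  push_cast at h1 ⊢
  nlinarith

theorem mul_lt_pow {N : ℤ} (hN : 2 ≤ N) (k a : ℕ) : (k + 1) * N ^ a < N ^ (a + (k + 1)) := by
  have h1 := succ_mul_pow_le hN (k + 1) a
  have h2 : 0 < N ^ a := by positivity
  push_cast at h1
  linarith

theorem two_mul_pow_lt {N : ℤ} (hN : 2 ≤ N) (a : ℕ) : 2 * N ^ a < N ^ (a + 2) := by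
  have h1 := succ_mul_pow_le hN 2 a
  have h2 : 0 < N ^ a := by positivity
  push_cast at h1
  linarith

section

variable {k l nA : ℕ} {d : Fin k → ℕ}

theorem size_le_total {hk : 0 < k} {I : Input d l} {n : ℕ → ℕ} {N : ℕ}
    (hn : n = fun i => (I.A (toIndex hk i)).card) (hN : N = 2 + ∑ i ∈ Finset.range k, n i) :
    I.size ≤ N := by
  refine Finset.sup_le fun i _ => ?_
  have := Finset.single_le_sum (f := n) (fun _ _ => Nat.zero_le _) (Finset.mem_range.2 i.2)
  have h1 : n i = (I.A i).card :=
    (congrFun hn i).trans (congrArg (fun i' => (I.A i').card) (toIndex_val hk i))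
  omega

theorem total_le {hk : 0 < k} {I : Input d l} {n : ℕ → ℕ} {N : ℕ}
    (hn : n = fun i => (I.A (toIndex hk i)).card) (hN : N = 2 + ∑ i ∈ Finset.range k, n i) :
    N ≤ 2 + k * I.size := by
  have h1 : ∑ i ∈ Finset.range k, n i ≤ k * I.size := by
    simpa using Finset.sum_le_card_nsmul (Finset.range k) n I.size fun i _ => by
      rw [hn]; exact Finset.le_sup (f := fun i => (I.A i).card) (Finset.mem_univ _)
  omega

/-- Word sizes are measured in I.size + 2, the parameters in N. Bernoulli's inequality converts 2 +
k * I.size into a power. -/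
theorem total_le_pow {hk : 0 < k} {I : Input d l} {n : ℕ → ℕ} {N : ℕ}
    (hn : n = fun i => (I.A (toIndex hk i)).card) (hN : N = 2 + ∑ i ∈ Finset.range k, n i) :
    N ≤ (I.size + 2) ^ (k + 1) := by
  refine (total_le hn hN).trans ?_
  have h := one_add_mul_le_pow (R := ℤ) (a := (I.size : ℤ) + 1) (by omega) (k + 1)
  have h' : (1 : ℤ) + ((I.size : ℤ) + 1) = ((I.size + 2 : ℕ) : ℤ) := by push_cast; ring
  rw [h'] at h
  zify
  refine le_trans ?_ h
  push_cast
  have h2 : (0 : ℤ) ≤ I.size := Int.natCast_nonneg _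
  have h3 : (0 : ℤ) ≤ k := Int.natCast_nonneg _
  nlinarith

set_option maxHeartbeats 2000000 in
/-- For a fixed problem, the parameters of the reduction can be chosen as fixed powers. The
parameter `aH` does not depend on the program for `#k`-SUM. -/
theorem exists_setup (hk : 0 < k) (τ : Fin nA → LinTerm (FOPVar d l)) (F : (Fin nA → Bool) → Bool)
    (c : ℕ) : ∃ y aM aH : ℕ, ∀ r w' : ℕ, ∃ aW aS κ w : ℕ, ∀ (I : Input d l) (σ₀ : State),
      I.InUniverse c → I.Encodes σ₀ → ∀ (n : ℕ → ℕ) (N : ℕ),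
      n = (fun i => (I.A (toIndex hk i)).card) → N = 2 + ∑ i ∈ Finset.range k, n i →
      ∃ X₀ Y X₁ Y₁ X : ℤ, Setup hk I σ₀ τ F n N (y * Nat.size N) (Nat.size N) (k + 3)
        (2 * (k + 3) * (k + 3) * (y * Nat.size N))
        ((2 * (k + 3) * (k + 3) * (y * Nat.size N)) ^ (nA + k)) κ y aM aH aS (N ^ aM) (N ^ aH)
        (N ^ aS) X₀ Y X₁ Y₁ (N ^ aW) X ((I.size + 2) ^ w : ℕ) ∧
      (r : ℤ) ≤ N ^ aW ∧ (k : ℤ) + 1 ≤ N ^ aW ∧ 2 * (N : ℤ) ≤ N ^ aW ∧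
      (2 * (N : ℤ) + 2) ^ w' ≤ N ^ aW ∧ (N : ℤ) ^ aH + N ≤ N ^ (aH + 1) := by
  obtain ⟨K, hK⟩ : ∃ K, K = k + 3 := ⟨_, rfl⟩
  obtain ⟨cf, hcf⟩ : ∃ cf : ℕ, cf = ∑ j, ((τ j).const.natAbs + ∑ v, ((τ j).coeff v).natAbs) :=
    ⟨_, rfl⟩
  -- N^a0 bounds N, the input numbers, the coefficients and constants of the terms, the dimensions
  -- and 2 K^2.
  obtain ⟨a0, ha0⟩ : ∃ a0, a0 = c + 1 + cf + ∑ i, d i + 2 * K * K := ⟨_, rfl⟩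
  obtain ⟨κ0, hκ0⟩ : ∃ κ0, κ0 = ∑ j, ((freeE (τ j)).cost + ∑ i, (termE (k + l) (τ j) i).cost) :=
    ⟨_, rfl⟩
  -- L = y * size N makes 2^L larger than N^y, and the extra 1 in y leaves room for Y + 1.
  obtain ⟨y, hy⟩ : ∃ y, y = a0 * κ0 + 1 := ⟨_, rfl⟩
  obtain ⟨Kc, hKc⟩ : ∃ Kc, Kc = 2 * K * K * y := ⟨_, rfl⟩
  obtain ⟨aM, haM⟩ : ∃ aM, aM = a0 * κ0 + (2 * k + 5) := ⟨_, rfl⟩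
  obtain ⟨aQ, haQ⟩ : ∃ aQ, aQ = (Kc + 1) * (nA + k) := ⟨_, rfl⟩
  -- N^a1 bounds all atoms of the packed expressions: the earlier data, M, D and the round number.
  obtain ⟨a1, ha1⟩ : ∃ a1, a1 = a0 + aM + aQ + (Kc + 1) := ⟨_, rfl⟩
  obtain ⟨κ1, hκ1⟩ : ∃ κ1, κ1 = (packedTargetE (k + l) K τ).cost +
      ∑ i, (packedValE (k + l) K τ i).cost := ⟨_, rfl⟩
  obtain ⟨aH, haH⟩ : ∃ aH, aH = a1 * κ1 + (k + 1) := ⟨_, rfl⟩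
  -- The numbers in the instances are bounded before the program for #k-SUM is known. This order is
  -- forced: that program depends on the universe, while its registers r and word exponent w'
  -- determine the window.
  refine ⟨y, aM, aH, fun r w' => ?_⟩
  -- The term 3 * w' comes from 2 N + 2 ≤ N^3, so that the words of the called program fit into the
  -- window.
  obtain ⟨aW, haW⟩ : ∃ aW, aW = 3 * w' + r + (k + 1) + 2 := ⟨_, rfl⟩
  -- N^aX has to exceed everything ever stored; 2 * (k * Kc) is for the weights, by 2^(size N) ≤
  -- N^2.
  obtain ⟨aX, haX⟩ : ∃ aX, aX = a1 + (aH + 1) + (aQ + (aW + 2) + 1) + a1 * κ1 + 2 * (k * Kc) + k +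
      Kc + 3 := ⟨_, rfl⟩
  obtain ⟨κ, hκ⟩ : ∃ κ, κ = κ1 + ((checkE (k + l) F).cost + 10) +
      ∑ i ∈ Finset.range k, ((digE (k + l) (nA + i)).cost + 10) +
      (Expr.sum ((List.range k).map fun i => digE (k + l) (nA + i))).cost +
      (Expr.sum (.const 2 :: (List.range k).map .reg)).cost + ((Expr.reg (k + l)).pow aM).cost +
      ((Expr.reg (k + l)).pow aH).cost + ((Expr.reg (k + l)).pow (aW + 2)).cost +
      ((Expr.reg (k + l + 2)).pow (nA + k)).cost := ⟨_, rfl⟩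
  -- Stride N^(aW + 2) is more than two half-widths. The word exponent combines N ≤ (I.size + 2)^(k
  -- + 1) with the bound X^κ for expressions of cost at most κ.
  refine ⟨aW, aW + 2, κ, (k + 1) * (aX * κ), fun I σ₀ hU hE n N hn hN => ?_⟩
  obtain ⟨s, hs⟩ : ∃ s, s = Nat.size N := ⟨_, rfl⟩
  have hN2 : 2 ≤ N := by omega
  have hZ2 : (2 : ℤ) ≤ N := by exact_mod_cast hN2
  have hpos : ∀ a : ℕ, (0 : ℤ) < (N : ℤ) ^ a := fun a => by positivity
  have hmono : ∀ {a b : ℕ}, a ≤ b → (N : ℤ) ^ a ≤ (N : ℤ) ^ b := fun hab =>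
    pow_le_pow_right₀ (by omega) hab
  have hnat : ∀ {m a : ℕ}, m ≤ a → (m : ℤ) ≤ (N : ℤ) ^ a := fun {m a} hma =>
    (natCast_lt_pow hZ2 m).le.trans (hmono hma)
  have hsucc : ∀ a : ℕ, (N : ℤ) ^ (a + 1) = N * (N : ℤ) ^ a := fun a => pow_succ' _ _
  have hadd : ∀ {u v : ℤ} {a : ℕ}, u ≤ (N : ℤ) ^ a → v ≤ (N : ℤ) ^ a → u + v ≤ (N : ℤ) ^ (a + 1) :=
    fun hu hv => add_le_pow_succ hZ2 hu hv
  have hself : ∀ {a : ℕ}, 1 ≤ a → (N : ℤ) ≤ (N : ℤ) ^ a := fun ha => by simpa using hmono ha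
  have hsN : s ≤ N := hs ▸ size_le_self N
  have hsize : I.size ≤ N := size_le_total hn hN
  have hNsize : N ≤ (I.size + 2) ^ (k + 1) := total_le_pow hn hN
  have hsizec : (I.size : ℤ) ^ c ≤ (N : ℤ) ^ a0 :=
    (pow_le_pow_left₀ (by positivity) (by exact_mod_cast hsize) c).trans (hmono (by omega))
  have hcost0 : ∀ j, (freeE (τ j)).cost ≤ κ0 ∧ ∀ i, (termE (k + l) (τ j) i).cost ≤ κ0 := fun j => by
    have h1 := Finset.single_le_sum (f := fun j => (freeE (τ j)).cost +
      ∑ i, (termE (k + l) (τ j) i).cost) (fun _ _ => Nat.zero_le _) (Finset.mem_univ j)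
    refine ⟨by omega, fun i => ?_⟩
    have h2 := Finset.single_le_sum (f := fun i => (termE (k + l) (τ j) i).cost)
      (fun _ _ => Nat.zero_le _) (Finset.mem_univ i)
    omega
  have hcoeff : ∀ j, (τ j).const.natAbs ≤ cf ∧ ∀ v, ((τ j).coeff v).natAbs ≤ cf := fun j => by
    have h1 := Finset.single_le_sum (f := fun j => (τ j).const.natAbs +
      ∑ v, ((τ j).coeff v).natAbs) (fun _ _ => Nat.zero_le _) (Finset.mem_univ j)
    refine ⟨by omega, fun v => ?_⟩
    have h2 := Finset.single_le_sum (f := fun v => ((τ j).coeff v).natAbs)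
      (fun _ _ => Nat.zero_le _) (Finset.mem_univ v)
    omega
  have hcost1 : ∀ i, (packedValE (k + l) K τ i).cost ≤ κ1 := fun i => by
    have h1 := Finset.single_le_sum (f := fun i => (packedValE (k + l) K τ i).cost)
      (fun _ _ => Nat.zero_le _) (Finset.mem_univ i)
    omega
  have hdig : ∀ i < k, (digE (k + l) (nA + i)).cost + 10 ≤ κ := fun i hi => by
    have h1 := Finset.single_le_sum (f := fun i => (digE (k + l) (nA + i)).cost + 10)
      (fun _ _ => Nat.zero_le _) (Finset.mem_range.2 hi)
    omega
  have hpw : ∀ {a b m : ℕ}, m ≤ b → ((N : ℤ) ^ a) ^ m ≤ (N : ℤ) ^ (a * b) := fun {a b m} hm => by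
    rw [← pow_mul]; exact hmono (Nat.mul_le_mul_left a hm)
  have hD : ((2 * K * K * (y * s) : ℕ) : ℤ) ≤ (N : ℤ) ^ (Kc + 1) := by
    have h1 : 2 * K * K * (y * s) = s * Kc := by rw [hKc]; ring
    rw [h1, hsucc]
    push_cast
    exact mul_le_mul (by exact_mod_cast hsN) (hnat le_rfl) (by positivity) (by positivity)
  have hQ : (((2 * K * K * (y * s)) ^ (nA + k) : ℕ) : ℤ) ≤ (N : ℤ) ^ aQ := by
    rw [haQ, pow_mul, Nat.cast_pow]
    exact pow_le_pow_left₀ (by positivity) hD _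
  have hlt : (N : ℤ) < 2 ^ s := by rw [hs]; exact_mod_cast Nat.lt_size_self N
  rw [← hs, ← hK]
  refine ⟨(N : ℤ) ^ a0, (N : ℤ) ^ (a0 * κ0), (N : ℤ) ^ a1, (N : ℤ) ^ (a1 * κ1), (N : ℤ) ^ aX,
    ?_, hnat (by omega), ?_, ?_, ?_, ?_⟩
  · constructor
    case enc => exact hE
    case n_eq => exact hn
    case N_eq => exact hN
    case lam_eq => exact hs
    case K_eq => exact hK
    case L_eq => rfl
    case D_eq => rfl
    case Q_eq => rfl
    case M_eq => rfl
    case H_eq => rfl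
    case St_eq => rfl
    case y_pos => omega
    case two_le => exact hZ2.trans (hself (by omega))
    case coeff_le =>
      intro j v
      rw [Int.abs_eq_natAbs]
      exact hnat (((hcoeff j).2 v).trans (by omega))
    case const_le =>
      intro j
      rw [Int.abs_eq_natAbs]
      exact hnat ((hcoeff j).1.trans (by omega))
    case d_le =>
      intro i
      have := Finset.single_le_sum (f := d) (fun _ _ => Nat.zero_le _) (Finset.mem_univ i)
      exact hnat (by omega)
    case K_le => exact hnat (by omega)
    case N_le => exact hself (by omega)
    case input_le => exact fun i a ha s => (hU.1 i a ha s).trans hsizec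
    case t_le => exact fun r => (hU.2 r).trans hsizec
    case term_le => exact fun j i => hpw ((hcost0 j).2 i)
    case free_le => exact fun j => hpw (hcost0 j).1
    case Y_lt =>
      calc (N : ℤ) ^ (a0 * κ0) + 1 ≤ (N : ℤ) ^ y := by
            rw [hy]; exact hadd le_rfl (hpos _)
        _ < (2 ^ s) ^ y := pow_lt_pow_left₀ hlt (by omega) (by omega)
        _ = 2 ^ (y * s) := by rw [← pow_mul, mul_comm]
    case Y_lt_M =>
      rw [haM, hK]
      exact mul_add_lt_pow hZ2 k _
    case X₀_le => exact hmono (by omega)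
    case M_le => exact hmono (by omega)
    case D_le => exact hD.trans (hmono (by omega))
    case Q_le => exact hQ.trans (hmono (by omega))
    case val_le => exact fun i => hpw (hcost1 i)
    case target_le => exact hpw (by omega)
    case Y₁_lt_H =>
      rw [haH]
      exact mul_lt_pow hZ2 k _
    case X₁_le => exact hmono (by omega)
    case lam_le => exact le_trans (by exact_mod_cast hsN) (hself (by omega))
    case Kc_le => exact hnat (by omega)
    case Y₁_le => exact hmono (by omega)
    case H_le =>
      exact (hadd le_rfl (hself (by omega))).trans (hmono (by omega))
    case card_le =>
      have h1 : ((k + 1 : ℕ) : ℤ) ≤ (N : ℤ) ^ (k + 2) := hnat (by omega)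
      have h2 : (N : ℤ) + N ≤ (N : ℤ) ^ (k + 2) := hadd (hself (by omega)) (hself (by omega))
      have h3 := (hadd h1 h2).trans (hmono (show k + 2 + 1 ≤ aX by omega))
      push_cast at h3
      linarith
    case W_le => exact two_mul_pow_lt hZ2 aW
    case St_le =>
      have h1 : (((2 * K * K * (y * s)) ^ (nA + k) : ℕ) : ℤ) * (N : ℤ) ^ (aW + 2) ≤
          (N : ℤ) ^ (aQ + (aW + 2)) :=
        (mul_le_mul_of_nonneg_right hQ (hpos _).le).trans_eq (pow_add _ _ _).symm
      exact (hadd (hmono (by omega)) h1).trans (hmono (by omega))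
    case weight_le =>
      have h1 : k * (2 * K * K * (y * s)) = s * (k * Kc) := by rw [hKc]; ring
      have h2 : (2 : ℤ) ^ s ≤ (N : ℤ) ^ 2 := by
        rw [hs]; exact two_pow_size_le_sq hN2
      rw [h1, pow_mul]
      refine (pow_le_pow_left₀ (by positivity) h2 _).trans ?_
      rw [← pow_mul]
      exact hmono (by omega)
    case total_le => exact hmono (by omega)
    case pow_le =>
      rw [← pow_mul, pow_mul _ (k + 1)]
      exact_mod_cast Nat.pow_le_pow_left hNsize _
    case val_cost => exact fun i => (hcost1 i).trans (by omega)
    case target_cost => omega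
    case check_cost => omega
    case dig_cost => exact hdig
    case bits_cost => omega
    case cost_N => omega
    case cost_M => omega
    case cost_H => omega
    case cost_S => omega
    case cost_m => omega
  · have : ((k + 1 : ℕ) : ℤ) ≤ (N : ℤ) ^ aW := hnat (by omega)
    exact_mod_cast this
  · rw [two_mul]
    exact (hadd (hself le_rfl) (hself le_rfl)).trans (hmono (by omega))
  · refine (pow_le_pow_left₀ (by positivity) (two_mul_add_two_le_cube hZ2) w').trans ?_
    rw [← pow_mul]
    exact hmono (by omega)
  · exact hadd le_rfl (hself (by omega))

end

end WordRAM

/-! ### The time bound -/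

/-- `Nat.size N` is at most the binary logarithm of 2 N, which is below a constant times any
positive power; the exponent δ / (m + 1) leaves room for the m-th power. -/
theorem size_pow_le (m : ℕ) {δ : ℝ} (hδ : 0 < δ) : ∃ C : ℝ, 0 ≤ C ∧ ∀ N : ℕ, 2 ≤ N →
    (Nat.size N : ℝ) ^ m ≤ C * (2 * N : ℝ) ^ δ := by
  set ε : ℝ := δ / (m + 1) with hε
  have hε0 : 0 < ε := by positivity
  have hlog := Real.log_pos one_lt_two
  refine ⟨(1 / (ε * Real.log 2)) ^ m, by positivity, fun N hN => ?_⟩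
  have hN' : (2 : ℝ) ≤ N := by exact_mod_cast hN
  have h1 : (Nat.size N : ℝ) * Real.log 2 ≤ Real.log (2 * N) := by
    rw [← Real.log_pow]
    refine Real.log_le_log (by positivity) ?_
    exact_mod_cast WordRAM.two_pow_size_le hN
  have h2 : (Nat.size N : ℝ) ≤ 1 / (ε * Real.log 2) * (2 * N : ℝ) ^ ε := by
    have h3 := h1.trans (Real.log_le_rpow_div (x := 2 * N) (by positivity) hε0)
    rw [← le_div_iff₀ hlog] at h3
    refine h3.trans_eq ?_
    field_simp
  calc (Nat.size N : ℝ) ^ m ≤ (1 / (ε * Real.log 2) * (2 * N : ℝ) ^ ε) ^ m :=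
        pow_le_pow_left₀ (by positivity) h2 m
    _ = (1 / (ε * Real.log 2)) ^ m * (2 * N : ℝ) ^ (ε * m) := by
        rw [mul_pow, Real.rpow_mul_natCast (by positivity)]
    _ ≤ _ := by
        refine mul_le_mul_of_nonneg_left ?_ (by positivity)
        refine Real.rpow_le_rpow_of_exponent_le (by linarith) ?_
        rw [hε, div_mul_eq_mul_div, div_le_iff₀ (by positivity)]
        nlinarith

/-- The running time of the reduction is dominated by the calls. -/
theorem exists_time_bound (κ Kc m k : ℕ) {A e δ : ℝ} (hA : 0 ≤ A) (he : 1 ≤ e) (hδ : 0 < δ) :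
    ∃ C : ℝ, 0 ≤ C ∧ ∀ N Tc : ℕ, 2 ≤ N → (Tc : ℝ) ≤ A * (2 * N : ℝ) ^ e →
      ((10 * (κ + 1) + 8 * Nat.size N + (Kc * Nat.size N) ^ m *
        (k * ((3 * κ + 42) * (2 * N) + 25) + 4 * Tc + 4 * κ + 30 + 4) : ℕ) : ℝ) ≤
      C * (2 * N : ℝ) ^ (e + δ) := by
  obtain ⟨C₁, hC₁, hs⟩ := size_pow_le m hδ
  set A' : ℝ := k * ((3 * κ + 42) + 25) + 4 * A + 4 * κ + 30 + 4 with hA'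
  refine ⟨10 * (κ + 1) + 8 + (Kc : ℝ) ^ m * C₁ * A', by positivity, fun N Tc hN hT => ?_⟩
  have hN' : (2 : ℝ) ≤ N := by exact_mod_cast hN
  set Z : ℝ := 2 * N with hZ
  have hZ1 : 1 ≤ Z := by linarith
  have he1 : Z ≤ Z ^ e := by
    simpa using Real.rpow_le_rpow_of_exponent_le hZ1 he
  have hd1 : 1 ≤ Z ^ δ := Real.one_le_rpow hZ1 hδ.le
  have hsize : (Nat.size N : ℝ) ≤ N := by exact_mod_cast WordRAM.size_le_self N
  have hZe : 0 < Z ^ e := by linarith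
  have hsum : Z ^ (e + δ) = Z ^ e * Z ^ δ := Real.rpow_add (by linarith) _ _
  have hbig : Z ≤ Z ^ (e + δ) := by rw [hsum]; nlinarith
  have hin : (k * ((3 * κ + 42) * Z + 25) + 4 * Tc + 4 * κ + 30 + 4 : ℝ) ≤ A' * Z ^ e := by
    have h1 : ((3 * κ + 42) * Z + 25 : ℝ) ≤ ((3 * κ + 42) + 25) * Z ^ e := by
      have : (3 * κ + 42 : ℝ) * Z ≤ (3 * κ + 42) * Z ^ e :=
        mul_le_mul_of_nonneg_left he1 (by positivity)
      linarith
    have h2 := mul_le_mul_of_nonneg_left h1 (Nat.cast_nonneg (α := ℝ) k)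
    have h3 : (4 * κ : ℝ) ≤ 4 * κ * Z ^ e := le_mul_of_one_le_right (by positivity) (by linarith)
    rw [hA']
    linarith
  have hp : ((Kc : ℝ) * Nat.size N) ^ m ≤ (Kc : ℝ) ^ m * C₁ * Z ^ δ := by
    rw [mul_pow, mul_assoc]
    exact mul_le_mul_of_nonneg_left (hs N hN) (by positivity)
  have hmul := mul_le_mul hp hin (by positivity) (by positivity)
  have h10 : (10 * (κ + 1) : ℝ) ≤ 10 * (κ + 1) * Z ^ (e + δ) :=
    le_mul_of_one_le_right (by positivity) (by linarith)
  push_cast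
  calc _ ≤ 10 * (κ + 1) * Z ^ (e + δ) + 8 * Z ^ (e + δ) +
        (Kc : ℝ) ^ m * C₁ * Z ^ δ * (A' * Z ^ e) := by
        rw [hZ] at hmul ⊢
        linarith
    _ = _ := by rw [hsum]; ring

/-! ### Sizes of the instances, and the main theorem -/

theorem le_size_kSumInput {k : ℕ} (hk : 0 < k) {S : Fin k → Finset ℤ} {t : ℤ} {N : ℕ}
    (h : ∀ i, N ≤ (S i).card) : N ≤ (kSumInput S t).size :=
  ((h ⟨0, hk⟩).trans_eq (card_kSumInput S t _).symm).trans
    (Finset.le_sup (f := fun i => ((kSumInput S t).A i).card) (Finset.mem_univ _))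

theorem size_kSumInput_le {k : ℕ} {S : Fin k → Finset ℤ} {t : ℤ} {N : ℕ}
    (h : ∀ i, (S i).card ≤ N) : (kSumInput S t).size ≤ N :=
  Finset.sup_le fun i _ => (card_kSumInput S t i).trans_le (h i)

theorem inUniverse_kSumInput {k : ℕ} {S : Fin k → Finset ℤ} {t : ℤ} {c : ℕ}
    (hS : ∀ i, ∀ v ∈ S i, |v| ≤ ((kSumInput S t).size : ℤ) ^ c)
    (ht : |t| ≤ ((kSumInput S t).size : ℤ) ^ c) :
    (kSumInput S t).InUniverse c := by
  refine ⟨fun i a ha s => ?_, fun _ => ht⟩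
  obtain ⟨v, hv, rfl⟩ := Finset.mem_map.1 ha
  exact hS i v hv

theorem mainTheorem2 (k : ℕ) (hk : 3 ≤ k) (hodd : Odd k)
    (hSum : ∃ ε : ℝ, 0 < ε ∧ CountableInTime (IsKSumWitness k) ((⌈(k : ℝ) / 2⌉₊ : ℝ) - ε)) :
    ∀ (d : Fin k → ℕ) (l : ℕ) (ψ : LinFormula (FOPVar d l)),
      ∃ ε' : ℝ, 0 < ε' ∧ CountableInTime (IsFOPWitness ψ) ((⌈(k : ℝ) / 2⌉₊ : ℝ) - ε') := by
  intro d l ψ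
  obtain ⟨ε, hε, hSum⟩ := hSum
  set E : ℝ := (⌈(k : ℝ) / 2⌉₊ : ℝ) with hE
  have hk0 : 0 < k := by omega
  have hE2 : 2 ≤ E := by
    have h1 : 1 < ⌈(k : ℝ) / 2⌉₊ := Nat.lt_ceil.2 (by
      have : (3 : ℝ) ≤ k := by exact_mod_cast hk
      push_cast
      linarith)
    rw [hE]
    exact_mod_cast h1
  -- As E ≥ 2, this keeps E - ε₀ at least 1, so that the linear time for building an instance is
  -- dominated by the bound for the call.
  set ε₀ : ℝ := min ε 1 with hε₀
  have hε₀0 : 0 < ε₀ := lt_min hε one_pos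
  have hε₀1 : ε₀ ≤ 1 := min_le_right _ _
  have hε₀ε : ε₀ ≤ ε := min_le_left _ _
  -- Half of the saving pays for the polylogarithmic number of rounds.
  refine ⟨ε₀ / 2, by positivity, fun c => ?_⟩
  obtain ⟨nA, τ, F, hψ⟩ := ψ.exists_signs
  obtain ⟨y, aM, aH, hset⟩ := WordRAM.exists_setup hk0 τ F c
  -- The numbers in the instances are at most N^aH + N ≤ N^(aH + 1), and each instance has size at
  -- least N.
  obtain ⟨p, w', C', hp⟩ := hSum (aH + 1)
  obtain ⟨aW, aS, κ, w, hset⟩ := hset p.regBound w'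
  obtain ⟨C, hC, htime⟩ := exists_time_bound κ (2 * (k + 3) * (k + 3) * y) (nA + k) k
    (abs_nonneg C') (show 1 ≤ E - ε₀ by linarith) (show 0 < ε₀ / 2 by linarith)
  refine ⟨WordRAM.reductionProg (k + l) k aM aH aS (2 * (k + 3) * (k + 3) * y) (nA + k)
      (WordRAM.roundProg (k + l) k
        (fun i => WordRAM.packedValE (k + l) (k + 3) τ (WordRAM.toIndex hk0 i))
        (fun i => WordRAM.digE (k + l) (nA + i)) (WordRAM.packedTargetE (k + l) (k + 3) τ)
        (WordRAM.checkE (k + l) F) p), w, C * (2 * (k + 2)) ^ (E - ε₀ / 2), fun I σ hU hσ => ?_⟩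
  obtain ⟨n, hn⟩ : ∃ n : ℕ → ℕ, n = fun i => (I.A (WordRAM.toIndex hk0 i)).card := ⟨_, rfl⟩
  obtain ⟨N, hN⟩ : ∃ N, N = 2 + ∑ i ∈ Finset.range k, n i := ⟨_, rfl⟩
  have hN2 : 2 ≤ N := by omega
  obtain ⟨X₀, Y, X₁, Y₁, X, hS, hr, hkW, hNW, hw', hHN⟩ := hset I σ hU hσ n N hn hN
  set Tc : ℕ := ⌊|C'| * (2 * N : ℝ) ^ (E - ε₀)⌋₊ with hTc
  have hrun := hS.run hψ (p := p) (Tc := Tc) hr hkW hNW ?_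
  · obtain ⟨T, σ', hex, hT, hres⟩ := hrun
    refine ⟨T, σ', hex, ?_, hres⟩
    have h1 := htime N Tc hN2 (Nat.floor_le (by positivity))
    have h2 : (T : ℝ) ≤ C * (2 * N : ℝ) ^ (E - ε₀ + ε₀ / 2) := by
      refine le_trans ?_ h1
      have h3 : (2 * (k + 3) * (k + 3) * (y * Nat.size N)) =
        2 * (k + 3) * (k + 3) * y * Nat.size N := by ring
      rw [h3] at hT
      exact_mod_cast hT
    have h4 : (2 * N : ℝ) ≤ 2 * (k + 2) * max (I.size : ℝ) 1 := by
      -- N is linear in the input size; the maximum with 1 covers the empty input.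
      have h5 : N ≤ (k + 2) * max I.size 1 := by
        have h6 := WordRAM.total_le hn hN
        have h7 : I.size ≤ max I.size 1 := le_max_left _ _
        have h8 : 1 ≤ max I.size 1 := le_max_right _ _
        nlinarith
      have h9 : (N : ℝ) ≤ (k + 2) * max (I.size : ℝ) 1 := by exact_mod_cast h5
      linarith
    have h10 : E - ε₀ + ε₀ / 2 = E - ε₀ / 2 := by ring
    rw [h10] at h2
    refine h2.trans ?_
    rw [mul_assoc, ← Real.mul_rpow (by positivity) (by positivity)]
    exact mul_le_mul_of_nonneg_left
      (Real.rpow_le_rpow (by positivity) h4 (by linarith)) hC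
  · intro S t hcard hval ht σ₁ hσ₁
    -- The padding provides this lower bound, which puts the instance into the universe of `p`; the
    -- upper bound 2 N controls words and time of the call.
    have hJ1 := le_size_kSumInput hk0 (t := t) fun i => (hcard i).1
    have hJ2 := size_kSumInput_le (t := t) fun i => (hcard i).2
    have hbig : (N : ℤ) ^ aH + N ≤ ((kSumInput S t).size : ℤ) ^ (aH + 1) :=
      hHN.trans (pow_le_pow_left₀ (by positivity) (by exact_mod_cast hJ1) _)
    obtain ⟨T, σ', hex, hT, hres⟩ := hp _ σ₁ (inUniverse_kSumInput
      (fun i v hv => (hval i v hv).trans hbig) (ht.trans hbig)) hσ₁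
    refine ⟨T, σ', hex.mono ?_, ?_, hres⟩
    · refine le_trans ?_ hw'
      have : (kSumInput S t).size + 2 ≤ 2 * N + 2 := by omega
      exact_mod_cast Nat.pow_le_pow_left this w'
    · refine Nat.le_floor (hT.trans ?_)
      have h1 : (1 : ℝ) ≤ max ((kSumInput S t).size : ℝ) 1 := le_max_right _ _
      have h2 : max ((kSumInput S t).size : ℝ) 1 ≤ 2 * N :=
        max_le (by exact_mod_cast hJ2) (by exact_mod_cast (by omega : 1 ≤ 2 * N))
      calc _ ≤ |C'| * (max ((kSumInput S t).size : ℝ) 1) ^ (E - ε) :=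
            mul_le_mul_of_nonneg_right (le_abs_self _) (by positivity)
        _ ≤ |C'| * (2 * N : ℝ) ^ (E - ε₀) := by
            refine mul_le_mul_of_nonneg_left ?_ (abs_nonneg _)
            -- E - ε may be negative, where powers decrease in the base; the exponent is therefore
            -- raised to E - ε₀ before the base is enlarged.
            exact (Real.rpow_le_rpow_of_exponent_le h1 (by linarith)).trans
              (Real.rpow_le_rpow (by positivity) h2 (by linarith))
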